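/- Formulas of the modal $\mu$-calculus are $\bot,\top,p,\neg p,X,\psi\wedge\chi,\psi\vee\chi,\langle a\rangle\psi,[a]\psi,\mu X.\psi,\nu X.\psi$ ($p$ a proposition, $a$ an action, $X$ a variable), interpreted over Kripke structures; $\varphi$ is satisfiable if it holds at some state of some Kripke structure. Let $\varphi$ be closed, guarded (a modal operator lies between each variable occurrence and its binder), clean (all bound variables are distinct) and irredundant ($X$ is free in $\psi$ for each subformula $\eta X.\psi$). Let $n=|\varphi|$ be its number of symbols. The alternation level of a bound variable $X$ is the number of alternations, counted from an imaginary initial $\nu$, in the sequence of nested fixpoint operators from the innermost closed fixpoint subformula containing the binder of $X$ down to that binder; the alternation depth of $\varphi$ is the maximum of these levels, and $k$ is the maximum of $1$ and the alternation depth. A subformula contains an active $\mu$-variable if repeatedly replacing free $\nu$-variables by their binding fixpoint formulas turns it into a formula with a free $\mu$-variable of $\varphi$. A modal group is a conjunction $\langle a\rangle\psi_1\wedge\dots\wedge\langle a\rangle\psi_m\wedge[a](\psi_1\vee\dots\vee\psi_m)$, $m\ge1$. The formula $\varphi$ is weakly aconjunctive if every conjunction occurring in $\varphi$ is (part of) a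 modal group or has at most one conjunct that contains an active $\mu$-variable; this covers the conjunctions $\psi\wedge\gamma$ with $\gamma$ a modal group and $\psi$ without active $\mu$-variables. In a finite parity game, edges carry priorities; a player who cannot move loses, and Eloise wins an infinite play iff the highest priority occurring infinitely often is even. To each formula $\varphi$ one explicitly and effectively associates a finite parity game $\mathcal G(\varphi)$, the permutation game. Its nodes are pairs $(U,l)$ of a subset $U$ of the Fischer--Ladner closure of $\varphi$ and a non-repetitive list $l$ of pairs $(\alpha,i)$ with $\alpha\in U$ and $2i+1$ at most the alternation depth. Its moves apply the tableau rules to $U$ (Abelard chooses the instance of the modal rule, Eloise chooses between disjuncts, and Eloise is stuck if $U$ contains $\bot$ or some $p,\neg p$), with modal groups handled by the modal rule as a whole, and track the members of $l$ through the rule application. The priorities report the oldest entry of $l$ that is removed (even) or for which a least fixpoint of level $2i+1$ is unfolded (odd). Theorem. There is an absolute constant $C$ such that for every closed, guarded, clean, irredundant and weakly aconjunctive formula $\varphi$, with $n$ and $k$ as above: (1) $\mathcal G(\varphi)$ has at most $C\cdot(nk)!$ nodes, and all its priorities are less than $C\cdot nk$; (2) Eloise has a memoryless winning strategy in $\mathcal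 G(\varphi)$ from its initial node $(\{\varphi\},[\,])$ if and only if $\varphi$ is satisfiable; (3) hence satisfiability is decided by solving these games: the nested fixpoint iteration algorithm for finite parity games, applied to $\mathcal G(\varphi)$ at $(\{\varphi\},[\,])$, returns true if and only if Eloise wins this node, that is, if and only if $\varphi$ is satisfiable. -/

import Mathlib

/-! # The modal `μ`-calculus, its weakly aconjunctive fragment, parity games, permutation games -/

namespace MuCalc

universe u v w x

/-- The two fixpoint operators. -/
inductive FixKind where
  | mu
  | nu
deriving DecidableEq

/-- Formulas of the `μ`-calculus over propositions `P`, actions `A` and fixpoint variables `X`. -/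
inductive Formula (P : Type u) (A : Type v) (X : Type w) where
  | bot : Formula P A X
  | top : Formula P A X
  | prop : P → Formula P A X
  | nprop : P → Formula P A X
  | var : X → Formula P A X
  | and : Formula P A X → Formula P A X → Formula P A X
  | or : Formula P A X → Formula P A X → Formula P A X
  | dia : A → Formula P A X → Formula P A X
  | box : A → Formula P A X → Formula P A X
  | fix : FixKind → X → Formula P A X → Formula P A X
deriving DecidableEq

/-- Kripke structures: a set of states, one accessibility relation per action, a valuation. -/
structure Kripke (P : Type u) (A : Type v) (W : Type x) where
  rel : A → W → W → Prop
  val : P → Set W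

namespace Formula

variable {P : Type u} {A : Type v} {X : Type w}

/-- Size: the number of symbols (a binder `ηX.` counts as one symbol). -/
def size : Formula P A X → ℕ
  | bot => 1
  | top => 1
  | prop _ => 1
  | nprop _ => 1
  | var _ => 1
  | and α β => α.size + β.size + 1
  | or α β => α.size + β.size + 1
  | dia _ α => α.size + 1
  | box _ α => α.size + 1
  | fix _ _ α => α.size + 1

/-- All subformulas (with repetitions), the formula itself included. -/
def subs : Formula P A X → List (Formula P A X)
  | bot => [bot]
  | top => [top]
  | prop p => [prop p]
  | nprop p => [nprop p]
  | var x => [var x]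
  | and α β => and α β :: (α.subs ++ β.subs)
  | or α β => or α β :: (α.subs ++ β.subs)
  | dia a α => dia a α :: α.subs
  | box a α => box a α :: α.subs
  | fix η x α => fix η x α :: α.subs

/-- The variables bound in a formula, one entry per occurrence of a binder. -/
def bound : Formula P A X → List X
  | and α β => α.bound ++ β.bound
  | or α β => α.bound ++ β.bound
  | dia _ α => α.bound
  | box _ α => α.bound
  | fix _ x α => x :: α.bound
  | _ => []

variable [DecidableEq X]

/-- Free variables. -/
def fv : Formula P A X → Finset X
  | var x => {x}
  | and α β => α.fv ∪ β.fv
  | or α β => α.fv ∪ β.fv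
  | dia _ α => α.fv
  | box _ α => α.fv
  | fix _ x α => α.fv.erase x
  | _ => ∅

/-- Free variables with a free occurrence that is not under any modal operator. -/
def ufv : Formula P A X → Finset X
  | var x => {x}
  | and α β => α.ufv ∪ β.ufv
  | or α β => α.ufv ∪ β.ufv
  | fix _ x α => α.ufv.erase x
  | _ => ∅

/-- The meaning of a formula under an interpretation `i` of the variables. For the (monotone)
map given by the body, the intersection of all pre-fixpoints is the least fixpoint and the union
of all post-fixpoints is the greatest fixpoint. -/
def sem {W : Type x} (K : Kripke P A W) : Formula P A X → (X → Set W) → Set W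
  | bot, _ => ∅
  | top, _ => Set.univ
  | prop p, _ => K.val p
  | nprop p, _ => (K.val p)ᶜ
  | var y, i => i y
  | and α β, i => α.sem K i ∩ β.sem K i
  | or α β, i => α.sem K i ∪ β.sem K i
  | dia a α, i => {s | ∃ t, K.rel a s t ∧ t ∈ α.sem K i}
  | box a α, i => {s | ∀ t, K.rel a s t → t ∈ α.sem K i}
  | fix .mu y α, i => ⋂₀ {S | α.sem K (Function.update i y S) ⊆ S}
  | fix .nu y α, i => ⋃₀ {S | S ⊆ α.sem K (Function.update i y S)}

/-- Some state of some Kripke structure satisfies the formula. -/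
def Satisfiable (φ : Formula P A X) : Prop :=
  ∃ (W : Type x) (K : Kripke P A W) (i : X → Set W) (s : W), s ∈ φ.sem K i

def Closed (φ : Formula P A X) : Prop := φ.fv = ∅

/-- Between each occurrence of a variable and its binder there is a modal operator. -/
def Guarded (φ : Formula P A X) : Prop :=
  ∀ η x ψ, fix η x ψ ∈ φ.subs → x ∉ ψ.ufv

/-- Bound variables are mutually distinct and distinct from the free ones. -/
def Clean (φ : Formula P A X) : Prop := φ.bound.Nodup ∧ ∀ x ∈ φ.bound, x ∉ φ.fv

/-- Every binder binds something. -/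
def Irredundant (φ : Formula P A X) : Prop :=
  ∀ η x ψ, fix η x ψ ∈ φ.subs → x ∈ ψ.fv

/-- The binder and the body of the bound variable `x` of `φ` (unique if `φ` is clean). -/
def binder (φ : Formula P A X) (x : X) : Option (FixKind × Formula P A X) :=
  φ.subs.findSome? fun
    | fix η y ψ => if y = x then some (η, ψ) else none
    | _ => none

/-! ### Alternation level and alternation depth -/

mutual
/-- Alternation level of a sequence of nested fixpoint operators, listed from the outermost to
the innermost one. -/
def al : List FixKind → ℕ
  | [] => 0
  | .mu :: σ => alMu σ + 1
  | .nu :: σ => alNu σ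
def alMu : List FixKind → ℕ
  | [] => 0
  | .mu :: σ => alMu σ
  | .nu :: σ => alNu σ + 1
def alNu : List FixKind → ℕ
  | [] => 0
  | .nu :: σ => alNu σ
  | .mu :: σ => alMu σ + 1
end

/-- Lists each bound variable `x` with the alternation level of the nested sequence of fixpoint
operators that ends in the binder `ηx.ψ` of `x` and starts at the innermost *closed* fixpoint
formula that contains this binder (so that all later members of the sequence are open).
The argument `σ` is the current sequence. -/
def levels (σ : List FixKind) : Formula P A X → List (X × ℕ)
  | and α β => α.levels σ ++ β.levels σ
  | or α β => α.levels σ ++ β.levels σ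
  | dia _ α => α.levels σ
  | box _ α => α.levels σ
  | fix η x α =>
      let σ' := if α.fv.erase x = ∅ then [η] else σ ++ [η]
      (x, al σ') :: α.levels σ'
  | _ => []

/-- Alternation depth: the largest alternation level. -/
def ad (φ : Formula P A X) : ℕ := ((φ.levels []).map Prod.snd).foldr max 0

/-- The alternation level of the bound variable `x` of `φ`; it is odd iff `x` is a
`μ`-variable. -/
def level (φ : Formula P A X) (x : X) : ℕ := ((φ.levels []).lookup x).getD 0

/-! ### Active `μ`-variables and weak aconjunctivity -/

/-- Does unfolding `ν`-variables turn the variable `x` of `φ` into a formula with a free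
`μ`-variable of `φ`? The first argument bounds the number of nested unfoldings. -/
def activeVar (φ : Formula P A X) : ℕ → X → Bool
  | 0, _ => false
  | m + 1, x =>
    match φ.binder x with
    | some (.mu, _) => true
    | some (.nu, ψ) => decide (∃ y ∈ ψ.fv.erase x, activeVar φ m y = true)
    | none => false

/-- The subformula `α` of `φ` contains an active `μ`-variable: repeated unfolding of
`ν`-variables of `φ` turns it into a formula with a free `μ`-variable of `φ`. (Each unfolding
leads to variables bound further outside, so `φ.size` nested unfoldings suffice.) -/
def active (φ α : Formula P A X) : Bool :=
  decide (∃ x ∈ α.fv, φ.activeVar φ.size x = true)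

variable [DecidableEq P] [DecidableEq A]

/-- `ψ` is one of the disjuncts of `χ`, read as a disjunction with any bracketing. -/
def isDisjunct (ψ : Formula P A X) : Formula P A X → Bool
  | or α β => ψ = or α β || ψ.isDisjunct α || ψ.isDisjunct β
  | χ => ψ = χ

/-- `χ` is built by disjunction from members of `ds`. -/
def coveredBy (ds : List (Formula P A X)) : Formula P A X → Bool
  | or α β => or α β ∈ ds || (coveredBy ds α && coveredBy ds β)
  | χ => χ ∈ ds

/-- The conjuncts of a formula, read as a conjunction with any bracketing. -/
def conjuncts : Formula P A X → List (Formula P A X)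
  | and α β => α.conjuncts ++ β.conjuncts
  | χ => [χ]

/-- The arguments of the members `⟨a⟩ψ` of a list. -/
def diaArgs (l : List (Formula P A X)) : List (A × Formula P A X) :=
  l.filterMap fun
    | dia a ψ => some (a, ψ)
    | _ => none

/-- The arguments of the members `[a]ψ` of a list. -/
def boxArgs (l : List (Formula P A X)) : List (A × Formula P A X) :=
  l.filterMap fun
    | box a ψ => some (a, ψ)
    | _ => none

/-- Recognizes the conjunctions `⟨a⟩ψ₁ ∧ … ∧ ⟨a⟩ψₙ ∧ [a](ψ₁ ∨ … ∨ ψₙ)` with `n ≥ 1` (in any order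
and with any bracketing) and returns `a`, the list of the `ψᵢ`, and `ψ₁ ∨ … ∨ ψₙ`. -/
def modalGroup (γ : Formula P A X) : Option (A × List (Formula P A X) × Formula P A X) :=
  let cs := γ.conjuncts
  let ds := (diaArgs cs).map Prod.snd
  match boxArgs cs with
  | [(a, χ)] =>
    if ds ≠ [] ∧ cs.length = ds.length + 1 ∧ (∀ d ∈ diaArgs cs, d.1 = a) ∧
        (∀ d ∈ ds, d.isDisjunct χ = true) ∧ coveredBy ds χ = true
    then some (a, ds, χ) else none
  | _ => none

/-- Every conjunction in the formula either is (part of) a modal group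
`⟨a⟩ψ₁ ∧ … ∧ ⟨a⟩ψₙ ∧ [a](ψ₁ ∨ … ∨ ψₙ)`, or at most one of its two conjuncts contains an active
`μ`-variable of `φ`. The flag `g` tells that an enclosing conjunction is a modal group. -/
def weaklyAconjunctiveIn (φ : Formula P A X) (g : Bool) : Formula P A X → Prop
  | and α β =>
      let g' := g || (modalGroup (and α β)).isSome
      (g' = true ∨ ¬ (φ.active α = true ∧ φ.active β = true)) ∧
        weaklyAconjunctiveIn φ g' α ∧ weaklyAconjunctiveIn φ g' β
  | or α β => weaklyAconjunctiveIn φ false α ∧ weaklyAconjunctiveIn φ false β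
  | dia _ α => weaklyAconjunctiveIn φ false α
  | box _ α => weaklyAconjunctiveIn φ false α
  | fix _ _ α => weaklyAconjunctiveIn φ false α
  | _ => True

/-- Weak aconjunctivity: a conjunction with active `μ`-variables in more than one conjunct must be
of the shape `⟨a⟩ψ₁ ∧ … ∧ ⟨a⟩ψₙ ∧ [a](ψ₁ ∨ … ∨ ψₙ)`. This covers the conjunctions
`ψ ∧ (⟨a⟩ψ₁ ∧ … ∧ ⟨a⟩ψₙ ∧ [a](ψ₁ ∨ … ∨ ψₙ))` where `ψ` contains no active `μ`-variable, as well as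
all aconjunctive formulas. -/
def WeaklyAconjunctive (φ : Formula P A X) : Prop := weaklyAconjunctiveIn φ false φ

end Formula

/-! ### Parity games -/

/-- A finite parity game. A move `(p, w) ∈ moves v` is an edge from `v` to `w` of priority `p`
(edges with different priorities may be parallel). -/
structure ParityGame (N : Type x) where
  nodes : Finset N
  /-- does the node belong to Eloise (or else to Abelard)? -/
  eloise : N → Bool
  moves : N → Finset (ℕ × N)
  closed : ∀ v ∈ nodes, ∀ m ∈ moves v, m.2 ∈ nodes

namespace ParityGame

variable {N : Type x}

/-- `m` is a move at `u`, and it is the one chosen by `s` if `u` belongs to Eloise. -/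
def Conforms (G : ParityGame N) (s : N → ℕ × N) (u : N) (m : ℕ × N) : Prop :=
  m ∈ G.moves u ∧ (G.eloise u = true → m = s u)

/-- Eloise has a (memoryless) winning strategy `s` for `v`: each play that starts at `v` and
conforms to `s` gets stuck, if at all, at a node of Abelard, and if it is infinite, then the
highest priority that occurs infinitely often in it is even. -/
def EloiseWins (G : ParityGame N) (v : N) : Prop :=
  ∃ s : N → ℕ × N,
    (∀ u, Relation.ReflTransGen (fun a b => ∃ p, G.Conforms s a (p, b)) v u →
      (∀ m, ¬ G.Conforms s u m) → G.eloise u = false) ∧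
    ∀ (ρ : ℕ → N) (π : ℕ → ℕ), ρ 0 = v → (∀ i, G.Conforms s (ρ i) (π i, ρ (i + 1))) →
      ∃ p, Even p ∧ (∃ᶠ i in Filter.atTop, π i = p) ∧ ∀ᶠ i in Filter.atTop, π i ≤ p

variable [DecidableEq N]

/-- An upper bound for all priorities of the game (its index). -/
def index (G : ParityGame N) : ℕ := G.nodes.sup fun v => (G.moves v).sup Prod.fst

/-- Nested fixpoint iteration; the priorities `≥ p` have been assigned the sets `env`. -/
def solveAux (G : ParityGame N) : ℕ → (ℕ → Finset N) → Finset N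
  | 0, env => G.nodes.filter fun v =>
      if G.eloise v = true then ∃ m ∈ G.moves v, m.2 ∈ env m.1
      else ∀ m ∈ G.moves v, m.2 ∈ env m.1
  | p + 1, env =>
      (fun S => G.solveAux p (Function.update env p S))^[G.nodes.card]
        (if p % 2 = 0 then G.nodes else ∅)

/-- The fixpoint iteration algorithm for solving a finite parity game at a node. -/
def solve (G : ParityGame N) (v : N) : Bool :=
  decide (v ∈ G.solveAux (G.index + 1) fun _ => ∅)

end ParityGame

/-! ### Partial permutations -/

section Pperm

variable {T : Type x} [DecidableEq T]

/-- The partial permutations (non-repetitive lists) over a finite set. -/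
def pperm (U : Finset T) : Finset (List T) := U.powerset.biUnion fun S => S.val.lists.toFinset

theorem mem_pperm {U : Finset T} {l : List T} : l ∈ pperm U ↔ l.Nodup ∧ ∀ y ∈ l, y ∈ U := by
  simp only [pperm, Finset.mem_biUnion, Finset.mem_powerset, Multiset.mem_toFinset,
    Multiset.mem_lists_iff]
  constructor
  · rintro ⟨S, hS, h⟩
    have hn := S.nodup
    rw [h] at hn
    refine ⟨hn, fun y hy => hS ?_⟩
    rw [← Finset.mem_val, h]
    exact hy
  · rintro ⟨hn, h⟩
    refine ⟨l.toFinset, fun y hy => h y (by simpa using hy), ?_⟩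
    simp [List.dedup_eq_self.2 hn]

/-- Makes each entry undefined that repeats an earlier one (or a member of `seen`). -/
def dropRepeats (seen : List T) : List (Option T) → List (Option T)
  | [] => []
  | none :: t => none :: dropRepeats seen t
  | some y :: t => if y ∈ seen then none :: dropRepeats seen t
      else some y :: dropRepeats (y :: seen) t

/-- The entries of the next partial permutation: keep the defined entries in order, then add the
new members `fresh` that do not occur yet. -/
def nextPerm (t : List (Option T)) (fresh : List T) : List T :=
  let kept := t.reduceOption
  kept ++ (fresh.filter fun y => y ∉ kept)

/-- The priority of the transition from `l` to the list `t` (as it is before the undefined entries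
are removed), where `hit` marks the accepting transitions and `q` bounds the length of the lists:
if the oldest entry that is removed is older than the oldest entry that is active, the priority
is even, otherwise odd; older entries give higher priorities; it is `0` if nothing happens. -/
def permPriority (q : ℕ) (l : List T) (t : List (Option T)) (hit : T → Bool) : ℕ :=
  let r := t.findIdx Option.isNone
  let a := (l.zip t).findIdx fun z => z.2.isSome && hit z.1
  if r < l.length ∨ a < l.length then
    if r ≤ a then 2 * (q - r) else 2 * (q - a) - 1
  else 0

theorem reduceOption_dropRepeats (t : List (Option T)) : ∀ seen : List T,
    (dropRepeats seen t).reduceOption.Nodup ∧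
      ∀ y ∈ (dropRepeats seen t).reduceOption, y ∉ seen ∧ some y ∈ t := by
  induction t with
  | nil => intro seen; simp [dropRepeats]
  | cons o t ih =>
    intro seen
    cases o with
    | none =>
      have := ih seen
      simp only [dropRepeats, List.reduceOption_cons_of_none]
      exact ⟨this.1, fun y hy => ⟨(this.2 y hy).1, List.mem_cons_of_mem _ (this.2 y hy).2⟩⟩
    | some z =>
      by_cases hz : z ∈ seen
      · have := ih seen
        simp only [dropRepeats, hz, if_true, List.reduceOption_cons_of_none]
        exact ⟨this.1, fun y hy => ⟨(this.2 y hy).1, List.mem_cons_of_mem _ (this.2 y hy).2⟩⟩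
      · have := ih (z :: seen)
        simp only [dropRepeats, hz, if_false, List.reduceOption_cons_of_some, List.nodup_cons]
        refine ⟨⟨fun h => (this.2 z h).1 (by simp), this.1⟩, fun y hy => ?_⟩
        rcases List.mem_cons.1 hy with rfl | hy
        · exact ⟨hz, by simp⟩
        · exact ⟨fun h => (this.2 y hy).1 (List.mem_cons_of_mem _ h),
            List.mem_cons_of_mem _ (this.2 y hy).2⟩

theorem nextPerm_mem {U : Finset T} {t : List (Option T)} {fresh : List T}
    (ht : ∀ y, some y ∈ t → y ∈ U) (hf : fresh.Nodup) (hfU : ∀ y ∈ fresh, y ∈ U) :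
    nextPerm (dropRepeats [] t) fresh ∈ pperm U := by
  have h := reduceOption_dropRepeats t []
  rw [mem_pperm]
  simp only [nextPerm]
  constructor
  · refine List.nodup_append.2 ⟨h.1, hf.filter _, ?_⟩
    intro a ha b hb hab
    subst hab
    simp [ha] at hb
  · intro y hy
    rcases List.mem_append.1 hy with hy | hy
    · exact ht y (h.2 y hy).2
    · exact hfU y (List.mem_filter.1 hy).1

end Pperm

/-! ### Permutation games -/

namespace Formula

variable {P : Type u} {A : Type v} {X : Type w}
variable [DecidableEq P] [DecidableEq A] [DecidableEq X]

/-- The number of odd alternation levels `2i + 1` of `φ`; the levels are the `i < numLevels`. -/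
def numLevels (φ : Formula P A X) : ℕ := (φ.ad + 1) / 2

/-- The levelled formulas over a set of formulas. -/
def levelled (φ : Formula P A X) (U : Finset (Formula P A X)) : Finset (Formula P A X × ℕ) :=
  U ×ˢ Finset.range φ.numLevels

/-- Nodes of the permutation game: a label and a partial permutation of levelled formulas. -/
abbrev PNode (P : Type u) (A : Type v) (X : Type w) : Type (max u v w) :=
  Finset (Formula P A X) × List (Formula P A X × ℕ)

instance instDecidableEqMove : DecidableEq (ℕ × PNode P A X) := instDecidableEqProd

/-- A member of the Fischer-Ladner closure of `φ` arises from a subformula of `φ` by replacing the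
free variables by their fixpoint literals, and is represented by this subformula. The nodes of
the permutation game are the labels `U` (sets of formulas from the closure) with a partial
permutation of levelled members of `U`. -/
def permNodes (φ : Formula P A X) : Finset (PNode P A X) :=
  φ.subs.toFinset.powerset.biUnion fun U => (pperm (φ.levelled U)).image fun l => (U, l)

/-- The label contains `⊥` or some `p` and `¬p`. -/
def clash (U : Finset (Formula P A X)) : Bool :=
  decide (∃ α ∈ U, (match α with
    | bot => true
    | prop p => decide (nprop p ∈ U)
    | _ => false) = true)

/-- Formulas to which a propositional rule or the fixpoint rule applies. Modal groups are not
decomposed by the conjunction rule but only by the modal rule. -/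
def reducible : Formula P A X → Bool
  | var _ => true
  | and α β => (modalGroup (and α β)).isNone
  | or _ _ => true
  | fix _ _ _ => true
  | _ => false

/-- The principal formula chosen for a label, if the label is not saturated. -/
def principal (φ : Formula P A X) (U : Finset (Formula P A X)) : Option (Formula P A X) :=
  φ.subs.find? fun α => decide (α ∈ U) && α.reducible

/-- The conclusions of the rule for a principal formula: for each conclusion, the formulas that
replace the principal formula, and the one by which it is replaced when it is being tracked. A
tracked conjunction continues as a conjunct that contains an active `μ`-variable. The fixpoint
rule replaces `ηx.ψ`, or the variable `x` that stands for it, by `ψ`. -/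
def conclusions (φ : Formula P A X) :
    Formula P A X → List (Finset (Formula P A X) × Option (Formula P A X))
  | and α β => [({α, β},
      if φ.active α = true then some α else if φ.active β = true then some β else none)]
  | or α β => [({α}, some α), ({β}, some β)]
  | fix _ _ ψ => [({ψ}, some ψ)]
  | var x => match φ.binder x with
    | some (_, ψ) => [({ψ}, some ψ)]
    | none => []
  | _ => []

/-- The alternation level of the fixpoint that is unfolded by the rule for a principal formula. -/
def unfoldLevel (φ : Formula P A X) : Formula P A X → Option ℕ
  | fix _ x _ => some (φ.level x)
  | var x => some (φ.level x)
  | _ => none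

/-- How a levelled formula `(α, i)` is tracked through the rule application to the principal
formula `β`, with tracked conclusion `o`: a formula other than `β` stays, and `β` becomes `o`
unless this unfolds a fixpoint of alternation level below `2i + 1`. -/
def trackLocal (φ β : Formula P A X) (o : Option (Formula P A X)) (y : Formula P A X × ℕ) :
    Option (Formula P A X × ℕ) :=
  if y.1 = β then
    if ∃ k ∈ φ.unfoldLevel β, k < 2 * y.2 + 1 then none else o.map fun α => (α, y.2)
  else some y

/-- The levelled formula `(α, i)` is active when the principal formula is `β`: it is `β`, and a
fixpoint of alternation level exactly `2i + 1` is unfolded. -/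
def hitLocal (φ β : Formula P A X) (y : Formula P A X × ℕ) : Bool :=
  decide (y.1 = β ∧ φ.unfoldLevel β = some (2 * y.2 + 1))

/-- When a least fixpoint is unfolded, a new levelled formula appears. -/
def freshLocal (φ β : Formula P A X) (o : Option (Formula P A X)) : List (Formula P A X × ℕ) :=
  match φ.unfoldLevel β, o with
  | some k, some α => if k % 2 = 1 then [(α, k / 2)] else []
  | _, _ => []

/-- The diamonds `⟨a⟩ξ` offered by a formula: a modal literal `⟨a⟩ξ`, or those of a modal group. -/
def diamonds (α : Formula P A X) : Finset (A × Formula P A X) :=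
  match α with
  | dia a ξ => {(a, ξ)}
  | and β γ => match modalGroup (and β γ) with
    | some (a, ds, _) => ds.toFinset.image fun ξ => (a, ξ)
    | none => ∅
  | _ => ∅

/-- What becomes of a formula under the modal rule with principal formula `⟨a⟩ξ`: `[a]χ` becomes
`χ`, and a modal group `⟨a⟩ψ₁ ∧ … ∧ ⟨a⟩ψₙ ∧ [a](ψ₁ ∨ … ∨ ψₙ)` becomes `ξ` if `ξ` is one of the
`ψᵢ`, and `ψ₁ ∨ … ∨ ψₙ` otherwise. -/
def modalNext (a : A) (ξ : Formula P A X) : Formula P A X → Option (Formula P A X)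
  | dia b ψ => if b = a ∧ ψ = ξ then some ξ else none
  | box b χ => if b = a then some χ else none
  | and α β => match modalGroup (and α β) with
    | some (b, ds, χ) => if b = a then (if ξ ∈ ds then some ξ else some χ) else none
    | none => none
  | _ => none

/-- A move of the permutation game, from the old partial permutation, the new label, and the
tracking data. -/
def permMove (φ : Formula P A X) (l : List (Formula P A X × ℕ)) (U' : Finset (Formula P A X))
    (track : Formula P A X × ℕ → Option (Formula P A X × ℕ)) (hit : Formula P A X × ℕ → Bool)
    (fresh : List (Formula P A X × ℕ)) : ℕ × PNode P A X :=
  let t := dropRepeats [] (l.map track)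
  (permPriority (φ.subs.toFinset.card * φ.numLevels) l t hit, (U', nextPerm t fresh))

/-- The moves of the permutation game. At an unsaturated label the rule for the chosen principal
formula is applied; at a saturated label the modal rule is applied to some diamond. There are no
moves if the label contains a clash. -/
def permMoves (φ : Formula P A X) (v : PNode P A X) : Finset (ℕ × PNode P A X) :=
  if clash v.1 = true then ∅ else
  match φ.principal v.1 with
  | some β => ((φ.conclusions β).map fun c =>
      φ.permMove v.2 (v.1.erase β ∪ c.1) (φ.trackLocal β c.2) (φ.hitLocal β)
        (φ.freshLocal β c.2)).toFinset
  | none => (v.1.biUnion diamonds).image fun d =>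
      φ.permMove v.2 (insert d.2 (v.1.biUnion fun α => (modalNext d.1 d.2 α).toFinset))
        (fun y => (modalNext d.1 d.2 y.1).map fun α => (α, y.2)) (fun _ => false) []

/-- Eloise owns the labels with a clash (where she is stuck) and the labels with a disjunction as
principal formula; Abelard owns all others. -/
def permEloise (φ : Formula P A X) (v : PNode P A X) : Bool :=
  clash v.1 || match φ.principal v.1 with
    | some (or _ _) => true
    | _ => false

/-! The moves of the permutation game stay within its nodes. -/

set_option linter.unusedSectionVars false

theorem self_mem_subs (φ : Formula P A X) : φ ∈ φ.subs := by
  cases φ <;> simp [subs]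

theorem subs_trans {φ ψ χ : Formula P A X} (h : ψ ∈ χ.subs) (hφ : φ ∈ ψ.subs) : φ ∈ χ.subs := by
  induction χ with
  | bot | top | prop | nprop | var =>
    simp only [subs, List.mem_singleton] at h
    subst h; exact hφ
  | and α β ihα ihβ | or α β ihα ihβ =>
    simp only [subs, List.mem_cons, List.mem_append] at h ⊢
    rcases h with rfl | h | h
    · simpa [subs] using hφ
    · exact Or.inr (Or.inl (ihα h))
    · exact Or.inr (Or.inr (ihβ h))
  | dia a α ih | box a α ih =>
    simp only [subs, List.mem_cons] at h ⊢
    rcases h with rfl | h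
    · simpa [subs] using hφ
    · exact Or.inr (ih h)
  | fix η x α ih =>
    simp only [subs, List.mem_cons] at h ⊢
    rcases h with rfl | h
    · simpa [subs] using hφ
    · exact Or.inr (ih h)

theorem conjuncts_subset_subs (γ : Formula P A X) : ∀ α ∈ γ.conjuncts, α ∈ γ.subs := by
  induction γ with
  | and α β ihα ihβ =>
    intro δ h
    simp only [conjuncts, List.mem_append, subs, List.mem_cons] at h ⊢
    exact Or.inr (h.imp (ihα δ) (ihβ δ))
  | _ =>
    intro δ h
    simp only [conjuncts, List.mem_singleton] at h
    subst h
    simp [subs]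

theorem mem_subs_of_modalGroup {γ χ : Formula P A X} {a : A} {ds : List (Formula P A X)}
    (h : modalGroup γ = some (a, ds, χ)) : χ ∈ γ.subs ∧ ∀ d ∈ ds, d ∈ γ.subs := by
  have hbox : ∀ p ∈ boxArgs γ.conjuncts, p.2 ∈ γ.subs := by
    intro p hp
    simp only [boxArgs, List.mem_filterMap] at hp
    obtain ⟨α, hα, hp⟩ := hp
    cases α <;> simp at hp
    subst hp
    exact subs_trans (conjuncts_subset_subs γ _ hα) (by simp [subs, self_mem_subs])
  have hdia : ∀ p ∈ diaArgs γ.conjuncts, p.2 ∈ γ.subs := by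
    intro p hp
    simp only [diaArgs, List.mem_filterMap] at hp
    obtain ⟨α, hα, hp⟩ := hp
    cases α <;> simp at hp
    subst hp
    exact subs_trans (conjuncts_subset_subs γ _ hα) (by simp [subs, self_mem_subs])
  simp only [modalGroup] at h
  split at h
  · rename_i b ψ hb
    split_ifs at h
    simp only [Option.some.injEq, Prod.mk.injEq] at h
    obtain ⟨rfl, rfl, rfl⟩ := h
    refine ⟨hbox (b, ψ) (by simp [hb]), fun d hd => ?_⟩
    obtain ⟨p, hp, rfl⟩ := List.mem_map.1 hd
    exact hdia p hp
  · simp at h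

theorem binder_mem_subs {φ ψ : Formula P A X} {x : X} {η : FixKind}
    (h : φ.binder x = some (η, ψ)) : ψ ∈ φ.subs := by
  obtain ⟨α, hα, h⟩ := List.exists_of_findSome?_eq_some h
  cases α <;> simp at h
  obtain ⟨_, rfl, rfl⟩ := h
  exact subs_trans hα (by simp [subs, self_mem_subs])

theorem modalNext_mem_subs {a : A} {ξ α β : Formula P A X} (h : modalNext a ξ α = some β) :
    β ∈ α.subs := by
  cases α with
  | dia b ψ =>
    simp only [modalNext] at h
    split_ifs at h with hc
    simp only [Option.some.injEq] at h
    rw [← h, ← hc.2]; simp [subs, self_mem_subs]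
  | box b χ =>
    simp only [modalNext] at h
    split_ifs at h with hc
    simp only [Option.some.injEq] at h
    rw [← h]; simp [subs, self_mem_subs]
  | and γ δ =>
    simp only [modalNext] at h
    split at h
    · rename_i b ds χ hg
      split_ifs at h with h1 h2
      · simp only [Option.some.injEq] at h
        exact h ▸ (mem_subs_of_modalGroup hg).2 _ h2
      · simp only [Option.some.injEq] at h
        exact h ▸ (mem_subs_of_modalGroup hg).1
    · simp at h
  | _ => simp [modalNext] at h

theorem diamonds_mem_subs {α : Formula P A X} {d : A × Formula P A X} (h : d ∈ diamonds α) :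
    d.2 ∈ α.subs := by
  cases α with
  | dia b ψ =>
    simp only [diamonds, Finset.mem_singleton] at h
    subst h; simp [subs, self_mem_subs]
  | and γ δ =>
    simp only [diamonds] at h
    split at h
    · rename_i b ds χ hg
      simp only [Finset.mem_image, List.mem_toFinset] at h
      obtain ⟨ξ, hξ, rfl⟩ := h
      exact (mem_subs_of_modalGroup hg).2 _ hξ
    · simp at h
  | _ => simp [diamonds] at h

theorem conclusions_mem {φ β : Formula P A X} (hβ : β ∈ φ.subs)
    {c : Finset (Formula P A X) × Option (Formula P A X)} (hc : c ∈ φ.conclusions β) :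
    (∀ α ∈ c.1, α ∈ φ.subs) ∧ ∀ α, c.2 = some α → α ∈ c.1 := by
  cases β with
  | and γ δ =>
    simp only [conclusions, List.mem_singleton] at hc
    subst hc
    refine ⟨fun α hα => ?_, fun α hα => ?_⟩
    · simp only [Finset.mem_insert, Finset.mem_singleton] at hα
      rcases hα with rfl | rfl <;> exact subs_trans hβ (by simp [subs, self_mem_subs])
    · dsimp only at hα ⊢
      split_ifs at hα <;> simp only [Option.some.injEq] at hα <;> subst hα <;> simp
  | or γ δ =>
    simp only [conclusions, List.mem_cons, List.not_mem_nil, or_false] at hc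
    rcases hc with rfl | rfl
    all_goals
      refine ⟨fun α hα => ?_, fun α hα => by simpa using hα.symm⟩
      simp only [Finset.mem_singleton] at hα
      subst hα
      exact subs_trans hβ (by simp [subs, self_mem_subs])
  | fix η x ψ =>
    simp only [conclusions, List.mem_singleton] at hc
    subst hc
    refine ⟨fun α hα => ?_, fun α hα => by simpa using hα.symm⟩
    simp only [Finset.mem_singleton] at hα
    subst hα
    exact subs_trans hβ (by simp [subs, self_mem_subs])
  | var x =>
    simp only [conclusions] at hc
    split at hc
    · rename_i η ψ hb
      simp only [List.mem_singleton] at hc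
      subst hc
      refine ⟨fun α hα => ?_, fun α hα => by simpa using hα.symm⟩
      simp only [Finset.mem_singleton] at hα
      subst hα
      exact binder_mem_subs hb
    · simp at hc
  | _ => simp [conclusions] at hc

theorem le_foldr_max {k : ℕ} {l : List ℕ} (h : k ∈ l) : k ≤ l.foldr max 0 := by
  induction l with
  | nil => simp at h
  | cons m l ih =>
    simp only [List.foldr_cons]
    rcases List.mem_cons.1 h with rfl | h
    · exact le_max_left _ _
    · exact le_trans (ih h) (le_max_right _ _)

theorem level_le_ad (φ : Formula P A X) (x : X) : φ.level x ≤ φ.ad := by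
  unfold level ad
  cases h : (φ.levels []).lookup x with
  | none => simp
  | some k =>
    obtain ⟨l₁, l₂, hl, -⟩ := List.lookup_eq_some_iff.1 h
    exact le_foldr_max (List.mem_map.2 ⟨(x, k), by simp [hl], rfl⟩)

theorem unfoldLevel_le_ad {φ β : Formula P A X} {k : ℕ} (h : φ.unfoldLevel β = some k) :
    k ≤ φ.ad := by
  cases β <;> simp [unfoldLevel] at h
  all_goals exact h ▸ level_le_ad _ _

theorem mem_permNodes {φ : Formula P A X} {v : PNode P A X} :
    v ∈ φ.permNodes ↔ (∀ α ∈ v.1, α ∈ φ.subs) ∧ v.2 ∈ pperm (φ.levelled v.1) := by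
  obtain ⟨U, l⟩ := v
  simp only [permNodes, Finset.mem_biUnion, Finset.mem_powerset, Finset.mem_image, Prod.mk.injEq]
  constructor
  · rintro ⟨U', hU, l', hl, rfl, rfl⟩
    exact ⟨fun α hα => by simpa using hU hα, hl⟩
  · rintro ⟨hU, hl⟩
    exact ⟨U, fun α hα => by simpa using hU α hα, l, hl, rfl, rfl⟩

theorem permMove_mem {φ : Formula P A X} {l : List (Formula P A X × ℕ)}
    {U' : Finset (Formula P A X)}
    {track : Formula P A X × ℕ → Option (Formula P A X × ℕ)} {hit : Formula P A X × ℕ → Bool}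
    {fresh : List (Formula P A X × ℕ)} (hU : ∀ α ∈ U', α ∈ φ.subs)
    (ht : ∀ y ∈ l, ∀ z, track y = some z → z ∈ φ.levelled U') (hf : fresh.Nodup)
    (hfU : ∀ y ∈ fresh, y ∈ φ.levelled U') :
    (φ.permMove l U' track hit fresh).2 ∈ φ.permNodes := by
  rw [mem_permNodes]
  refine ⟨hU, nextPerm_mem (fun z hz => ?_) hf hfU⟩
  obtain ⟨y, hy, hz⟩ := List.mem_map.1 hz
  exact ht y hy z hz

theorem permMoves_closed (φ : Formula P A X) :
    ∀ v ∈ φ.permNodes, ∀ m ∈ φ.permMoves v, m.2 ∈ φ.permNodes := by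
  intro v hv m hm
  rw [mem_permNodes, mem_pperm] at hv
  obtain ⟨hU, -, hl⟩ := hv
  simp only [levelled, Finset.mem_product, Finset.mem_range] at hl
  unfold permMoves at hm
  split_ifs at hm
  · simp at hm
  split at hm
  · rename_i β hβ
    have hβU : β ∈ v.1 := by
      have := List.find?_some hβ
      simp only [Bool.and_eq_true, decide_eq_true_eq] at this
      exact this.1
    simp only [List.mem_toFinset, List.mem_map] at hm
    obtain ⟨c, hc, rfl⟩ := hm
    have hcm := conclusions_mem (hU β hβU) hc
    refine permMove_mem ?_ ?_ ?_ ?_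
    · intro α hα
      rcases Finset.mem_union.1 hα with hα | hα
      · exact hU α (Finset.mem_of_mem_erase hα)
      · exact hcm.1 α hα
    · intro y hy z hz
      simp only [levelled, Finset.mem_product, Finset.mem_range]
      unfold trackLocal at hz
      split_ifs at hz with h1 h2
      · obtain ⟨α, hα, rfl⟩ := Option.map_eq_some_iff.1 hz
        exact ⟨Finset.mem_union_right _ (hcm.2 α hα), (hl y hy).2⟩
      · simp only [Option.some.injEq] at hz
        subst hz
        exact ⟨Finset.mem_union_left _ (Finset.mem_erase.2 ⟨h1, (hl y hy).1⟩), (hl y hy).2⟩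
    · unfold freshLocal
      split
      · split_ifs <;> simp
      · simp
    · intro y hy
      unfold freshLocal at hy
      split at hy
      · rename_i k α hk hα
        split_ifs at hy with h1
        · simp only [List.mem_singleton] at hy
          subst hy
          simp only [levelled, numLevels, Finset.mem_product, Finset.mem_range]
          have := unfoldLevel_le_ad hk
          exact ⟨Finset.mem_union_right _ (hcm.2 α hα), by omega⟩
        · simp at hy
      · simp at hy
  · simp only [Finset.mem_image, Finset.mem_biUnion] at hm
    obtain ⟨d, ⟨α, hα, hd⟩, rfl⟩ := hm
    refine permMove_mem ?_ ?_ (by simp) (by simp)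
    · intro β hβ
      rcases Finset.mem_insert.1 hβ with rfl | hβ
      · exact subs_trans (hU α hα) (diamonds_mem_subs hd)
      · obtain ⟨γ, hγ, hβ⟩ := Finset.mem_biUnion.1 hβ
        exact subs_trans (hU γ hγ) (modalNext_mem_subs (by simpa using hβ))
    · intro y hy z hz
      obtain ⟨β, hβ, rfl⟩ := Option.map_eq_some_iff.1 hz
      simp only [levelled, Finset.mem_product, Finset.mem_range]
      refine ⟨Finset.mem_insert_of_mem (Finset.mem_biUnion.2 ⟨y.1, (hl y hy).1, ?_⟩), (hl y hy).2⟩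
      simpa using hβ

/-- The permutation game for `φ`. -/
def permGame (φ : Formula P A X) : ParityGame (PNode P A X) where
  nodes := φ.permNodes
  eloise := φ.permEloise
  moves := φ.permMoves
  closed := φ.permMoves_closed

/-- The initial node: the label `{φ}` with the empty partial permutation. -/
def startNode (φ : Formula P A X) : PNode P A X := ({φ}, [])

/-- The decision procedure: construct the permutation game and solve it at the initial node. -/
def decideSat (φ : Formula P A X) : Bool := φ.permGame.solve φ.startNode

end Formula
end MuCalc

-- The proof combines positional determinacy of parity games with an analysis of threads, the
-- histories of single formulas along a play.
--
-- Determinacy. Nested fixpoints consist of positions from which positional strategies win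
-- (`Arena.nest_subset_win`), and the complement of a nested fixpoint is the nested fixpoint of the
-- dual game (`Arena.compl_nest`). On a finite game the iteration computes these fixpoints
-- (`ParityGame.mem_solveAux`). So the algorithm either returns true and Eloise wins without memory,
-- or returns false and Abelard has a positional winning strategy.
--
-- Threads. A thread is bad if the lowest level that it unfolds infinitely often is odd. In the list
-- of a node an entry only moves towards the front, when older entries are removed or merged, so a
-- bad thread that is tracked eventually keeps its place. Then it keeps producing an odd priority
-- that no even one exceeds (`idxOf_track`). Conversely, if the highest recurring priority is odd,
-- it belongs to a place whose entry survives and is active infinitely often, and this entry is a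
-- bad thread (`track_of_permPriority_le`).
--
-- From satisfiability to winning. True formulas lie in a winning region of the evaluation game
-- (`win_of_mem_sem`). Were the algorithm to return false, Eloise could answer Abelard's strategy so
-- that all formulas of the label stay true (`exists_true_move`). The resulting play has an odd
-- highest recurring priority, hence a bad thread of true formulas, contrary to the parity condition
-- of the evaluation game.
--
-- From winning to satisfiability. The saturated nodes form a Kripke structure, and `WinSet.truth`
-- shows by induction on formulas that labels are true in it. If a least fixpoint failed, some
-- thread would unfold its variable infinitely often and otherwise only variables bound inside its
-- body. Such a thread is tracked (`WinSet.track`): all formulas on it contain an active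
-- `μ`-variable (`active_of_loop`), so by weak aconjunctivity each conjunction that is decomposed
-- has only one conjunct on which the thread can continue, while modal groups are left to the modal
-- rule, which turns each into a single formula. This contradicts that Eloise wins.
--
-- The size bound rests on `∑ j ≤ s, s! / (j! (s - j)!) * (jL)! ≤ e * (sL)!`.

namespace MuCalc

universe u v w x

set_option linter.unusedSectionVars false

/-! ### Positional winning regions in infinite parity games -/

/-- A parity game on an arbitrary set of positions, seen by one of its players: `own` holds at
the positions of this player, and `good` at the priorities that this player likes. -/
structure Arena (N : Type x) where
  own : N → Prop
  mv : N → Set (ℕ × N)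
  good : ℕ → Prop

namespace Arena

open Filter

variable {N : Type x} (G : Arena N)

/-- The highest priority that occurs infinitely often, if any, is good. -/
def PlayGood (π : ℕ → ℕ) : Prop :=
  ∀ p, (∃ᶠ n in atTop, π n = p) → (∀ᶠ n in atTop, π n ≤ p) → G.good p

/-- The player has the positional strategy `c` on `D`, by which each play from `D` leaves `D` by a
move in `O`, or moves by `I` within `D` and satisfies the parity condition. -/
structure Region (I O : N → Set (ℕ × N)) (D : Set N) (c : N → ℕ × N) : Prop where
  own : ∀ v ∈ D, G.own v → c v ∈ G.mv v ∧ (c v ∈ O v ∨ c v ∈ I v ∧ (c v).2 ∈ D)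
  opp : ∀ v ∈ D, ¬ G.own v → ∀ m ∈ G.mv v, m ∈ O v ∨ m ∈ I v ∧ m.2 ∈ D
  inf : ∀ (ρ : ℕ → N) (π : ℕ → ℕ), (∀ n, ρ n ∈ D) →
    (∀ n, (π n, ρ (n + 1)) ∈ G.mv (ρ n) ∧ (π n, ρ (n + 1)) ∉ O (ρ n) ∧
      (G.own (ρ n) → (π n, ρ (n + 1)) = c (ρ n))) → G.PlayGood π

/-- The union of all regions. -/
def Win (I O : N → Set (ℕ × N)) : Set N := {v | ∃ D c, G.Region I O D c ∧ v ∈ D}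

variable {G}

theorem frequently_add {P : ℕ → Prop} (k : ℕ) :
    (∃ᶠ n in atTop, P (n + k)) ↔ ∃ᶠ n in atTop, P n := by
  conv_rhs => rw [← map_add_atTop_eq_nat k, frequently_map]

theorem eventually_add {P : ℕ → Prop} (k : ℕ) :
    (∀ᶠ n in atTop, P (n + k)) ↔ ∀ᶠ n in atTop, P n := by
  conv_rhs => rw [← map_add_atTop_eq_nat k, eventually_map]

theorem PlayGood.of_tail {π : ℕ → ℕ} (k : ℕ) (h : G.PlayGood fun n => π (n + k)) :
    G.PlayGood π := fun p h1 h2 =>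
  h p ((frequently_add (P := fun n => π n = p) k).2 h1)
    ((eventually_add (P := fun n => π n ≤ p) k).2 h2)

theorem Region.stay {I O : N → Set (ℕ × N)} {D : Set N} {c : N → ℕ × N} (h : G.Region I O D c)
    {v : N} {m : ℕ × N} (hv : v ∈ D) (hm : m ∈ G.mv v) (hO : m ∉ O v)
    (hc : G.own v → m = c v) : m ∈ I v ∧ m.2 ∈ D := by
  by_cases ho : G.own v
  · have := (h.own v hv ho).2
    rw [← hc ho] at this
    exact this.resolve_left hO
  · exact (h.opp v hv ho m hm).resolve_left hO

/-- The union of all regions is a region. -/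
theorem region_win (I O : N → Set (ℕ × N)) : ∃ c, G.Region I O (G.Win I O) c := by
  classical
  let ι := {r : Set N × (N → ℕ × N) // G.Region I O r.1 r.2}
  -- Well-order all regions and play at each position by the least region that contains it. The
  -- index can only fall along a play, so it is eventually constant, and a tail of the play follows
  -- a single strategy.
  obtain ⟨_, hwf⟩ := exists_wellFoundedLT ι
  have hj : ∀ v ∈ G.Win I O, ∃ j : ι, v ∈ j.1.1 ∧ ∀ k : ι, v ∈ k.1.1 → j ≤ k := by
    rintro v ⟨D, c, h, hv⟩
    obtain ⟨j, hj, hmin⟩ := hwf.wf.has_min {j : ι | v ∈ j.1.1} ⟨⟨(D, c), h⟩, hv⟩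
    exact ⟨j, hj, fun k hk => not_lt.1 (hmin k hk)⟩
  choose j hjm hjl using hj
  have hsub : ∀ (k : ι) v, v ∈ k.1.1 → v ∈ G.Win I O := fun k v hv => ⟨_, _, k.2, hv⟩
  refine ⟨fun v => if h : v ∈ G.Win I O then (j v h).1.2 v else (0, v), ?_, ?_, ?_⟩
  · intro v hv ho
    simp only [hv, dif_pos]
    obtain ⟨h1, h2⟩ := (j v hv).2.own v (hjm v hv) ho
    exact ⟨h1, h2.imp_right fun h => ⟨h.1, hsub _ _ h.2⟩⟩
  · intro v hv ho m hm
    exact ((j v hv).2.opp v (hjm v hv) ho m hm).imp_right fun h => ⟨h.1, hsub _ _ h.2⟩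
  · intro ρ π hρ hπ
    let J : ℕ → ι := fun n => j (ρ n) (hρ n)
    have hnext : ∀ n, ρ (n + 1) ∈ (J n).1.1 := by
      intro n
      refine ((J n).2.stay (hjm _ (hρ n)) (hπ n).1 (hπ n).2.1 fun ho => ?_).2
      have := (hπ n).2.2 ho
      simpa only [hρ n, dif_pos] using this
    have hanti : Antitone J := antitone_nat_of_succ_le fun n => hjl _ _ _ (hnext n)
    obtain ⟨_, ⟨n0, rfl⟩, hmin⟩ := hwf.wf.has_min (Set.range J) ⟨_, 0, rfl⟩
    have hconst : ∀ n, J (n + n0) = J n0 := fun n =>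
      le_antisymm (hanti (by omega)) (not_lt.1 (hmin _ ⟨_, rfl⟩))
    refine PlayGood.of_tail n0 ((J n0).2.inf (fun n => ρ (n + n0)) _ (fun n => ?_) fun n => ?_)
    · rw [← hconst n]; exact hjm _ (hρ _)
    · have h := hπ (n + n0)
      rw [show n + n0 + 1 = n + 1 + n0 by omega] at h
      refine ⟨h.1, h.2.1, fun ho => ?_⟩
      have h2 := h.2.2 ho
      simp only [hρ (n + n0), dif_pos] at h2
      rw [h2]
      exact congrArg (fun k : ι => k.1.2 (ρ (n + n0))) (hconst n)

/-- A region whose exits are exits or lead to winning positions consists of winning positions. -/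
theorem Region.subset_win {I O I' O' : N → Set (ℕ × N)} {D : Set N} {c : N → ℕ × N}
    (h : G.Region I O D c) (hI : ∀ v, I v ⊆ I' v)
    (hO : ∀ v, ∀ m ∈ O v, m ∈ O' v ∨ m ∈ I' v ∧ m.2 ∈ G.Win I' O') : D ⊆ G.Win I' O' := by
  classical
  obtain ⟨cW, hW⟩ := G.region_win I' O'
  intro v0 hv0
  -- `cW` takes precedence on the overlap. A play without exits that meets the winning set stays in
  -- it, so either a tail follows `cW` or the whole play follows `c`.
  refine ⟨D ∪ G.Win I' O', fun v => if v ∈ G.Win I' O' then cW v else c v, ⟨?_, ?_, ?_⟩,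
    Or.inl hv0⟩
  · intro v hv ho
    by_cases hw : v ∈ G.Win I' O'
    · simp only [hw, if_true]
      exact (hW.own v hw ho).imp_right (Or.imp_right fun h => ⟨h.1, Or.inr h.2⟩)
    · simp only [hw, if_false]
      obtain ⟨h1, h2 | h2⟩ := h.own v (hv.resolve_right hw) ho
      · exact ⟨h1, (hO v _ h2).imp_right fun h => ⟨h.1, Or.inr h.2⟩⟩
      · exact ⟨h1, Or.inr ⟨hI v h2.1, Or.inl h2.2⟩⟩
  · intro v hv ho m hm
    rcases hv with hv | hv
    · rcases h.opp v hv ho m hm with h2 | h2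
      · exact (hO v _ h2).imp_right fun h => ⟨h.1, Or.inr h.2⟩
      · exact Or.inr ⟨hI v h2.1, Or.inl h2.2⟩
    · exact (hW.opp v hv ho m hm).imp_right fun h => ⟨h.1, Or.inr h.2⟩
  · intro ρ π hρ hπ
    by_cases hex : ∃ n, ρ n ∈ G.Win I' O'
    · obtain ⟨n0, hn0⟩ := hex
      have hs : ∀ n, ρ (n + n0) ∈ G.Win I' O' := by
        intro n
        induction n with
        | zero => simpa using hn0
        | succ n ih =>
          have h := hπ (n + n0)
          rw [show n + n0 + 1 = n + 1 + n0 by omega] at h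
          exact (hW.stay ih h.1 h.2.1 fun ho => by simpa [ih] using h.2.2 ho).2
      refine PlayGood.of_tail n0 (hW.inf (fun n => ρ (n + n0)) _ hs fun n => ?_)
      have h := hπ (n + n0)
      rw [show n + n0 + 1 = n + 1 + n0 by omega] at h
      exact ⟨h.1, h.2.1, fun ho => by simpa [hs n] using h.2.2 ho⟩
    · push Not at hex
      refine h.inf ρ π (fun n => (hρ n).resolve_right (hex n)) fun n => ?_
      refine ⟨(hπ n).1, fun hmO => ?_, fun ho => by simpa [hex n] using (hπ n).2.2 ho⟩
      rcases hO _ _ hmO with h2 | h2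
      · exact (hπ n).2.1 h2
      · exact hex _ h2.2

theorem win_mono {I O I' O' : N → Set (ℕ × N)} (hI : ∀ v, I v ⊆ I' v)
    (hO : ∀ v, ∀ m ∈ O v, m ∈ O' v ∨ m ∈ I' v ∧ m.2 ∈ G.Win I' O') :
    G.Win I O ⊆ G.Win I' O' := by
  obtain ⟨c, h⟩ := G.region_win I O
  exact h.subset_win hI hO

/-- The position alone is a region once all its moves count as exits; its parity condition is then
void. -/
theorem win_of_opp {I O : N → Set (ℕ × N)} {v : N} (ho : ¬ G.own v)
    (h : ∀ m ∈ G.mv v, m ∈ O v ∨ m ∈ I v ∧ m.2 ∈ G.Win I O) : v ∈ G.Win I O := by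
  have : G.Region (fun _ => ∅) (fun v => {m | m ∈ O v ∨ m ∈ I v ∧ m.2 ∈ G.Win I O}) {v}
      (fun v => (0, v)) := by
    refine ⟨?_, ?_, ?_⟩
    · rintro _ rfl h; exact absurd h ho
    · rintro _ rfl - m hm; exact Or.inl (h m hm)
    · intro ρ π hρ hπ
      have h0 : ρ 0 = v := hρ 0
      refine absurd ?_ (hπ 0).2.1
      rw [h0]
      exact h _ (h0 ▸ (hπ 0).1)
  exact this.subset_win (fun _ => Set.empty_subset _) (fun _ _ h => h) rfl

theorem win_of_own {I O : N → Set (ℕ × N)} {v : N} (ho : G.own v) {m : ℕ × N} (hm : m ∈ G.mv v)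
    (h : m ∈ O v ∨ m ∈ I v ∧ m.2 ∈ G.Win I O) : v ∈ G.Win I O := by
  have : G.Region (fun _ => ∅) (fun v => {m | m ∈ O v ∨ m ∈ I v ∧ m.2 ∈ G.Win I O}) {v}
      (fun _ => m) := by
    refine ⟨?_, ?_, ?_⟩
    · rintro _ rfl -; exact ⟨hm, Or.inl h⟩
    · rintro _ rfl h; exact absurd ho h
    · intro ρ π hρ hπ
      have h0 : ρ 0 = v := hρ 0
      refine absurd ?_ (hπ 0).2.1
      rw [(hπ 0).2.2 (h0 ▸ ho), h0]
      exact h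
  exact this.subset_win (fun _ => Set.empty_subset _) (fun _ _ h => h) rfl

/-- A region with exits that lead back into it, such that all plays that take these exits
infinitely often are won. -/
theorem Region.subset_win_of_loop {I O I' O' : N → Set (ℕ × N)} {D : Set N} {c : N → ℕ × N}
    (h : G.Region I O D c) (hI : ∀ v, I v ⊆ I' v)
    (hO : ∀ v, ∀ m ∈ O v, m ∈ O' v ∨ m ∈ I' v ∧ m.2 ∈ D)
    (hQ : ∀ (ρ : ℕ → N) (π : ℕ → ℕ), (∀ n, (π n, ρ (n + 1)) ∈ G.mv (ρ n)) →
      (∀ n, (π n, ρ (n + 1)) ∈ I' (ρ n)) → (∃ᶠ n in atTop, (π n, ρ (n + 1)) ∈ O (ρ n) ∧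
        (π n, ρ (n + 1)) ∉ O' (ρ n)) → G.PlayGood π) :
    D ⊆ G.Win I' O' := by
  have key : G.Region I' O' D c := by
    have hcomb : ∀ v m, (m ∈ O v ∨ m ∈ I v ∧ m.2 ∈ D) → m ∈ O' v ∨ m ∈ I' v ∧ m.2 ∈ D := by
      rintro v m (hm | hm)
      · exact hO v m hm
      · exact Or.inr ⟨hI v hm.1, hm.2⟩
    have hown : ∀ v ∈ D, G.own v → c v ∈ G.mv v ∧ (c v ∈ O' v ∨ c v ∈ I' v ∧ (c v).2 ∈ D) :=
      fun v hv ho => (h.own v hv ho).imp_right (hcomb v _)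
    have hopp : ∀ v ∈ D, ¬ G.own v → ∀ m ∈ G.mv v, m ∈ O' v ∨ m ∈ I' v ∧ m.2 ∈ D :=
      fun v hv ho m hm => hcomb v m (h.opp v hv ho m hm)
    refine ⟨hown, hopp, ?_⟩
    intro ρ π hρ hπ
    by_cases hf : ∃ᶠ n in atTop, (π n, ρ (n + 1)) ∈ O (ρ n)
    · refine hQ ρ π (fun n => (hπ n).1) (fun n => ?_) (hf.mono fun n hn => ⟨hn, (hπ n).2.1⟩)
      by_cases ho : G.own (ρ n)
      · have := (hown _ (hρ n) ho).2
        rw [← (hπ n).2.2 ho] at this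
        exact (this.resolve_left (hπ n).2.1).1
      · exact ((hopp _ (hρ n) ho _ (hπ n).1).resolve_left (hπ n).2.1).1
    · rw [not_frequently, eventually_atTop] at hf
      obtain ⟨n0, hn0⟩ := hf
      refine PlayGood.of_tail n0 (h.inf (fun n => ρ (n + n0)) _ (fun n => hρ _) fun n => ?_)
      have h := hπ (n + n0)
      have h' := hn0 (n + n0) (by omega)
      rw [show n + n0 + 1 = n + 1 + n0 by omega] at h h'
      exact ⟨h.1, h', h.2.2⟩
  exact fun v hv => ⟨D, c, key, hv⟩

/-! ### Nested fixpoints -/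

/-- The nested fixpoint of a game in which the priorities `≥ p` have been assigned the sets
`env`. -/
def nest (G : Arena N) : ℕ → (ℕ → Set N) → Set N
  | 0, env => {v | (G.own v → ∃ m ∈ G.mv v, m.2 ∈ env m.1) ∧
      (¬ G.own v → ∀ m ∈ G.mv v, m.2 ∈ env m.1)}
  | p + 1, env => {v | (G.good p → ∃ S, S ⊆ G.nest p (Function.update env p S) ∧ v ∈ S) ∧
      (¬ G.good p → ∀ S, G.nest p (Function.update env p S) ⊆ S → v ∈ S)}

/-- Priorities below `p` are played inside the region, while higher ones leave it for the sets
assigned to them. Each fixpoint operator turns one more priority from an exit into an inner move. -/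
theorem nest_subset_win (p : ℕ) : ∀ env : ℕ → Set N,
    G.nest p env ⊆ G.Win (fun _ => {m | m.1 < p}) (fun _ => {m | p ≤ m.1 ∧ m.2 ∈ env m.1}) := by
  induction p with
  | zero =>
    rintro env v ⟨h1, h2⟩
    by_cases ho : G.own v
    · obtain ⟨m, hm, h⟩ := h1 ho
      exact win_of_own ho hm (Or.inl ⟨Nat.zero_le _, h⟩)
    · exact win_of_opp ho fun m hm => Or.inl ⟨Nat.zero_le _, h2 ho m hm⟩
  | succ p ih =>
    rintro env v ⟨h1, h2⟩
    by_cases hg : G.good p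
    · obtain ⟨S, hS, hv⟩ := h1 hg
      -- Moves of priority `p` into the post-fixpoint lead back into the inner region. If they recur
      -- and nothing exceeds `p`, the play is good because `p` is.
      obtain ⟨c, hc⟩ := G.region_win (fun _ => {m | m.1 < p})
        (fun _ => {m | p ≤ m.1 ∧ m.2 ∈ Function.update env p S m.1})
      refine hc.subset_win_of_loop (fun _ m (hm : m.1 < p) => Nat.lt_succ_of_lt hm) ?_ ?_
        (ih _ (hS hv))
      · rintro v m ⟨hpm, hm⟩
        rcases hpm.eq_or_lt with heq | hlt
        · subst heq
          exact Or.inr ⟨Nat.lt_succ_self _, ih _ (hS (by simpa using hm))⟩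
        · rw [Function.update_of_ne hlt.ne'] at hm
          exact Or.inl ⟨hlt, hm⟩
      · intro ρ π _ hI hf q hq1 hq2
        have hle : ∀ n, π n ≤ p := fun n => Nat.lt_succ_iff.1 (hI n)
        obtain ⟨n, hn⟩ := hq1.exists
        obtain ⟨k, ⟨hk, -⟩, hk'⟩ := (hf.and_eventually hq2).exists
        have h3 : p ≤ π k := hk.1
        have h4 := hle n
        have : q = p := by omega
        exact this ▸ hg
    -- The winning set is itself a pre-fixpoint, so it contains the least one.
    · refine h2 hg _ fun u hu => ?_
      refine win_mono (fun _ m (hm : m.1 < p) => Nat.lt_succ_of_lt hm) ?_ (ih _ hu)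
      rintro v m ⟨hpm, hm⟩
      rcases hpm.eq_or_lt with heq | hlt
      · subst heq
        rw [Function.update_self] at hm
        exact Or.inr ⟨Nat.lt_succ_self _, hm⟩
      · rw [Function.update_of_ne hlt.ne'] at hm
        exact Or.inl ⟨hlt, hm⟩

/-- The game as seen by the other player. -/
def dual (G : Arena N) : Arena N where
  own v := ¬ G.own v
  mv := G.mv
  good p := ¬ G.good p

/-- De Morgan: complementation exchanges the players, and post-fixpoints with pre-fixpoints.
Applying `nest_subset_win` to the dual game then gives positional determinacy. -/
theorem compl_nest (p : ℕ) : ∀ env : ℕ → Set N,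
    (G.nest p env)ᶜ = G.dual.nest p fun q => (env q)ᶜ := by
  induction p with
  | zero =>
    intro env
    ext v
    simp only [nest, dual, Set.mem_compl_iff, Set.mem_ofPred_eq]
    by_cases ho : G.own v <;> simp [ho]
  | succ p ih =>
    intro env
    have hupd : ∀ S : Set N, (fun q => (Function.update env p S q)ᶜ) =
        Function.update (fun q => (env q)ᶜ) p Sᶜ := by
      intro S
      funext q
      by_cases h : q = p
      · subst h; simp
      · simp [Function.update_of_ne h]
    have ih' : ∀ S : Set N, G.dual.nest p (Function.update (fun q => (env q)ᶜ) p S) =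
        (G.nest p (Function.update env p Sᶜ))ᶜ := by
      intro S
      rw [ih, hupd, compl_compl]
    ext v
    simp only [nest, Set.mem_compl_iff, Set.mem_ofPred_eq, ih']
    by_cases hg : G.good p
    · simp only [dual, hg, not_true, not_false_eq_true, forall_true_left, false_imp_iff, and_true,
        true_and]
      constructor
      · intro h S hS
        by_contra hv
        exact h ⟨Sᶜ, fun u hu => by by_contra h'; exact hu (hS h'), hv⟩
      · rintro h ⟨S, hS, hv⟩
        refine h Sᶜ (fun u hu hu' => hu ?_) hv
        rw [compl_compl]; exact hS hu'
    · simp only [dual, hg, not_true, not_false_eq_true, forall_true_left, false_imp_iff, and_true,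
        true_and]
      constructor
      · intro h
        push Not at h
        obtain ⟨S, hS, hv⟩ := h
        exact ⟨Sᶜ, fun u hu hu' => hu (hS (by rwa [compl_compl] at hu')), hv⟩
      · rintro ⟨S, hS, hv⟩ h
        exact h Sᶜ (fun u hu hu' => hS hu' hu) hv

end Arena

/-! ### The fixpoint iteration algorithm -/

section Iterate

variable {N : Type x} [DecidableEq N]

/-- Until it stabilizes, each round gains an element of `U`, so `U.card` rounds suffice. -/
theorem iterate_card_empty {f : Finset N → Finset N} (hf : Monotone f) {U : Finset N}
    (hU : ∀ S ⊆ U, f S ⊆ U) :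
    f (f^[U.card] ∅) = f^[U.card] ∅ ∧ ∀ S, f S ⊆ S → f^[U.card] ∅ ⊆ S := by
  have hsub : ∀ n, f^[n] ∅ ⊆ U := by
    intro n
    induction n with
    | zero => simp
    | succ n ih => rw [Function.iterate_succ_apply']; exact hU _ ih
  have hstep : ∀ n, f^[n] ∅ ⊆ f^[n + 1] ∅ := by
    intro n
    induction n with
    | zero => simp
    | succ n ih =>
      rw [Function.iterate_succ_apply' f n, Function.iterate_succ_apply' f (n + 1)]
      exact hf ih
  have hcard : ∀ n, f (f^[n] ∅) = f^[n] ∅ ∨ n + 1 ≤ (f^[n + 1] ∅).card := by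
    intro n
    induction n with
    | zero =>
      by_cases h : f ∅ = ∅
      · exact Or.inl h
      · exact Or.inr (Finset.card_pos.2 (Finset.nonempty_iff_ne_empty.2 h))
    | succ n ih =>
      by_cases h : f (f^[n + 1] ∅) = f^[n + 1] ∅
      · exact Or.inl h
      · right
        rcases ih with ih | ih
        · exact absurd (by rw [Function.iterate_succ_apply', ih]; exact ih) h
        · have : (f^[n + 1] ∅).card < (f^[n + 1 + 1] ∅).card := by
            refine Finset.card_lt_card ((hstep (n + 1)).ssubset_of_ne fun h' => h ?_)
            rw [Function.iterate_succ_apply' f (n + 1)] at h'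
            exact h'.symm
          omega
  refine ⟨?_, fun S hS => ?_⟩
  · refine (hcard U.card).resolve_right fun h => ?_
    have := Finset.card_le_card (hsub (U.card + 1))
    omega
  · generalize U.card = n
    induction n with
    | zero => simp
    | succ n ih => rw [Function.iterate_succ_apply']; exact (hf ih).trans hS

theorem iterate_card_self {f : Finset N → Finset N} (hf : Monotone f) {U : Finset N}
    (hU : ∀ S, f S ⊆ U) :
    f (f^[U.card] U) = f^[U.card] U ∧ ∀ S ⊆ U, S ⊆ f S → S ⊆ f^[U.card] U := by
  have hsub : ∀ n, f^[n] U ⊆ U := by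
    intro n
    induction n with
    | zero => simp
    | succ n ih => rw [Function.iterate_succ_apply']; exact hU _
  have hstep : ∀ n, f^[n + 1] U ⊆ f^[n] U := by
    intro n
    induction n with
    | zero => exact hU _
    | succ n ih =>
      rw [Function.iterate_succ_apply' f n, Function.iterate_succ_apply' f (n + 1)]
      exact hf ih
  have hcard : ∀ n, f (f^[n] U) = f^[n] U ∨ (f^[n + 1] U).card + (n + 1) ≤ U.card := by
    intro n
    induction n with
    | zero =>
      by_cases h : f U = U
      · exact Or.inl h
      · exact Or.inr (Finset.card_lt_card ((hU _).ssubset_of_ne h))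
    | succ n ih =>
      by_cases h : f (f^[n + 1] U) = f^[n + 1] U
      · exact Or.inl h
      · right
        rcases ih with ih | ih
        · exact absurd (by rw [Function.iterate_succ_apply', ih]; exact ih) h
        · have : (f^[n + 1 + 1] U).card < (f^[n + 1] U).card := by
            refine Finset.card_lt_card ((hstep (n + 1)).ssubset_of_ne fun h' => h ?_)
            rw [Function.iterate_succ_apply' f (n + 1)] at h'
            exact h'
          omega
  refine ⟨?_, fun S hSU hS => ?_⟩
  · refine (hcard U.card).resolve_right fun h => ?_
    omega
  · generalize U.card = n
    induction n with
    | zero => simpa using hSU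
    | succ n ih => rw [Function.iterate_succ_apply']; exact hS.trans (hf ih)

end Iterate

-- Correctness of nested fixpoint iteration on finite games.

namespace ParityGame

open Filter

variable {N : Type x} [DecidableEq N]

theorem solveAux_subset (G : ParityGame N) (p : ℕ) : ∀ env, G.solveAux p env ⊆ G.nodes := by
  induction p with
  | zero => intro env; exact Finset.filter_subset _ _
  | succ p ih =>
    intro env
    simp only [solveAux]
    generalize G.nodes.card = n
    cases n with
    | zero =>
      simp only [Function.iterate_zero, id]
      split_ifs <;> simp
    | succ n => rw [Function.iterate_succ_apply']; exact ih _

theorem solveAux_mono (G : ParityGame N) (p : ℕ) : ∀ env env' : ℕ → Finset N,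
    (∀ q, env q ⊆ env' q) → G.solveAux p env ⊆ G.solveAux p env' := by
  induction p with
  | zero =>
    intro env env' h v hv
    simp only [solveAux, Finset.mem_filter] at hv ⊢
    refine ⟨hv.1, ?_⟩
    split_ifs at hv ⊢
    · obtain ⟨m, hm, hm'⟩ := hv.2
      exact ⟨m, hm, h _ hm'⟩
    · exact fun m hm => h _ (hv.2 m hm)
  | succ p ih =>
    intro env env' h
    simp only [solveAux]
    generalize G.nodes.card = n
    induction n with
    | zero => simp
    | succ n ihn =>
      rw [Function.iterate_succ_apply', Function.iterate_succ_apply']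
      refine ih _ _ fun q => ?_
      by_cases hq : q = p
      · subst hq; simpa using ihn
      · simpa [Function.update_of_ne hq] using h q

/-- A finite parity game as seen by Eloise. -/
def arena (G : ParityGame N) : Arena N where
  own v := G.eloise v = true
  mv v := {m | m ∈ G.moves v}
  good := Even

/-- Moves never leave `nodes`, so sets that agree on the nodes are interchangeable; this allows
finite iteration to stand in for fixpoints over all of `N`. -/
theorem mem_solveAux (G : ParityGame N) (p : ℕ) : ∀ (env : ℕ → Finset N) (env' : ℕ → Set N),
    (∀ q, ∀ v ∈ G.nodes, v ∈ env q ↔ v ∈ env' q) →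
    ∀ v ∈ G.nodes, v ∈ G.solveAux p env ↔ v ∈ G.arena.nest p env' := by
  classical
  induction p with
  | zero =>
    intro env env' h v hv
    simp only [solveAux, Finset.mem_filter, Arena.nest, arena, Set.mem_ofPred_eq, hv, true_and]
    by_cases ho : G.eloise v = true
    · simp only [ho, if_true, forall_true_left, not_true, false_imp_iff, and_true]
      exact exists_congr fun m => and_congr_right fun hm => h _ _ (G.closed v hv m hm)
    · rw [if_neg ho]
      simp only [ho]
      exact (forall₂_congr fun m hm => h _ _ (G.closed v hv m hm)).trans (by simp)
  | succ p ih =>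
    intro env env' h v hv
    have hmono : Monotone fun S => G.solveAux p (Function.update env p S) := by
      intro S T hST
      refine G.solveAux_mono p _ _ fun q => ?_
      by_cases hq : q = p
      · subst hq; simpa using hST
      · simp [Function.update_of_ne hq]
    have hupd : ∀ (S : Finset N) (S' : Set N), (∀ v ∈ G.nodes, v ∈ S ↔ v ∈ S') →
        ∀ v ∈ G.nodes, v ∈ G.solveAux p (Function.update env p S) ↔
          v ∈ G.arena.nest p (Function.update env' p S') := by
      intro S S' hS
      refine ih _ _ fun q u hu => ?_
      by_cases hq : q = p
      · subst hq; simpa using hS u hu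
      · simpa [Function.update_of_ne hq] using h q u hu
    have hsub := fun S => G.solveAux_subset p (Function.update env p S)
    simp only [solveAux, Arena.nest, Set.mem_ofPred_eq]
    by_cases hg : p % 2 = 0
    · have hg' : G.arena.good p := Nat.even_iff.2 hg
      simp only [hg, hg', if_true, forall_true_left, not_true, false_imp_iff, and_true]
      obtain ⟨h1, h2⟩ := iterate_card_self hmono (U := G.nodes) hsub
      constructor
      · intro hv'
        refine ⟨_, fun u hu => ?_, Finset.mem_coe.2 hv'⟩
        rw [Finset.mem_coe, ← h1] at hu
        exact (hupd _ _ (fun _ _ => Iff.rfl) u (hsub _ hu)).1 hu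
      · rintro ⟨S, hS, hvS⟩
        refine h2 (G.nodes.filter (· ∈ S)) (Finset.filter_subset _ _) (fun u hu => ?_)
          (Finset.mem_filter.2 ⟨hv, hvS⟩)
        rw [Finset.mem_filter] at hu
        exact (hupd _ S (fun w hw => by simp [hw]) u hu.1).2 (hS hu.2)
    · have hg' : ¬ G.arena.good p := fun h => hg (Nat.even_iff.1 h)
      simp only [hg, hg', if_false, false_imp_iff, not_false_eq_true, forall_true_left, true_and]
      obtain ⟨h1, h2⟩ := iterate_card_empty hmono (U := G.nodes) fun S _ => hsub S
      constructor
      · intro hv' S hS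
        refine (Finset.mem_filter.1 (h2 (G.nodes.filter (· ∈ S)) (fun u hu => ?_) hv')).2
        refine Finset.mem_filter.2 ⟨hsub _ hu, hS ?_⟩
        exact (hupd _ S (fun w hw => by simp [hw]) u (hsub _ hu)).1 hu
      · intro h'
        -- In `nest` the pre-fixpoint is taken over all of `N`; adding every non-node to the iterate
        -- makes it one.
        refine (h' (↑(_ : Finset N) ∪ (↑G.nodes)ᶜ) fun u hu => ?_).resolve_right (fun h => h hv)
        by_cases hun : u ∈ G.nodes
        · left
          rw [Finset.mem_coe, ← h1]
          exact (hupd _ _ (fun w hw => by simp [hw]) u hun).2 hu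
        · exact Or.inr hun


theorem le_index (G : ParityGame N) {v : N} (hv : v ∈ G.nodes) {m : ℕ × N} (hm : m ∈ G.moves v) :
    m.1 ≤ G.index :=
  (Finset.le_sup (f := Prod.fst) hm).trans
    (Finset.le_sup (f := fun v => (G.moves v).sup Prod.fst) hv)

/-- If the algorithm returns false, then Abelard has a positional winning strategy. -/
theorem abelard_of_not_solve (G : ParityGame N) {v : N} (hv : v ∈ G.nodes)
    (h : G.solve v = false) :
    ∃ (D : Set N) (c : N → ℕ × N), v ∈ D ∧ (∀ u ∈ D, u ∈ G.nodes) ∧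
      (∀ u ∈ D, G.eloise u = false → c u ∈ G.moves u) ∧
      (∀ u ∈ D, ∀ m ∈ G.moves u, (G.eloise u = false → m = c u) → m.2 ∈ D) ∧
      ∀ (ρ : ℕ → N) (π : ℕ → ℕ), (∀ n, ρ n ∈ D) →
        (∀ n, (π n, ρ (n + 1)) ∈ G.moves (ρ n) ∧
          (G.eloise (ρ n) = false → (π n, ρ (n + 1)) = c (ρ n))) →
        ∀ p, (∃ᶠ n in atTop, π n = p) → (∀ᶠ n in atTop, π n ≤ p) → ¬ Even p := by
  have h1 : v ∉ G.solveAux (G.index + 1) fun _ => ∅ := by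
    simpa [solve] using h
  rw [G.mem_solveAux _ _ (fun _ => ∅) (by simp) v hv, ← Set.mem_compl_iff, Arena.compl_nest] at h1
  obtain ⟨D, c, hD, hvD⟩ := Arena.nest_subset_win _ _ h1
  -- After complementation every position is an allowed target of an exit, but an exit would need a
  -- priority above the index.
  have hno : ∀ u ∈ G.nodes, ∀ m ∈ G.moves u, ¬ (G.index + 1 ≤ m.1 ∧ m.2 ∈ (∅ : Set N)ᶜ) :=
    fun u hu m hm h => by have := G.le_index hu hm; omega
  refine ⟨D ∩ G.nodes, c, ⟨hvD, hv⟩, fun u hu => hu.2, fun u hu ho => ?_, fun u hu m hm ho => ?_,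
    fun ρ π hρ hπ => ?_⟩
  · exact (hD.own u hu.1 (by simp [Arena.dual, arena, ho])).1
  · exact ⟨(hD.stay hu.1 hm (hno u hu.2 m hm)
      (fun h => ho (by simpa [Arena.dual, arena] using h))).2, G.closed u hu.2 m hm⟩
  · refine hD.inf ρ π (fun n => (hρ n).1) fun n => ⟨(hπ n).1, hno _ (hρ n).2 _ (hπ n).1, fun h => ?_⟩
    exact (hπ n).2 (by simpa [Arena.dual, arena] using h)

theorem eventually_le_of_bounded {π : ℕ → ℕ} {B : ℕ} (h : ∀ n, π n ≤ B) :
    ∃ p, (∃ᶠ n in atTop, π n = p) ∧ ∀ᶠ n in atTop, π n ≤ p := by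
  replace h : ∀ᶠ n in atTop, π n ≤ B := Eventually.of_forall h
  induction B with
  | zero => exact ⟨0, (h.mono fun n hn => Nat.le_zero.1 hn).frequently, h⟩
  | succ B ih =>
    by_cases hf : ∃ᶠ n in atTop, π n = B + 1
    · exact ⟨_, hf, h⟩
    · rw [not_frequently] at hf
      exact ih ((h.and hf).mono fun n hn => by have := hn.1; have := hn.2; omega)

theorem eloiseWins_of_solve (G : ParityGame N) {v : N} (hv : v ∈ G.nodes)
    (h : G.solve v = true) : G.EloiseWins v := by
  have h1 : v ∈ G.solveAux (G.index + 1) fun _ => ∅ := by simpa [solve] using h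
  rw [G.mem_solveAux _ _ (fun _ => ∅) (by simp) v hv] at h1
  obtain ⟨D, c, hD, hvD⟩ := Arena.nest_subset_win _ _ h1
  have hstay : ∀ u ∈ D ∩ G.nodes, ∀ m, G.Conforms c u m → m.2 ∈ D ∩ G.nodes := fun u hu m hm =>
    ⟨(hD.stay hu.1 hm.1 (fun h => h.2) hm.2).2, G.closed u hu.2 m hm.1⟩
  refine ⟨c, fun u hu hstuck => ?_, fun ρ π h0 hπ => ?_⟩
  · have huD : u ∈ D ∩ G.nodes := by
      clear hstuck
      induction hu with
      | refl => exact ⟨hvD, hv⟩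
      | tail _ hstep ih => obtain ⟨p, hp⟩ := hstep; exact hstay _ ih _ hp
    by_contra ho
    have ho' : G.eloise u = true := by simpa using ho
    exact hstuck (c u) ⟨(hD.own u huD.1 ho').1, fun _ => rfl⟩
  · have hmem : ∀ n, ρ n ∈ D ∩ G.nodes := by
      intro n
      induction n with
      | zero => rw [h0]; exact ⟨hvD, hv⟩
      | succ n ih => exact hstay _ ih _ (hπ n)
    obtain ⟨p, hp1, hp2⟩ := eventually_le_of_bounded
      fun n => G.le_index (hmem n).2 (hπ n).1
    exact ⟨p, hD.inf ρ π (fun n => (hmem n).1)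
      (fun n => ⟨(hπ n).1, fun h => h.2, (hπ n).2⟩) p hp1 hp2, hp1, hp2⟩

/-- Otherwise Abelard has a positional winning strategy as well. The play of the two strategies
against each other never gets stuck, and its highest recurring priority would be both even and odd.
-/
theorem solve_of_eloiseWins (G : ParityGame N) {v : N} (hv : v ∈ G.nodes)
    (h : G.EloiseWins v) : G.solve v = true := by
  classical
  by_contra hs
  obtain ⟨D, c, hvD, hDn, hD1, hD2, hD3⟩ :=
    G.abelard_of_not_solve hv (by simpa using hs)
  obtain ⟨s, hs1, hs2⟩ := h
  let f : N → ℕ × N := fun u => if G.eloise u = true then s u else c u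
  let ρ : ℕ → N := fun n => (fun u => (f u).2)^[n] v
  have hρ : ∀ n, ρ (n + 1) = (f (ρ n)).2 := fun n => Function.iterate_succ_apply' _ _ _
  have hinv : ∀ n, ρ n ∈ D ∧
      Relation.ReflTransGen (fun a b => ∃ p, G.Conforms s a (p, b)) v (ρ n) ∧
      f (ρ n) ∈ G.moves (ρ n) := by
    have hmv : ∀ u ∈ D, Relation.ReflTransGen (fun a b => ∃ p, G.Conforms s a (p, b)) v u →
        f u ∈ G.moves u := by
      intro u huD hu
      by_cases ho : G.eloise u = true
      · simp only [f, ho, if_true]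
        by_contra hn
        have := hs1 u hu fun m hm => hn (hm.2 ho ▸ hm.1)
        simp [ho] at this
      · simp only [f, ho]
        exact hD1 u huD (by simpa using ho)
    intro n
    induction n with
    | zero => exact ⟨hvD, .refl, hmv _ hvD .refl⟩
    | succ n ih =>
      obtain ⟨h1, h2, h3⟩ := ih
      have h4 : ρ (n + 1) ∈ D := by
        rw [hρ]
        exact hD2 _ h1 _ h3 fun ho => by simp [f, ho]
      have h5 : Relation.ReflTransGen (fun a b => ∃ p, G.Conforms s a (p, b)) v (ρ (n + 1)) := by
        refine h2.tail ⟨(f (ρ n)).1, ?_⟩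
        rw [hρ]
        exact ⟨h3, fun ho => by simp [f, ho]⟩
      exact ⟨h4, h5, hmv _ h4 h5⟩
  have heq : ∀ n, ((f (ρ n)).1, ρ (n + 1)) = f (ρ n) := fun n => by rw [hρ]
  obtain ⟨p, hp, hp1, hp2⟩ := hs2 ρ (fun n => (f (ρ n)).1) rfl fun n => by
    rw [heq]; exact ⟨(hinv n).2.2, fun ho => by simp [f, ho]⟩
  refine hD3 ρ _ (fun n => (hinv n).1) (fun n => ?_) p hp1 hp2 hp
  rw [heq]
  exact ⟨(hinv n).2.2, fun ho => by simp [f, ho]⟩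

end ParityGame

/-! ### Infinite paths -/

/-- If from each member of `S` a path with steps in `R₁` and a final step in `R₂` leads back to
`S`, then there is an infinite path with infinitely many steps in `R₂`. -/
theorem exists_path {T : Type x} {R₁ R₂ : T → T → Prop} {S : Set T}
    (h : ∀ a ∈ S, ∃ b c, Relation.ReflTransGen R₁ a b ∧ R₂ b c ∧ c ∈ S) {a : T} (ha : a ∈ S) :
    ∃ g : ℕ → T, g 0 = a ∧ (∀ n, R₁ (g n) (g (n + 1)) ∨ R₂ (g n) (g (n + 1))) ∧
      ∃ᶠ n in Filter.atTop, R₂ (g n) (g (n + 1)) := by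
  -- `D n b` says that `n` steps in `R₁` and then one in `R₂` lead from `b` into `S`. The path
  -- carries this countdown, which restarts whenever it has run out.
  let D : ℕ → T → Prop := fun n => Nat.rec (fun b => ∃ c, R₂ b c ∧ c ∈ S)
    (fun _ D b => ∃ c, R₁ b c ∧ D c) n
  have hD : ∀ b ∈ S, ∃ n, D n b := by
    intro b hb
    obtain ⟨c, d, hc, hd, hS⟩ := h b hb
    clear hb
    induction hc using Relation.ReflTransGen.head_induction_on with
    | refl => exact ⟨0, d, hd, hS⟩
    | head hstep _ ih => obtain ⟨n, hn⟩ := ih; exact ⟨n + 1, _, hstep, hn⟩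
  have hnext : ∀ s : {s : ℕ × T // D s.1 s.2}, ∃ t : {s : ℕ × T // D s.1 s.2},
      (s.1.1 = 0 ∧ R₂ s.1.2 t.1.2) ∨ (R₁ s.1.2 t.1.2 ∧ s.1.1 = t.1.1 + 1) := by
    rintro ⟨⟨n, b⟩, hs⟩
    cases n with
    | zero =>
      obtain ⟨c, hc, hcS⟩ := hs
      obtain ⟨n, hn⟩ := hD c hcS
      exact ⟨⟨(n, c), hn⟩, Or.inl ⟨rfl, hc⟩⟩
    | succ n =>
      obtain ⟨c, hc, hn⟩ := hs
      exact ⟨⟨(n, c), hn⟩, Or.inr ⟨hc, rfl⟩⟩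
  choose f hf using hnext
  obtain ⟨n0, hn0⟩ := hD a ha
  let G : ℕ → {s : ℕ × T // D s.1 s.2} := fun n => f^[n] ⟨(n0, a), hn0⟩
  have hG : ∀ n, G (n + 1) = f (G n) := fun n => Function.iterate_succ_apply' _ _ _
  have hstep : ∀ n, ((G n).1.1 = 0 ∧ R₂ (G n).1.2 (G (n + 1)).1.2) ∨
      (R₁ (G n).1.2 (G (n + 1)).1.2 ∧ (G n).1.1 = (G (n + 1)).1.1 + 1) := by
    intro n; rw [hG]; exact hf _
  have hzero : ∀ r n, (G n).1.1 = r → ∃ m ≥ n, R₂ (G m).1.2 (G (m + 1)).1.2 := by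
    intro r
    induction r with
    | zero =>
      intro n hn
      rcases hstep n with h | h
      · exact ⟨n, le_rfl, h.2⟩
      · omega
    | succ r ih =>
      intro n hn
      rcases hstep n with h | h
      · omega
      · obtain ⟨m, hm, h'⟩ := ih (n + 1) (by omega)
        exact ⟨m, by omega, h'⟩
  refine ⟨fun n => (G n).1.2, rfl, fun n => ?_, ?_⟩
  · exact (hstep n).elim (fun h => Or.inr h.2) fun h => Or.inl h.1
  · rw [Filter.frequently_atTop]
    exact fun n => hzero _ n rfl

/-- A sequence of paths with infinitely many marked ones gives an infinite path. -/
theorem exists_path_of_seq {T : Type x} {R₁ R₂ : T → T → Prop} {f : ℕ → T} {p : ℕ → Prop}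
    (h : ∀ n, Relation.ReflTransGen R₁ (f n) (f (n + 1)) ∨ R₂ (f n) (f (n + 1)))
    (hp : ∀ n, p n → R₂ (f n) (f (n + 1))) (hf : ∃ᶠ n in Filter.atTop, p n) :
    ∃ g : ℕ → T, g 0 = f 0 ∧ (∀ n, R₁ (g n) (g (n + 1)) ∨ R₂ (g n) (g (n + 1))) ∧
      ∃ᶠ n in Filter.atTop, R₂ (g n) (g (n + 1)) := by
  refine exists_path (S := Set.range f) ?_ ⟨0, rfl⟩
  rintro _ ⟨n, rfl⟩
  obtain ⟨m, hm, hpm⟩ := (Filter.frequently_atTop.1 hf) n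
  obtain ⟨k, rfl⟩ := Nat.exists_eq_add_of_le hm
  clear hm
  induction k generalizing n with
  | zero => exact ⟨_, _, .refl, hp _ hpm, _, rfl⟩
  | succ k ih =>
    rcases h n with h1 | h1
    · obtain ⟨b, c, hb, hc⟩ := ih (n + 1) (by rwa [show n + 1 + k = n + (k + 1) by omega])
      exact ⟨b, c, h1.trans hb, hc⟩
    · exact ⟨_, _, .refl, h1, _, rfl⟩

namespace Formula

variable {P : Type u} {A : Type v} {X : Type w}

/-! ### Subformulas, binders and scopes -/

theorem size_pos (α : Formula P A X) : 0 < α.size := by cases α <;> simp [size]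

theorem size_le_of_mem_subs {α β : Formula P A X} (h : β ∈ α.subs) : β.size ≤ α.size := by
  induction α with
  | bot | top | prop | nprop | var => simp [subs] at h; simp [h]
  | and γ δ ih1 ih2 | or γ δ ih1 ih2 =>
    simp only [subs, List.mem_cons, List.mem_append] at h
    rcases h with rfl | h | h
    · rfl
    · have := ih1 h; simp only [size]; omega
    · have := ih2 h; simp only [size]; omega
  | dia a γ ih | box a γ ih | fix η x γ ih =>
    simp only [subs, List.mem_cons] at h
    rcases h with rfl | h
    · rfl
    · have := ih h; simp only [size]; omega

theorem bound_sublist {α β : Formula P A X} (h : β ∈ α.subs) : β.bound.Sublist α.bound := by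
  induction α with
  | bot | top | prop | nprop | var => simp [subs] at h; simp [h]
  | and γ δ ih1 ih2 | or γ δ ih1 ih2 =>
    simp only [subs, List.mem_cons, List.mem_append] at h
    rcases h with rfl | h | h
    · rfl
    · exact (ih1 h).trans (List.sublist_append_left _ _)
    · exact (ih2 h).trans (List.sublist_append_right _ _)
  | dia a γ ih | box a γ ih =>
    simp only [subs, List.mem_cons] at h
    rcases h with rfl | h
    · rfl
    · exact ih h
  | fix η x γ ih =>
    simp only [subs, List.mem_cons] at h
    rcases h with rfl | h
    · rfl
    · exact (ih h).trans (List.sublist_cons_self _ _)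

theorem body_mem_subs {φ ψ : Formula P A X} {η : FixKind} {x : X} (h : fix η x ψ ∈ φ.subs) :
    ψ ∈ φ.subs := by
  classical
  exact subs_trans h (by simp [subs, self_mem_subs])

theorem mem_bound_of_fix {α ψ : Formula P A X} {η : FixKind} {x : X} (h : fix η x ψ ∈ α.subs) :
    x ∈ α.bound := (bound_sublist h).subset (by simp [bound])

theorem exists_fix_of_mem_bound {α : Formula P A X} {x : X} (h : x ∈ α.bound) :
    ∃ η ψ, fix η x ψ ∈ α.subs := by
  induction α with
  | bot | top | prop | nprop | var => simp [bound] at h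
  | and γ δ ih1 ih2 | or γ δ ih1 ih2 =>
    simp only [bound, List.mem_append] at h
    rcases h with h | h
    · obtain ⟨η, ψ, h⟩ := ih1 h; exact ⟨η, ψ, by simp [subs, h]⟩
    · obtain ⟨η, ψ, h⟩ := ih2 h; exact ⟨η, ψ, by simp [subs, h]⟩
  | dia a γ ih | box a γ ih => obtain ⟨η, ψ, h⟩ := ih h; exact ⟨η, ψ, by simp [subs, h]⟩
  | fix η' y γ ih =>
    simp only [bound, List.mem_cons] at h
    rcases h with rfl | h
    · exact ⟨η', γ, by simp [subs]⟩
    · obtain ⟨η, ψ, h⟩ := ih h; exact ⟨η, ψ, by simp [subs, h]⟩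

theorem not_mem_bound_body {φ ψ : Formula P A X} {η : FixKind} {x : X} (hn : φ.bound.Nodup)
    (h : fix η x ψ ∈ φ.subs) : x ∉ ψ.bound := by
  have := hn.sublist (bound_sublist h)
  simp only [bound, List.nodup_cons] at this
  exact this.1

theorem fix_unique {α ψ ψ' : Formula P A X} {η η' : FixKind} {x : X} (hn : α.bound.Nodup)
    (h : fix η x ψ ∈ α.subs) (h' : fix η' x ψ' ∈ α.subs) : η = η' ∧ ψ = ψ' := by
  induction α with
  | bot | top | prop | nprop | var => simp [subs] at h
  | and γ δ ih1 ih2 | or γ δ ih1 ih2 =>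
    simp only [subs, List.mem_cons, List.mem_append, reduceCtorEq, false_or] at h h'
    simp only [bound, List.nodup_append] at hn
    rcases h with h | h <;> rcases h' with h' | h'
    · exact ih1 hn.1 h h'
    · exact absurd rfl (hn.2.2 x (mem_bound_of_fix h) x (mem_bound_of_fix h'))
    · exact absurd rfl (hn.2.2 x (mem_bound_of_fix h') x (mem_bound_of_fix h))
    · exact ih2 hn.2.1 h h'
  | dia a γ ih | box a γ ih =>
    simp only [subs, List.mem_cons, reduceCtorEq, false_or] at h h'
    exact ih hn h h'
  | fix η' y γ ih =>
    simp only [subs, List.mem_cons, fix.injEq] at h h'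
    simp only [bound, List.nodup_cons] at hn
    rcases h with ⟨rfl, rfl, rfl⟩ | h <;> rcases h' with ⟨rfl, h2, rfl⟩ | h'
    · exact ⟨rfl, rfl⟩
    · exact absurd (mem_bound_of_fix h') hn.1
    · exact absurd (h2 ▸ mem_bound_of_fix h) hn.1
    · exact ih hn.2 h h'

variable [DecidableEq X] [DecidableEq P] [DecidableEq A]

theorem fix_mem_of_binder {φ ψ : Formula P A X} {η : FixKind} {x : X}
    (h : φ.binder x = some (η, ψ)) : fix η x ψ ∈ φ.subs := by
  obtain ⟨α, hα, h⟩ := List.exists_of_findSome?_eq_some h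
  cases α <;> simp at h
  obtain ⟨rfl, rfl, rfl⟩ := h
  exact hα

theorem binder_eq_some {φ ψ : Formula P A X} {η : FixKind} {x : X} (hn : φ.bound.Nodup)
    (h : fix η x ψ ∈ φ.subs) : φ.binder x = some (η, ψ) := by
  cases hb : φ.binder x with
  | none =>
    have := List.findSome?_eq_none_iff.1 hb _ h
    simp at this
  | some p =>
    obtain ⟨rfl, rfl⟩ := fix_unique hn (fix_mem_of_binder hb) h
    rfl

theorem scope {φ α : Formula P A X} (h : α ∈ φ.subs) {z : X} (hz : z ∈ α.fv) :
    z ∈ φ.fv ∨ ∃ η ψ, fix η z ψ ∈ φ.subs ∧ α ∈ ψ.subs := by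
  induction φ with
  | bot | top | prop | nprop | var => simp [subs] at h; subst h; exact Or.inl hz
  | and γ δ ih1 ih2 | or γ δ ih1 ih2 =>
    simp only [subs, List.mem_cons, List.mem_append] at h
    rcases h with rfl | h | h
    · exact Or.inl hz
    · rcases ih1 h with h | ⟨η, ψ, h, h'⟩
      · exact Or.inl (by simp [fv, h])
      · exact Or.inr ⟨η, ψ, by simp [subs, h], h'⟩
    · rcases ih2 h with h | ⟨η, ψ, h, h'⟩
      · exact Or.inl (by simp [fv, h])
      · exact Or.inr ⟨η, ψ, by simp [subs, h], h'⟩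
  | dia a γ ih | box a γ ih =>
    simp only [subs, List.mem_cons] at h
    rcases h with rfl | h
    · exact Or.inl hz
    · rcases ih h with h | ⟨η, ψ, h, h'⟩
      · exact Or.inl (by simpa [fv] using h)
      · exact Or.inr ⟨η, ψ, by simp [subs, h], h'⟩
  | fix η y γ ih =>
    simp only [subs, List.mem_cons] at h
    rcases h with rfl | h
    · exact Or.inl hz
    · rcases ih h with h' | ⟨η, ψ, h, h'⟩
      · by_cases hzy : z = y
        · subst hzy; exact Or.inr ⟨η, γ, by simp [subs], h⟩
        · exact Or.inl (by simp [fv, h', hzy])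
      · exact Or.inr ⟨η, ψ, by simp [subs, h], h'⟩

theorem scope_closed {φ α : Formula P A X} (hc : φ.Closed) (h : α ∈ φ.subs) {z : X}
    (hz : z ∈ α.fv) : ∃ η ψ, fix η z ψ ∈ φ.subs ∧ α ∈ ψ.subs :=
  (scope h hz).resolve_left (by rw [Closed] at hc; simp [hc])

/-- One formula is a subformula of the other, or arises from it by unfolding a variable. -/
def FStep (φ α β : Formula P A X) : Prop :=
  β ∈ α.subs ∨ ∃ η y, α = var y ∧ fix η y β ∈ φ.subs

/-- Closed subformulas are traps: a variable occurring in one is bound in it, and by uniqueness of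
binders its unfolding stays inside. -/
theorem FStep.mem_of_closed {φ θ α β : Formula P A X} (hn : φ.bound.Nodup) (h : φ.FStep α β)
    (hθ : θ ∈ φ.subs) (hf : θ.fv = ∅) (hα : α ∈ θ.subs) : β ∈ θ.subs := by
  rcases h with h | ⟨η, y, rfl, h⟩
  · exact subs_trans hα h
  · obtain ⟨η', ψ, h1, h2⟩ := scope_closed hf hα (z := y) (by simp [fv])
    obtain ⟨-, rfl⟩ := fix_unique hn h (subs_trans hθ h1)
    exact body_mem_subs h1

/-! ### Alternation levels -/

theorem alMu_alNu_append (σ : List FixKind) :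
    alMu σ ≤ alMu (σ ++ [.mu]) ∧ alMu σ ≤ alMu (σ ++ [.nu]) ∧ alNu σ ≤ alNu (σ ++ [.mu]) ∧
    alNu σ ≤ alNu (σ ++ [.nu]) ∧ alMu (σ ++ [.mu]) % 2 = 0 ∧ alMu (σ ++ [.nu]) % 2 = 1 ∧
    alNu (σ ++ [.mu]) % 2 = 1 ∧ alNu (σ ++ [.nu]) % 2 = 0 := by
  induction σ with
  | nil => simp [alMu, alNu]
  | cons η σ ih => cases η <;> simp only [List.cons_append, alMu, alNu] <;> omega

theorem al_le_append (σ : List FixKind) (η : FixKind) : al σ ≤ al (σ ++ [η]) := by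
  cases σ with
  | nil => simp [al]
  | cons ξ σ =>
    have := alMu_alNu_append σ
    cases ξ <;> cases η <;> simp only [List.cons_append, al] <;> omega

theorem al_append_mod (σ : List FixKind) (η : FixKind) : al (σ ++ [η]) % 2 = 1 ↔ η = .mu := by
  cases σ with
  | nil => cases η <;> simp [al, alMu, alNu]
  | cons ξ σ =>
    have := alMu_alNu_append σ
    cases ξ <;> cases η <;>
      simp only [List.cons_append, al, reduceCtorEq, iff_true, iff_false] <;> omega

theorem levels_keys (α : Formula P A X) : ∀ σ, (α.levels σ).map Prod.fst = α.bound := by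
  induction α <;> simp_all [levels, bound]

/-- Levels do not decrease as the sequence grows; only a closed fixpoint subformula restarts the
count. -/
theorem levels_ge (α : Formula P A X) : ∀ σ y k, (y, k) ∈ α.levels σ →
    al σ ≤ k ∨ ∃ θ ∈ α.subs, θ.fv = ∅ ∧ y ∈ θ.bound := by
  induction α with
  | bot | top | prop | nprop | var => simp [levels]
  | and γ δ ih1 ih2 | or γ δ ih1 ih2 =>
    intro σ y k h
    simp only [levels, List.mem_append] at h
    rcases h with h | h
    · refine (ih1 σ y k h).imp_right ?_
      rintro ⟨θ, h1, h2⟩; exact ⟨θ, by simp [subs, h1], h2⟩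
    · refine (ih2 σ y k h).imp_right ?_
      rintro ⟨θ, h1, h2⟩; exact ⟨θ, by simp [subs, h1], h2⟩
  | dia a γ ih | box a γ ih =>
    intro σ y k h
    refine (ih σ y k h).imp_right ?_
    rintro ⟨θ, h1, h2⟩; exact ⟨θ, by simp [subs, h1], h2⟩
  | fix η x γ ih =>
    intro σ y k h
    have hy : y ∈ (fix η x γ).bound := by
      rw [← levels_keys _ σ]; exact List.mem_map.2 ⟨_, h, rfl⟩
    by_cases hc : γ.fv.erase x = ∅
    · exact Or.inr ⟨fix η x γ, by simp [subs], hc, hy⟩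
    · simp only [levels, hc, if_false, List.mem_cons, Prod.mk.injEq] at h
      have hle := al_le_append σ η
      rcases h with ⟨-, rfl⟩ | h
      · exact Or.inl hle
      · rcases ih _ y k h with h | ⟨θ, h1, h2⟩
        · exact Or.inl (hle.trans h)
        · exact Or.inr ⟨θ, by simp [subs, h1], h2⟩

/-- Here `σ'` is the sequence in force just above the binder, or `[]` if the fixpoint formula is
closed. -/
theorem levels_of_fix {α ψ : Formula P A X} {η : FixKind} {x : X} (h : fix η x ψ ∈ α.subs) :
    ∀ σ, ∃ σ', (x, al (σ' ++ [η])) ∈ α.levels σ ∧ ∀ p ∈ ψ.levels (σ' ++ [η]), p ∈ α.levels σ := by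
  induction α with
  | bot | top | prop | nprop | var => simp [subs] at h
  | and γ δ ih1 ih2 | or γ δ ih1 ih2 =>
    intro σ
    simp only [subs, List.mem_cons, List.mem_append, reduceCtorEq, false_or] at h
    rcases h with h | h
    · obtain ⟨σ', h1, h2⟩ := ih1 h σ
      exact ⟨σ', by simp [levels, h1], fun p hp => by simp [levels, h2 p hp]⟩
    · obtain ⟨σ', h1, h2⟩ := ih2 h σ
      exact ⟨σ', by simp [levels, h1], fun p hp => by simp [levels, h2 p hp]⟩
  | dia a γ ih | box a γ ih =>
    simp only [subs, List.mem_cons, reduceCtorEq, false_or] at h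
    exact ih h
  | fix ξ y γ ih =>
    intro σ
    simp only [subs, List.mem_cons, fix.injEq] at h
    rcases h with ⟨rfl, rfl, rfl⟩ | h
    · by_cases hc : ψ.fv.erase x = ∅
      · refine ⟨[], ?_, fun p hp => ?_⟩ <;> simp [levels, hc]
        exact Or.inr (by simpa using hp)
      · refine ⟨σ, ?_, fun p hp => ?_⟩ <;> simp [levels, hc]
        exact Or.inr hp
    · obtain ⟨σ', h1, h2⟩ := ih h (if γ.fv.erase y = ∅ then [ξ] else σ ++ [ξ])
      refine ⟨σ', ?_, fun p hp => ?_⟩ <;> simp only [levels, List.mem_cons]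
      · exact Or.inr h1
      · exact Or.inr (h2 p hp)

theorem level_eq_of_mem {φ : Formula P A X} (hn : φ.bound.Nodup) {y : X} {k : ℕ}
    (h : (y, k) ∈ φ.levels []) : φ.level y = k := by
  have key : ∀ l : List (X × ℕ), (l.map Prod.fst).Nodup → (y, k) ∈ l → l.lookup y = some k := by
    intro l
    induction l with
    | nil => simp
    | cons p l ih =>
      intro hn h
      obtain ⟨z, j⟩ := p
      simp only [List.map_cons, List.nodup_cons] at hn
      rcases List.mem_cons.1 h with h | h
      · simp only [Prod.mk.injEq] at h; obtain ⟨rfl, rfl⟩ := h; simp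
      · have : y ≠ z := fun hyz => hn.1 (hyz ▸ List.mem_map.2 ⟨_, h, rfl⟩)
        rw [List.lookup_cons, beq_false_of_ne this]
        exact ih hn.2 h
  rw [level, key _ (by rwa [levels_keys]) h]
  rfl

theorem level_mod {φ ψ : Formula P A X} {η : FixKind} {x : X} (hn : φ.bound.Nodup)
    (h : fix η x ψ ∈ φ.subs) : φ.level x % 2 = 1 ↔ η = .mu := by
  obtain ⟨σ, h1, -⟩ := levels_of_fix h []
  rw [level_eq_of_mem hn h1, al_append_mod]

theorem level_le_or {φ ψ : Formula P A X} {η : FixKind} {x y : X} (hn : φ.bound.Nodup)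
    (h : fix η x ψ ∈ φ.subs) (hy : y ∈ ψ.bound) :
    φ.level x ≤ φ.level y ∨ ∃ θ ∈ ψ.subs, θ.fv = ∅ ∧ y ∈ θ.bound := by
  obtain ⟨σ, h1, h2⟩ := levels_of_fix h []
  rw [← levels_keys ψ (σ ++ [η])] at hy
  obtain ⟨⟨_, k⟩, hk, rfl⟩ := List.mem_map.1 hy
  rw [level_eq_of_mem hn h1, level_eq_of_mem hn (h2 _ hk)]
  exact levels_ge ψ _ _ _ hk

/-- On a loop through `x` within its body, no fixpoint of lower level is unfolded. -/
theorem level_le_of_loop {φ ψ ψ' : Formula P A X} {η η' : FixKind} {x y : X} (hcl : φ.Closed)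
    (hn : φ.bound.Nodup) (hx : fix η x ψ ∈ φ.subs) (hy : fix η' y ψ' ∈ φ.subs)
    (hψ' : ψ' ∈ ψ.subs) (hvar : var y ∈ ψ.subs ∨ fix η' y ψ' ∈ ψ.subs)
    (hpath : Relation.ReflTransGen φ.FStep ψ' (var x)) : φ.level x ≤ φ.level y := by
  by_cases hxy : y = x
  · rw [hxy]
  have hψ := body_mem_subs hx
  -- If `y` were bound outside, `fix η x ψ` would lie inside `ψ'`, which would then be larger than
  -- `ψ` instead of a subformula of it.
  have hmem : fix η' y ψ' ∈ ψ.subs := by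
    rcases hvar with h | h
    · rcases scope h (z := y) (by simp [fv]) with hf | ⟨ξ, χ, h1, h2⟩
      · obtain ⟨ξ, χ, h1, h2⟩ := scope_closed hcl hx (z := y) (by simp [fv, hf, hxy])
        obtain ⟨-, rfl⟩ := fix_unique hn hy h1
        have h3 := size_le_of_mem_subs h2
        have h4 := size_le_of_mem_subs hψ'
        simp only [size] at h3
        omega
      · obtain ⟨rfl, rfl⟩ := fix_unique hn hy (subs_trans hψ h1)
        exact h1
    · exact h
  refine (level_le_or hn hx (mem_bound_of_fix hmem)).resolve_right ?_
  -- A closed `θ` around the binder of `y` would trap the path, so `x` would occur in `θ` and be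
  -- bound there, inside its own body.
  rintro ⟨θ, hθ, hθf, hyθ⟩
  have hθφ := subs_trans hψ hθ
  obtain ⟨ξ, χ, h1⟩ := exists_fix_of_mem_bound hyθ
  obtain ⟨rfl, rfl⟩ := fix_unique hn hy (subs_trans hθφ h1)
  have h2 : var x ∈ θ.subs := by
    have h3 := body_mem_subs h1
    clear h1 hψ' hvar hmem hy
    induction hpath using Relation.ReflTransGen.head_induction_on with
    | refl => exact h3
    | head hs _ ih => exact ih (hs.mem_of_closed hn hθφ hθf h3)
  obtain ⟨ξ, χ, h3, -⟩ := scope_closed hθf h2 (z := x) (by simp [fv])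
  exact not_mem_bound_body hn hx (mem_bound_of_fix (subs_trans hθ h3))

/-! ### Active `μ`-variables on loops -/

/-- Unfolding variables that differ from `x` leads from `y` to `x`. -/
inductive Leads (φ : Formula P A X) (x : X) : X → Prop
  | refl : Leads φ x x
  | step {y z : X} {η : FixKind} {ψ : Formula P A X} : fix η y ψ ∈ φ.subs → z ∈ ψ.fv → z ≠ y →
      Leads φ x z → Leads φ x y

/-- If `z` gets bound on the way from `β` up to `α`, the chain is followed one link further: the
next variable is free in the fixpoint formula of `z`, again a subformula of `α`. The chain cannot be
used up, since `x` is not bound in `α`. -/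
theorem Leads.of_sub {φ α : Formula P A X} {x z : X} (hn : φ.bound.Nodup) (h : φ.Leads x z)
    (hα : α ∈ φ.subs) (hx : x ∉ α.bound) : ∀ β ∈ α.subs, z ∈ β.fv → ∃ y ∈ α.fv, φ.Leads x y := by
  induction h with
  | refl =>
    intro β hβ hz
    rcases scope hβ hz with h | ⟨η, ψ, h, -⟩
    · exact ⟨_, h, .refl⟩
    · exact absurd (mem_bound_of_fix h) hx
  | step h1 h2 h3 h4 ih =>
    intro β hβ hz
    rcases scope hβ hz with h | ⟨η, ψ, h, -⟩
    · exact ⟨_, h, .step h1 h2 h3 h4⟩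
    · obtain ⟨rfl, rfl⟩ := fix_unique hn h1 (subs_trans hα h)
      exact ih _ h (by simp [fv, h2, h3])

/-- Each link passes to a variable bound further outside, whose body is larger. This growth pays for
the unit of fuel that is spent, so fuel `φ.size` never runs out. -/
theorem Leads.activeVar {φ ψ : Formula P A X} {x y : X} (hcl : φ.Closed) (hn : φ.bound.Nodup)
    (hx : fix .mu x ψ ∈ φ.subs) (h : φ.Leads x y) : ∀ η ψ' m, fix η y ψ' ∈ φ.subs →
      φ.size < m + ψ'.size → φ.activeVar m y = true := by
  induction h with
  | refl =>
    intro η ψ' m h hm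
    cases m with
    | zero => have := size_le_of_mem_subs h; simp only [size] at this; omega
    | succ m => simp [Formula.activeVar, binder_eq_some hn hx]
  | @step y z ξ χ h1 h2 h3 h4 ih =>
    intro η ψ' m h hm
    obtain ⟨rfl, rfl⟩ := fix_unique hn h1 h
    cases m with
    | zero => have := size_le_of_mem_subs h; simp only [size] at this; omega
    | succ m =>
      simp only [Formula.activeVar, binder_eq_some hn h]
      cases ξ with
      | mu => rfl
      | nu =>
        obtain ⟨ζ, χ', h5, h6⟩ := scope_closed hcl h1 (z := z) (by simp [fv, h2, h3])
        have := size_le_of_mem_subs h6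
        simp only [size] at this
        simpa using ⟨z, ⟨h3, h2⟩, ih ζ χ' m h5 (by omega)⟩

/-- Going backwards along the path from `x`, every formula keeps a free variable that leads to `x`.
This is where threads meet the syntactic notion of active variables, and so weak aconjunctivity. -/
theorem active_of_loop {φ ψ α : Formula P A X} {x : X} (hcl : φ.Closed) (hn : φ.bound.Nodup)
    (hx : fix .mu x ψ ∈ φ.subs)
    (h : Relation.ReflTransGen (fun α β => φ.FStep α β ∧ α ∈ ψ.subs) α (var x))
    (hα : α ∈ φ.subs) : φ.active α = true := by
  have key : ∃ y ∈ α.fv, φ.Leads x y := by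
    clear hα
    induction h using Relation.ReflTransGen.head_induction_on with
    | refl => exact ⟨x, by simp [fv], .refl⟩
    | @head γ δ hs _ ih =>
      obtain ⟨y, hy, hyx⟩ := ih
      obtain ⟨hs | ⟨η, z, rfl, hz⟩, hγ⟩ := hs
      · refine hyx.of_sub hn (subs_trans (body_mem_subs hx) hγ) (fun h => ?_) δ hs hy
        exact not_mem_bound_body hn hx ((bound_sublist hγ).subset h)
      · refine ⟨z, by simp [fv], ?_⟩
        by_cases hyz : y = z
        · exact hyz ▸ hyx
        · exact .step hz hy hyz hyx
  obtain ⟨y, hy, hyx⟩ := key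
  obtain ⟨η, ψ', h1, -⟩ := scope_closed hcl hα hy
  simp only [active, decide_eq_true_eq]
  have := size_pos ψ'
  exact ⟨y, hy, hyx.activeVar hcl hn hx η ψ' _ h1 (by omega)⟩

end Formula

/-! ### Partial permutations along moves -/

section Pperm

variable {T : Type x} [DecidableEq T]

theorem dropRepeats_length (t : List (Option T)) :
    ∀ seen, (dropRepeats seen t).length = t.length := by
  induction t with
  | nil => simp [dropRepeats]
  | cons o t ih =>
    intro seen
    cases o with
    | none => simp [dropRepeats, ih]
    | some y => simp only [dropRepeats]; split_ifs <;> simp [ih]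

theorem getElem?_of_dropRepeats (t : List (Option T)) : ∀ (seen : List T) (j : ℕ) (y : T),
    (dropRepeats seen t)[j]? = some (some y) → t[j]? = some (some y) := by
  induction t with
  | nil => simp [dropRepeats]
  | cons o t ih =>
    intro seen j y
    cases j with
    | zero =>
      cases o with
      | none => simp [dropRepeats]
      | some z => simp only [dropRepeats]; split_ifs <;> simp
    | succ j =>
      cases o with
      | none => simpa [dropRepeats] using ih _ j y
      | some z => simp only [dropRepeats]; split_ifs <;> simpa using ih _ j y

theorem dropRepeats_getElem? (t : List (Option T)) : ∀ (seen : List T) (j : ℕ) (y : T),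
    t[j]? = some (some y) → y ∉ seen → (∀ i < j, t[i]? ≠ some (some y)) →
    (dropRepeats seen t)[j]? = some (some y) := by
  induction t with
  | nil => simp
  | cons o t ih =>
    intro seen j y hj hs hi
    cases j with
    | zero =>
      simp only [List.getElem?_cons_zero, Option.some.injEq] at hj
      subst hj
      simp [dropRepeats, hs]
    | succ j =>
      simp only [List.getElem?_cons_succ] at hj
      have hi' : ∀ i < j, t[i]? ≠ some (some y) := fun i h => by
        simpa using hi (i + 1) (by omega)
      cases o with
      | none => simpa [dropRepeats] using ih _ j y hj hs hi'
      | some z =>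
        have hz : y ≠ z := by
          have := hi 0 (by omega)
          rintro rfl; simp at this
        simp only [dropRepeats]
        split_ifs
        · simpa using ih _ j y hj hs hi'
        · simpa using ih (z :: seen) j y hj (by simp [hz, hs]) hi'

/-- Removing holes shifts an entry to the left, strictly iff some hole precedes it; places in the
list thereby measure age. -/
theorem reduceOption_getElem? (t : List (Option T)) : ∀ (j : ℕ) (y : T),
    t[j]? = some (some y) → ∃ i ≤ j, t.reduceOption[i]? = some y ∧
      ((∃ r < j, t[r]? = some none) → i < j) ∧ ((∀ r < j, t[r]? ≠ some none) → i = j) := by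
  induction t with
  | nil => simp
  | cons o t ih =>
    intro j y hj
    cases j with
    | zero =>
      simp only [List.getElem?_cons_zero, Option.some.injEq] at hj
      subst hj
      exact ⟨0, le_rfl, by simp [List.reduceOption_cons_of_some], by simp, by simp⟩
    | succ j =>
      simp only [List.getElem?_cons_succ] at hj
      obtain ⟨i, hi, h1, h2, h3⟩ := ih j y hj
      cases o with
      | none =>
        refine ⟨i, by omega, by simpa [List.reduceOption_cons_of_none] using h1,
          fun _ => by omega, fun h => ?_⟩
        exact absurd (by simp) (h 0 (by omega))
      | some z =>
        refine ⟨i + 1, by omega, by simpa [List.reduceOption_cons_of_some] using h1, ?_, ?_⟩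
        · rintro ⟨r, hr, h⟩
          cases r with
          | zero => simp at h
          | succ r => have := h2 ⟨r, by omega, by simpa using h⟩; omega
        · intro h
          rw [h3 fun r hr => by simpa using h (r + 1) (by omega)]

theorem nextPerm_getElem? {t : List (Option T)} {fresh : List T} {i : ℕ} {y : T}
    (h : t.reduceOption[i]? = some y) : (nextPerm t fresh)[i]? = some y := by
  obtain ⟨hi, -⟩ := List.getElem?_eq_some_iff.1 h
  simp only [nextPerm]
  rw [List.getElem?_append_left hi, h]

theorem findIdx_isNone_le {t : List (Option T)} {j : ℕ} (h : t[j]? = some none) :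
    t.findIdx Option.isNone ≤ j := by
  by_contra hlt
  obtain ⟨hj, h⟩ := List.getElem?_eq_some_iff.1 h
  have := List.not_of_lt_findIdx (not_le.1 hlt)
  rw [h] at this
  simp at this

theorem getElem?_findIdx_isNone {t : List (Option T)}
    (h : t.findIdx Option.isNone < t.length) : t[t.findIdx Option.isNone]? = some none := by
  have := List.findIdx_getElem (w := h)
  rw [List.getElem?_eq_getElem h]
  simpa using this

/-- If the priority of a move is at most that of an active entry at place `a`, then no entry up
to place `a` is removed, and the entry at place `a` is active if the priority is that one. -/
theorem track_of_permPriority_le {q a : ℕ} {l : List T} {track : T → Option T} {hit : T → Bool}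
    {fresh : List T} (hq : l.length ≤ q) {y : T} (hy : l[a]? = some y)
    (h : permPriority q l (dropRepeats [] (l.map track)) hit ≤ 2 * (q - a) - 1) :
    (∃ z, track y = some z ∧ (nextPerm (dropRepeats [] (l.map track)) fresh)[a]? = some z) ∧
      (permPriority q l (dropRepeats [] (l.map track)) hit = 2 * (q - a) - 1 → hit y = true) := by
  have hlen : (dropRepeats [] (l.map track)).length = l.length := by
    simp [dropRepeats_length]
  obtain ⟨ha, rfl⟩ := List.getElem?_eq_some_iff.1 hy
  have hsome : ∀ j y, (dropRepeats [] (l.map track))[j]? = some (some y) →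
    (l.map track)[j]? = some (some y) := getElem?_of_dropRepeats _ []
  generalize dropRepeats [] (l.map track) = t at *
  -- A removal at or before place `a` forces a priority above `2 * (q - a) - 1`: either the removal
  -- is reported, or an active entry that is older still. That `q` bounds the length keeps the
  -- subtractions from truncating.
  have hr : a < t.findIdx Option.isNone := by
    by_contra hlt
    simp only [permPriority] at h
    rw [if_pos (Or.inl (by omega))] at h
    split_ifs at h <;> omega
  have hnone : ∀ j ≤ a, t[j]? ≠ some none := fun j hj h => by
    have := findIdx_isNone_le h; omega
  constructor
  · have hta : t[a]? = some t[a] := List.getElem?_eq_getElem (by omega)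
    cases hv : t[a] with
    | none => exact absurd (hv ▸ hta) (hnone a le_rfl)
    | some z =>
      rw [hv] at hta
      obtain ⟨i, -, h1, -, h3⟩ := reduceOption_getElem? t a z hta
      obtain rfl := h3 fun r hr => hnone r hr.le
      refine ⟨z, ?_, nextPerm_getElem? h1⟩
      have := hsome _ _ hta
      rw [List.getElem?_map, List.getElem?_eq_getElem ha] at this
      simpa using this
  · intro heq
    simp only [permPriority] at heq
    have hidx : (l.zip t).findIdx (fun z => z.2.isSome && hit z.1) = a := by
      split_ifs at heq <;> omega
    have hlt : (l.zip t).findIdx (fun z => z.2.isSome && hit z.1) < (l.zip t).length := by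
      rw [hidx, List.length_zip]; omega
    have := List.findIdx_getElem (w := hlt)
    simp only [hidx, List.getElem_zip, Bool.and_eq_true] at this
    exact this.2

/-- A tracked entry does not move towards the end. If it keeps its place `a`, then the priority is
at least that of an active entry at place `a` if the entry is active, and otherwise it is odd or
smaller. -/
theorem idxOf_track {q : ℕ} {l : List T} {track : T → Option T} {hit : T → Bool}
    {fresh : List T} (hq : l.length ≤ q) {y z : T} (hy : y ∈ l) (hz : track y = some z)
    {l' : List T} (hl' : nextPerm (dropRepeats [] (l.map track)) fresh = l') {p : ℕ}
    (hp : permPriority q l (dropRepeats [] (l.map track)) hit = p) :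
    z ∈ l' ∧ l'.idxOf z ≤ l.idxOf y ∧ (l'.idxOf z = l.idxOf y →
      (hit y = true → 2 * (q - l.idxOf y) - 1 ≤ p) ∧ (Even p → p < 2 * (q - l.idxOf y) - 1)) := by
  have hlen : (dropRepeats [] (l.map track)).length = l.length := by
    simp [dropRepeats_length]
  have ha : l.idxOf y < l.length := List.idxOf_lt_length_iff.2 hy
  have hla : l[l.idxOf y] = y := List.getElem_idxOf ha
  generalize l.idxOf y = a at *
  have hex : ∃ j, (l.map track)[j]? = some (some z) :=
    ⟨a, by rw [List.getElem?_map, List.getElem?_eq_getElem ha]; simp [hla, hz]⟩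
  classical
  -- Several entries may be tracked to `z`; `dropRepeats` keeps the first of them, at place `j ≤ a`.
  have hja : Nat.find hex ≤ a := Nat.find_min' hex (by
    rw [List.getElem?_map, List.getElem?_eq_getElem ha]; simp [hla, hz])
  have htj := dropRepeats_getElem? _ [] _ _ (Nat.find_spec hex) (by simp)
    fun i hi => Nat.find_min hex hi
  generalize Nat.find hex = j at *
  generalize dropRepeats [] (l.map track) = t at *
  obtain ⟨i, hij, h1, h2, -⟩ := reduceOption_getElem? t j z htj
  have h3 : l'[i]? = some z := by rw [← hl']; exact nextPerm_getElem? h1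
  obtain ⟨hil, h4⟩ := List.getElem?_eq_some_iff.1 h3
  have hzl : z ∈ l' := h4 ▸ List.getElem_mem hil
  have hidx : l'.idxOf z ≤ i := by
    by_contra hlt
    have := List.not_of_lt_findIdx (xs := l') (p := (· == z)) (not_le.1 hlt)
    simp [h4] at this
  refine ⟨hzl, by omega, fun heq => ?_⟩
  have hji : j = a := by omega
  have hia : i = a := by omega
  subst hji
  -- The place was kept, so there was no merging and no removal at or before it. An even nonzero
  -- priority therefore reports a younger entry and is smaller.
  have hr : j < t.findIdx Option.isNone := by
    by_contra hlt
    rcases (not_lt.1 hlt).eq_or_lt with he | hl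
    · have := getElem?_findIdx_isNone (t := t) (by omega)
      rw [he, htj] at this
      simp at this
    · have := h2 ⟨_, hl, getElem?_findIdx_isNone (by omega)⟩
      omega
  simp only [permPriority] at hp
  constructor
  · intro hit'
    have hj : (l.zip t).findIdx (fun z => z.2.isSome && hit z.1) ≤ j := by
      by_contra hlt
      have h5 := List.not_of_lt_findIdx (not_le.1 hlt)
      simp only [List.getElem_zip, hla, hit', Bool.and_true] at h5
      obtain ⟨h6, h7⟩ := List.getElem?_eq_some_iff.1 htj
      rw [h7] at h5
      simp at h5
    split_ifs at hp <;> omega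
  · intro he
    rw [Nat.even_iff] at he
    split_ifs at hp <;> omega

end Pperm

section Pperm

variable {T : Type x} [DecidableEq T]

theorem permPriority_le (q : ℕ) (l : List T) (t : List (Option T)) (hit : T → Bool) :
    permPriority q l t hit ≤ 2 * q := by
  simp only [permPriority]
  split_ifs <;> omega

theorem exists_of_odd_permPriority {q : ℕ} {l : List T} {t : List (Option T)} {hit : T → Bool}
    (h : ¬ Even (permPriority q l t hit)) :
    ∃ a < l.length, permPriority q l t hit = 2 * (q - a) - 1 := by
  simp only [permPriority] at h ⊢
  split_ifs at h ⊢ with h1 h2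
  · exact absurd (even_two_mul _) h
  · exact ⟨_, by omega, rfl⟩
  · exact absurd Even.zero h

end Pperm

namespace Formula

open Filter

variable {P : Type u} {A : Type v} {X : Type w} [DecidableEq P] [DecidableEq A] [DecidableEq X]

/-! ### Modal groups -/

/-- A formula contributes to at most one of the two lists, so equality of lengths leaves room for
modal literals only. This explains the length test in `modalGroup`. -/
theorem length_diaArgs_add_boxArgs_le (l : List (Formula P A X)) :
    (diaArgs l).length + (boxArgs l).length ≤ l.length ∧
      ((diaArgs l).length + (boxArgs l).length = l.length →
        ∀ δ ∈ l, (∃ d ∈ diaArgs l, δ = dia d.1 d.2) ∨ ∃ d ∈ boxArgs l, δ = box d.1 d.2) := by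
  induction l with
  | nil => simp [diaArgs, boxArgs]
  | cons γ l ih =>
    have hle := ih.1
    have lift : ∀ γ : Formula P A X,
        ((diaArgs l).length + (boxArgs l).length = l.length) →
        ((∃ d ∈ diaArgs (γ :: l), γ = dia d.1 d.2) ∨ ∃ d ∈ boxArgs (γ :: l), γ = box d.1 d.2) →
        ∀ δ ∈ γ :: l, (∃ d ∈ diaArgs (γ :: l), δ = dia d.1 d.2) ∨
          ∃ d ∈ boxArgs (γ :: l), δ = box d.1 d.2 := by
      intro γ h1 h2 δ hδ
      rcases List.mem_cons.1 hδ with rfl | hδ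
      · exact h2
      · refine (ih.2 h1 δ hδ).imp ?_ ?_
        · rintro ⟨d, hd, h⟩
          refine ⟨d, ?_, h⟩
          simp only [diaArgs, List.mem_filterMap, List.mem_cons] at hd ⊢
          obtain ⟨ε, hε, hd⟩ := hd
          exact ⟨ε, Or.inr hε, hd⟩
        · rintro ⟨d, hd, h⟩
          refine ⟨d, ?_, h⟩
          simp only [boxArgs, List.mem_filterMap, List.mem_cons] at hd ⊢
          obtain ⟨ε, hε, hd⟩ := hd
          exact ⟨ε, Or.inr hε, hd⟩
    cases γ with
    | dia a ξ =>
      have h1 : diaArgs (dia a ξ :: l) = (a, ξ) :: diaArgs l := rfl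
      have h2 : boxArgs (dia a ξ :: l) = boxArgs l := rfl
      have h3 := lift (dia a ξ)
      rw [h1, h2] at h3 ⊢
      simp only [List.length_cons]
      exact ⟨by omega, fun h => h3 (by omega) (Or.inl ⟨(a, ξ), by simp, rfl⟩)⟩
    | box a ξ =>
      have h1 : diaArgs (box a ξ :: l) = diaArgs l := rfl
      have h2 : boxArgs (box a ξ :: l) = (a, ξ) :: boxArgs l := rfl
      have h3 := lift (box a ξ)
      rw [h1, h2] at h3 ⊢
      simp only [List.length_cons]
      exact ⟨by omega, fun h => h3 (by omega) (Or.inr ⟨(a, ξ), by simp, rfl⟩)⟩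
    | _ =>
      refine ⟨?_, fun h => ?_⟩
      all_goals simp [diaArgs, boxArgs] at hle ⊢
      · omega
      · simp [diaArgs, boxArgs] at h; omega

theorem modalGroup_eq_some {γ χ : Formula P A X} {a : A} {ds : List (Formula P A X)}
    (h : modalGroup γ = some (a, ds, χ)) :
    box a χ ∈ γ.conjuncts ∧ (∀ ξ ∈ ds, dia a ξ ∈ γ.conjuncts ∧ isDisjunct ξ χ = true) ∧
      ∀ δ ∈ γ.conjuncts, (∃ ξ ∈ ds, δ = dia a ξ) ∨ δ = box a χ := by
  simp only [modalGroup] at h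
  split at h
  · rename_i b ψ hb
    split_ifs at h with hc
    simp only [Option.some.injEq, Prod.mk.injEq] at h
    obtain ⟨rfl, rfl, rfl⟩ := h
    obtain ⟨-, hlen, hact, hdis, -⟩ := hc
    have hall := (length_diaArgs_add_boxArgs_le γ.conjuncts).2
      (by rw [hb, hlen]; simp)
    refine ⟨?_, fun ξ hξ => ⟨?_, hdis ξ hξ⟩, fun δ hδ => ?_⟩
    · have : (b, ψ) ∈ boxArgs γ.conjuncts := by simp [hb]
      simp only [boxArgs, List.mem_filterMap] at this
      obtain ⟨ε, hε, h⟩ := this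
      cases ε <;> simp at h
      obtain ⟨rfl, rfl⟩ := h
      exact hε
    · obtain ⟨⟨c, ξ'⟩, hd, rfl⟩ := List.mem_map.1 hξ
      obtain rfl : c = b := hact _ hd
      simp only [diaArgs, List.mem_filterMap] at hd
      obtain ⟨ε, hε, h⟩ := hd
      cases ε <;> simp at h
      obtain ⟨rfl, rfl⟩ := h
      exact hε
    · rcases hall δ hδ with ⟨d, hd, rfl⟩ | ⟨d, hd, rfl⟩
      · exact Or.inl ⟨d.2, List.mem_map.2 ⟨d, hd, rfl⟩, by rw [hact d hd]⟩
      · rw [hb, List.mem_singleton] at hd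
        subst hd
        exact Or.inr rfl
  · simp at h

/-! ### The evaluation game -/

variable {W : Type x}

/-- The priority of unfolding a fixpoint of level `k`. -/
def levelPriority (φ : Formula P A X) (k : ℕ) : ℕ := 2 * φ.ad + 2 - k

/-- The positions of Eloise in the evaluation game. -/
def evalOwn (K : Kripke P A W) : W × Formula P A X → Prop
  | (_, bot) => True
  | (s, prop p) => s ∉ K.val p
  | (s, nprop p) => s ∈ K.val p
  | (_, or _ _) => True
  | (_, dia _ _) => True
  | _ => False

/-- The moves of the evaluation game. -/
def evalMoves (φ : Formula P A X) (K : Kripke P A W) :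
    W × Formula P A X → Set (ℕ × W × Formula P A X)
  | (s, and α β) => {(0, s, α), (0, s, β)}
  | (s, or α β) => {(0, s, α), (0, s, β)}
  | (s, dia a α) => {m | ∃ t, K.rel a s t ∧ m = (0, t, α)}
  | (s, box a α) => {m | ∃ t, K.rel a s t ∧ m = (0, t, α)}
  | (s, fix _ y α) => {(φ.levelPriority (φ.level y), s, α)}
  | (s, var y) => {m | ∃ η ψ, fix η y ψ ∈ φ.subs ∧ m = (φ.levelPriority (φ.level y), s, ψ)}
  | _ => ∅

/-- The evaluation game for the subformulas of `φ` over a Kripke structure. -/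
def evalArena (φ : Formula P A X) (K : Kripke P A W) : Arena (W × Formula P A X) where
  own := evalOwn K
  mv := φ.evalMoves K
  good := Even

/-- Moves to subformulas of `ψ` that do not unfold the variables in `F`. -/
def evalI (ψ : Formula P A X) (F : Set X) (v : W × Formula P A X) :
    Set (ℕ × W × Formula P A X) :=
  {m | m.2.2 ∈ ψ.subs ∧ ∀ y ∈ F, v.2 ≠ var y}

/-- Moves that unfold a variable in `F` at a state where it is true. -/
def evalO (φ : Formula P A X) (K : Kripke P A W) (F : Set X) (i : X → Set W)
    (v : W × Formula P A X) : Set (ℕ × W × Formula P A X) :=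
  {m | m ∈ φ.evalMoves K v ∧ ∃ y ∈ F, v.2 = var y ∧ v.1 ∈ i y}

theorem fStep_of_evalMoves {φ : Formula P A X} {K : Kripke P A W} {v : W × Formula P A X}
    {m : ℕ × W × Formula P A X} (h : m ∈ φ.evalMoves K v) : φ.FStep v.2 m.2.2 := by
  obtain ⟨s, α⟩ := v
  cases α with
  | bot | top | prop | nprop => exact absurd h (Set.notMem_empty _)
  | and α β | or α β =>
    rcases h with rfl | rfl <;> exact Or.inl (by simp [subs, self_mem_subs])
  | dia a α | box a α =>
    obtain ⟨t, -, rfl⟩ := h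
    exact Or.inl (by simp [subs, self_mem_subs])
  | fix η y α =>
    rw [evalMoves, Set.mem_singleton_iff] at h
    subst h
    exact Or.inl (by simp [subs, self_mem_subs])
  | var y =>
    obtain ⟨η, ψ, h, rfl⟩ := h
    exact Or.inr ⟨η, y, rfl, h⟩

theorem evalMoves_priority {φ : Formula P A X} {K : Kripke P A W} {v : W × Formula P A X}
    {m : ℕ × W × Formula P A X} (h : m ∈ φ.evalMoves K v) (hv : v.2 ∈ φ.subs) :
    m.1 = 0 ∨ ∃ η y, fix η y m.2.2 ∈ φ.subs ∧ m.1 = φ.levelPriority (φ.level y) ∧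
      (v.2 = var y ∨ v.2 = fix η y m.2.2) := by
  obtain ⟨s, α⟩ := v
  cases α with
  | bot | top | prop | nprop => exact absurd h (Set.notMem_empty _)
  | and α β | or α β => rcases h with rfl | rfl <;> exact Or.inl rfl
  | dia a α | box a α =>
    obtain ⟨t, -, rfl⟩ := h
    exact Or.inl rfl
  | fix η y α =>
    rw [evalMoves, Set.mem_singleton_iff] at h
    subst h
    exact Or.inr ⟨η, y, hv, rfl, Or.inr rfl⟩
  | var y =>
    obtain ⟨η, ψ, h, rfl⟩ := h
    exact Or.inr ⟨η, y, h, rfl, Or.inl rfl⟩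

/-- All fixpoints unfolded on the loop have level at least that of `x` by `level_le_of_loop`, and
lower levels have higher priorities. So the recurring unfoldings of `x` determine the highest
priority. -/
theorem even_of_nu_loop {φ ψ : Formula P A X} {K : Kripke P A W} {x : X} (hcl : φ.Closed)
    (hn : φ.bound.Nodup) (hx : fix .nu x ψ ∈ φ.subs) {ρ : ℕ → W × Formula P A X} {π : ℕ → ℕ}
    (hm : ∀ n, (π n, ρ (n + 1)) ∈ φ.evalMoves K (ρ n)) (hs : ∀ n, (ρ (n + 1)).2 ∈ ψ.subs)
    (hf : ∃ᶠ n in atTop, (ρ n).2 = var x) : (φ.evalArena K).PlayGood π := by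
  intro q hq1 hq2
  show Even q
  have hψ := body_mem_subs hx
  by_contra hodd
  -- Levels are subtracted from an even number not below them, so parity is preserved and the order
  -- reversed.
  have hpar : Even (φ.levelPriority (φ.level x)) := by
    have h1 := level_mod hn hx
    have h2 := level_le_ad φ x
    simp only [reduceCtorEq, iff_false] at h1
    rw [Nat.even_iff, levelPriority]
    omega
  have hle : φ.levelPriority (φ.level x) ≤ q := by
    obtain ⟨n, hn1, hn2⟩ := (hf.and_eventually hq2).exists
    have h := hm n
    rcases hρ : ρ n with ⟨s, α⟩
    rw [hρ] at h hn1
    simp only at hn1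
    subst hn1
    obtain ⟨η, χ, -, h⟩ := h
    have := congrArg Prod.fst h
    simp only at this
    omega
  obtain ⟨n, hqn, hn1⟩ := (hq1.and_eventually (eventually_ge_atTop 1)).exists
  obtain ⟨n, rfl⟩ := Nat.exists_eq_add_of_le' hn1
  rcases evalMoves_priority (hm (n + 1)) (subs_trans hψ (hs n)) with h0 | ⟨η, y, h1, h2, h3⟩
  · simp only at h0
    exact hodd (by rw [← hqn, h0]; exact Even.zero)
  · simp only at h1 h2 h3
    obtain ⟨k, hk, hkn⟩ := (hf.and_eventually (eventually_ge_atTop (n + 1 + 1))).exists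
    obtain ⟨j, rfl⟩ := Nat.exists_eq_add_of_le hkn
    have hpath : Relation.ReflTransGen φ.FStep (ρ (n + 1 + 1)).2 (var x) := by
      rw [← hk]
      clear hk hkn
      induction j with
      | zero => exact .refl
      | succ j ih => exact ih.tail (fStep_of_evalMoves (hm _))
    have hlev := level_le_of_loop hcl hn hx h1 (hs (n + 1))
      (h3.imp (fun h4 => by rw [← h4]; exact hs n) fun h4 => by rw [← h4]; exact hs n) hpath
    have : q = φ.levelPriority (φ.level x) := by
      refine le_antisymm ?_ hle
      rw [← hqn, h2, levelPriority, levelPriority]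
      omega
    exact hodd (this ▸ hpar)

/-- True formulas are winning positions in the evaluation game. -/
theorem win_of_mem_sem {φ : Formula P A X} (K : Kripke P A W) (hcl : φ.Closed)
    (hn : φ.bound.Nodup) (ψ : Formula P A X) : ψ ∈ φ.subs → ∀ F : Set X, (∀ y ∈ ψ.fv, y ∈ F) →
      (∀ y ∈ F, y ∉ ψ.bound) → ∀ i : X → Set W, ∀ s ∈ ψ.sem K i,
      (s, ψ) ∈ (φ.evalArena K).Win (evalI ψ F) (φ.evalO K F i) := by
  have hmono : ∀ (α ψ : Formula P A X) (F : Set X) (i : X → Set W), α ∈ ψ.subs →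
      (φ.evalArena K).Win (evalI α F) (φ.evalO K F i) ⊆
        (φ.evalArena K).Win (evalI ψ F) (φ.evalO K F i) := fun α ψ F i h =>
    Arena.win_mono (fun v m hm => ⟨subs_trans h hm.1, hm.2⟩) fun v m hm => Or.inl hm
  induction ψ with
  | bot => intro _ F _ _ i s hs; exact absurd hs (Set.notMem_empty _)
  | top =>
    intro _ F _ _ i s hs
    exact Arena.win_of_opp (fun h => h) fun m hm => absurd hm (Set.notMem_empty _)
  | prop p =>
    intro _ F _ _ i s hs
    exact Arena.win_of_opp (fun h => h hs) fun m hm => absurd hm (Set.notMem_empty _)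
  | nprop p =>
    intro _ F _ _ i s hs
    exact Arena.win_of_opp (fun h => hs h) fun m hm => absurd hm (Set.notMem_empty _)
  | var y =>
    intro _ F hF _ i s hs
    exact Arena.win_of_opp (fun h => h) fun m hm =>
      Or.inl ⟨hm, y, hF y (by simp [fv]), rfl, hs⟩
  | and α β ih1 ih2 =>
    intro h F hF hB i s hs
    have h1 : α ∈ (and α β).subs := by simp [subs, self_mem_subs]
    have h2 : β ∈ (and α β).subs := by simp [subs, self_mem_subs]
    refine Arena.win_of_opp (fun h => h) fun m hm => Or.inr ?_
    rcases hm with rfl | rfl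
    · exact ⟨⟨h1, by simp⟩, hmono _ _ F i h1 (ih1 (subs_trans h h1) F
        (fun y hy => hF y (by simp [fv, hy])) (fun y hy hb => hB y hy (by simp [bound, hb]))
        i s hs.1)⟩
    · exact ⟨⟨h2, by simp⟩, hmono _ _ F i h2 (ih2 (subs_trans h h2) F
        (fun y hy => hF y (by simp [fv, hy])) (fun y hy hb => hB y hy (by simp [bound, hb]))
        i s hs.2)⟩
  | or α β ih1 ih2 =>
    intro h F hF hB i s hs
    have h1 : α ∈ (or α β).subs := by simp [subs, self_mem_subs]
    have h2 : β ∈ (or α β).subs := by simp [subs, self_mem_subs]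
    rcases hs with hs | hs
    · exact Arena.win_of_own trivial (m := (0, s, α)) (Or.inl rfl) (Or.inr ⟨⟨h1, by simp⟩,
        hmono _ _ F i h1 (ih1 (subs_trans h h1) F
        (fun y hy => hF y (by simp [fv, hy])) (fun y hy hb => hB y hy (by simp [bound, hb]))
        i s hs)⟩)
    · exact Arena.win_of_own trivial (m := (0, s, β)) (Or.inr rfl) (Or.inr ⟨⟨h2, by simp⟩,
        hmono _ _ F i h2 (ih2 (subs_trans h h2) F
        (fun y hy => hF y (by simp [fv, hy])) (fun y hy hb => hB y hy (by simp [bound, hb]))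
        i s hs)⟩)
  | dia a α ih =>
    intro h F hF hB i s hs
    have h1 : α ∈ (dia a α).subs := by simp [subs, self_mem_subs]
    obtain ⟨t, hst, ht⟩ := hs
    exact Arena.win_of_own trivial (m := (0, t, α)) ⟨t, hst, rfl⟩ (Or.inr ⟨⟨h1, by simp⟩,
      hmono _ _ F i h1 (ih (subs_trans h h1) F hF hB i t ht)⟩)
  | box a α ih =>
    intro h F hF hB i s hs
    have h1 : α ∈ (box a α).subs := by simp [subs, self_mem_subs]
    refine Arena.win_of_opp (fun h => h) ?_
    rintro m ⟨t, hst, rfl⟩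
    exact Or.inr ⟨⟨h1, by simp⟩, hmono _ _ F i h1 (ih (subs_trans h h1) F hF hB i t (hs t hst))⟩
  | fix η x ψ ih =>
    intro h F hF hB i s hs
    have h1 : ψ ∈ (fix η x ψ).subs := by simp [subs, self_mem_subs]
    have hxF : x ∉ F := fun hx => hB x hx (by simp [bound])
    have ih' := ih (subs_trans h h1) (insert x F)
      (fun y hy => by
        by_cases hyx : y = x
        · exact Or.inl hyx
        · exact Or.inr (hF y (by simp [fv, hy, hyx])))
      (fun y hy => by
        rcases hy with rfl | hy
        · exact not_mem_bound_body hn h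
        · exact fun hb => hB y hy (by simp [bound, hb]))
    have hI : ∀ v : W × Formula P A X, evalI ψ (insert x F) v ⊆ evalI ψ F v :=
      fun v m hm => ⟨hm.1, fun y hy => hm.2 y (Or.inr hy)⟩
    -- Binding `x` turns the exits that unfold `x` at states of `S` into moves to the body at states
    -- of `S`; other exits are unaffected.
    have hO : ∀ (S : Set W) (D : Set (W × Formula P A X)), (∀ t ∈ S, (t, ψ) ∈ D) →
        ∀ v, ∀ m ∈ φ.evalO K (insert x F) (Function.update i x S) v,
          m ∈ φ.evalO K F i v ∨ m ∈ evalI ψ F v ∧ m.2 ∈ D := by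
      rintro S D hSD ⟨t, α⟩ m ⟨hm, y, hy, hα, ht⟩
      simp only at hα ht
      subst hα
      by_cases hyx : y = x
      · subst hyx
        obtain ⟨ξ, χ, h2, rfl⟩ := hm
        obtain ⟨-, rfl⟩ := fix_unique hn h h2
        refine Or.inr ⟨⟨self_mem_subs _, fun z hz hzy => hxF ?_⟩, hSD t (by simpa using ht)⟩
        simp only [var.injEq] at hzy
        exact hzy ▸ hz
      · rw [Function.update_of_ne hyx] at ht
        exact Or.inl ⟨hm, y, hy.resolve_left hyx, rfl, ht⟩
    suffices hwin : (s, ψ) ∈ (φ.evalArena K).Win (evalI ψ F) (φ.evalO K F i) by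
      refine Arena.win_of_opp (fun h => h) fun m hm => Or.inr ?_
      obtain rfl : m = (φ.levelPriority (φ.level x), s, ψ) := hm
      exact ⟨⟨h1, by simp⟩, hmono _ _ F i h1 hwin⟩
    cases η with
    | mu =>
      -- The states at which the body is won form a pre-fixpoint.
      refine hs {t | (t, ψ) ∈ (φ.evalArena K).Win (evalI ψ F) (φ.evalO K F i)} fun t ht => ?_
      exact Arena.win_mono hI (hO _ _ fun t ht => ht) (ih' _ t ht)
    | nu =>
      obtain ⟨S, hS, hsS⟩ := hs
      -- Unfolding `x` in the post-fixpoint `S` leads back into the region, and doing so forever is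
      -- won by `even_of_nu_loop`.
      obtain ⟨c, hc⟩ := (φ.evalArena K).region_win (evalI ψ (insert x F))
        (φ.evalO K (insert x F) (Function.update i x S))
      refine hc.subset_win_of_loop hI (hO S _ fun t ht => ih' _ t (hS ht)) ?_ (ih' _ s (hS hsS))
      intro ρ π hm hmI hf
      refine even_of_nu_loop hcl hn h hm (fun n => (hmI n).1) (hf.mono fun n hn => ?_)
      obtain ⟨⟨hm1, y, hy, hy1, hy2⟩, h2⟩ := hn
      rcases hy with rfl | hy
      · exact hy1
      · exact absurd hy1 ((hmI n).2 y hy)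

end Formula

namespace Formula

open Filter

variable {P : Type u} {A : Type v} {X : Type w} [DecidableEq P] [DecidableEq A] [DecidableEq X]
variable {W : Type x}

/-! ### Moves of the permutation game -/

theorem mem_permMoves_local {φ β : Formula P A X} {v : PNode P A X} {m : ℕ × PNode P A X}
    (hcl : clash v.1 = false) (hβ : φ.principal v.1 = some β) :
    m ∈ φ.permMoves v ↔ ∃ c ∈ φ.conclusions β, m = φ.permMove v.2 (v.1.erase β ∪ c.1)
      (φ.trackLocal β c.2) (φ.hitLocal β) (φ.freshLocal β c.2) := by
  simp only [permMoves, hcl, hβ, Bool.false_eq_true, if_false, List.mem_toFinset, List.mem_map]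
  exact exists_congr fun c => and_congr_right fun _ => eq_comm

theorem mem_permMoves_modal {φ : Formula P A X} {v : PNode P A X} {m : ℕ × PNode P A X}
    (hcl : clash v.1 = false) (hβ : φ.principal v.1 = none) :
    m ∈ φ.permMoves v ↔ ∃ d ∈ v.1.biUnion diamonds, m = φ.permMove v.2
      (insert d.2 (v.1.biUnion fun α => (modalNext d.1 d.2 α).toFinset))
      (fun y => (modalNext d.1 d.2 y.1).map fun α => (α, y.2)) (fun _ => false) [] := by
  simp only [permMoves, hcl, hβ, Bool.false_eq_true, if_false, Finset.mem_image]
  exact exists_congr fun c => and_congr_right fun _ => eq_comm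

theorem principal_mem {φ β : Formula P A X} {U : Finset (Formula P A X)}
    (h : φ.principal U = some β) : β ∈ U ∧ β.reducible = true ∧ β ∈ φ.subs := by
  have h1 := List.find?_some h
  simp only [Bool.and_eq_true, decide_eq_true_eq] at h1
  exact ⟨h1.1, h1.2, List.mem_of_find?_eq_some h⟩

theorem permEloise_local {φ β : Formula P A X} {v : PNode P A X} (hcl : clash v.1 = false)
    (hβ : φ.principal v.1 = some β) :
    φ.permEloise v = true ↔ ∃ α γ, β = or α γ := by
  simp only [permEloise, hcl, hβ, Bool.false_or]
  cases β <;> simp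

theorem permEloise_modal {φ : Formula P A X} {v : PNode P A X} (hcl : clash v.1 = false)
    (hβ : φ.principal v.1 = none) : φ.permEloise v = false := by
  simp [permEloise, hcl, hβ]

theorem length_le_of_mem_permNodes {φ : Formula P A X} {v : PNode P A X} (h : v ∈ φ.permNodes) :
    v.2.length ≤ φ.subs.toFinset.card * φ.numLevels := by
  rw [mem_permNodes, mem_pperm] at h
  obtain ⟨hU, hl, hlU⟩ := h
  rw [← List.toFinset_card_of_nodup hl]
  refine (Finset.card_le_card (t := φ.levelled v.1) fun y hy => hlU y (by simpa using hy)).trans ?_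
  rw [levelled, Finset.card_product, Finset.card_range]
  exact Nat.mul_le_mul_right _ (Finset.card_le_card fun α hα => by simpa using hU α hα)

/-! ### Threads in the evaluation game -/

/-- A move of priority `p` from a position in `D` by the strategy `c`. -/
def EvalStep (φ : Formula P A X) (K : Kripke P A W) (D : Set (W × Formula P A X))
    (c : W × Formula P A X → ℕ × W × Formula P A X) (p : ℕ) (a b : W × Formula P A X) : Prop :=
  a ∈ D ∧ (p, b) ∈ φ.evalMoves K a ∧ (evalOwn K a → (p, b) = c a)

variable {φ : Formula P A X} {K : Kripke P A W} {D : Set (W × Formula P A X)}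
  {c : W × Formula P A X → ℕ × W × Formula P A X} {i : X → Set W}

theorem not_mem_evalO_empty (a : W × Formula P A X) (m : ℕ × W × Formula P A X) :
    m ∉ φ.evalO K ∅ i a := by
  rintro ⟨-, y, hy, -⟩
  exact hy

theorem EvalStep.mem (hD : (φ.evalArena K).Region (evalI φ ∅) (φ.evalO K ∅ i) D c) {p : ℕ}
    {a b : W × Formula P A X} (h : φ.EvalStep K D c p a b) : b ∈ D :=
  (hD.stay h.1 h.2.1 (not_mem_evalO_empty _ _) h.2.2).2

/-- Such a thread would be a play in the winning region whose highest recurring priority is odd.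
Since `j < φ.numLevels`, the level `2 * j + 1` is at most `φ.ad`, so its priority is odd without
truncation. -/
theorem false_of_thread (hD : (φ.evalArena K).Region (evalI φ ∅) (φ.evalO K ∅ i) D c) {j : ℕ}
    (hj : j < φ.numLevels) {f : ℕ → W × Formula P A X} {hit : ℕ → Prop}
    (h : ∀ n, Relation.ReflTransGen
      (fun a b => ∃ p ≤ φ.levelPriority (2 * j + 1), φ.EvalStep K D c p a b) (f n) (f (n + 1)))
    (hh : ∀ n, hit n → φ.EvalStep K D c (φ.levelPriority (2 * j + 1)) (f n) (f (n + 1)))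
    (hf : ∃ᶠ n in atTop, hit n) : False := by
  obtain ⟨g, -, hg, hgf⟩ := exists_path_of_seq (fun n => Or.inl (h n)) hh hf
  -- A step may be justified by more than one priority; the target priority is recorded whenever it
  -- is possible.
  have hg' : ∀ n, ∃ p ≤ φ.levelPriority (2 * j + 1), φ.EvalStep K D c p (g n) (g (n + 1)) ∧
      (φ.EvalStep K D c (φ.levelPriority (2 * j + 1)) (g n) (g (n + 1)) →
        p = φ.levelPriority (2 * j + 1)) := by
    intro n
    by_cases hs : φ.EvalStep K D c (φ.levelPriority (2 * j + 1)) (g n) (g (n + 1))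
    · exact ⟨_, le_rfl, hs, fun _ => rfl⟩
    · obtain ⟨p, hp, hp'⟩ := (hg n).resolve_right hs
      exact ⟨p, hp, hp', fun h => absurd h hs⟩
  choose π hπ1 hπ2 hπ3 using hg'
  have heven : Even (φ.levelPriority (2 * j + 1)) :=
    hD.inf g π (fun n => (hπ2 n).1)
      (fun n => ⟨(hπ2 n).2.1, not_mem_evalO_empty _ _, (hπ2 n).2.2⟩) _
      (hgf.mono fun n hn => hπ3 n hn) (Eventually.of_forall hπ1)
  rw [numLevels] at hj
  rw [levelPriority, Nat.even_iff] at heven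
  omega

/-- Conjuncts are chosen by the opponent, so all of them stay in `D`. The evaluation game thus takes
apart the modal groups that the permutation game keeps whole. -/
theorem conjuncts_path (hD : (φ.evalArena K).Region (evalI φ ∅) (φ.evalO K ∅ i) D c) {s : W}
    (γ : Formula P A X) : (s, γ) ∈ D → ∀ δ ∈ γ.conjuncts, (s, δ) ∈ D ∧
      Relation.ReflTransGen (φ.EvalStep K D c 0) (s, γ) (s, δ) := by
  induction γ with
  | and α β ih1 ih2 =>
    intro h δ hδ
    have h1 : φ.EvalStep K D c 0 (s, and α β) (s, α) := ⟨h, Or.inl rfl, fun h => h.elim⟩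
    have h2 : φ.EvalStep K D c 0 (s, and α β) (s, β) := ⟨h, Or.inr rfl, fun h => h.elim⟩
    rcases List.mem_append.1 hδ with hδ | hδ
    · exact (ih1 (h1.mem hD) δ hδ).imp_right (.head h1)
    · exact (ih2 (h2.mem hD) δ hδ).imp_right (.head h2)
  | _ =>
    intro h δ hδ
    simp only [conjuncts, List.mem_singleton] at hδ
    subst hδ
    exact ⟨h, .refl⟩

/-- A diamond of a true formula is witnessed by a successor at which all the formulas are true
that arise by the modal rule. -/
theorem exists_modal_step (hD : (φ.evalArena K).Region (evalI φ ∅) (φ.evalO K ∅ i) D c) {s : W}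
    {α : Formula P A X} (hα : (s, α) ∈ D) {d : A × Formula P A X} (hd : d ∈ diamonds α) :
    ∃ t, (t, d.2) ∈ D ∧ ∀ γ, (s, γ) ∈ D → ∀ δ, modalNext d.1 d.2 γ = some δ → (t, δ) ∈ D ∧
      Relation.ReflTransGen (φ.EvalStep K D c 0) (s, γ) (t, δ) := by
  obtain ⟨a, ξ⟩ := d
  have hdia : (s, dia a ξ) ∈ D := by
    cases α with
    | dia b ψ =>
      simp only [diamonds, Finset.mem_singleton, Prod.mk.injEq] at hd
      obtain ⟨rfl, rfl⟩ := hd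
      exact hα
    | and β γ =>
      simp only [diamonds] at hd
      split at hd
      · rename_i b ds χ hg
        simp only [Finset.mem_image, List.mem_toFinset, Prod.mk.injEq] at hd
        obtain ⟨ξ, hξ, rfl, rfl⟩ := hd
        exact (conjuncts_path hD _ hα _ ((modalGroup_eq_some hg).2.1 _ hξ).1).1
      · simp at hd
    | _ => simp [diamonds] at hd
  -- Positionality matters here: the successor depends only on `s` and `dia a ξ`, so every literal
  -- and every modal group that continues as `ξ` agrees on `t`.
  obtain ⟨t, hst, hct⟩ := (hD.own _ hdia trivial).1
  have hstep : φ.EvalStep K D c 0 (s, dia a ξ) (t, ξ) :=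
    ⟨hdia, ⟨t, hst, rfl⟩, fun _ => hct.symm⟩
  have hbox : ∀ χ, (s, box a χ) ∈ D → φ.EvalStep K D c 0 (s, box a χ) (t, χ) :=
    fun χ hχ => ⟨hχ, ⟨t, hst, rfl⟩, fun h => h.elim⟩
  refine ⟨t, hstep.mem hD, fun γ hγ δ hδ => ?_⟩
  cases γ with
  | dia b ψ =>
    simp only [modalNext] at hδ
    split_ifs at hδ with hc
    obtain ⟨rfl, rfl⟩ := hc
    obtain rfl := Option.some.inj hδ
    exact ⟨hstep.mem hD, .single hstep⟩
  | box b χ =>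
    simp only [modalNext] at hδ
    split_ifs at hδ with hc
    subst hc
    obtain rfl := Option.some.inj hδ
    exact ⟨(hbox _ hγ).mem hD, .single (hbox _ hγ)⟩
  | and β γ =>
    simp only [modalNext] at hδ
    split at hδ
    · rename_i b ds χ hg
      obtain ⟨hg1, hg2, -⟩ := modalGroup_eq_some hg
      split_ifs at hδ with h1 h2
      · subst h1
        obtain rfl := Option.some.inj hδ
        exact ⟨hstep.mem hD, (conjuncts_path hD _ hγ _ (hg2 _ h2).1).2.tail hstep⟩
      · subst h1
        obtain rfl := Option.some.inj hδ
        obtain ⟨h3, h4⟩ := conjuncts_path hD _ hγ _ hg1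
        exact ⟨(hbox _ h3).mem hD, h4.tail (hbox _ h3)⟩
    · simp at hδ
  | _ => simp [modalNext] at hδ

/-- The priority in the evaluation game of the rule for a principal formula. -/
def rulePriority (φ β : Formula P A X) : ℕ := (φ.unfoldLevel β).elim 0 φ.levelPriority

theorem conclusions_step {s : W} {β : Formula P A X} (hβ : (s, β) ∈ D)
    (hor : ¬ ∃ α γ, β = or α γ) {e : Finset (Formula P A X) × Option (Formula P A X)}
    (he : e ∈ φ.conclusions β) {α : Formula P A X} (hα : α ∈ e.1) :
    φ.EvalStep K D c (φ.rulePriority β) (s, β) (s, α) := by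
  cases β with
  | and γ δ =>
    simp only [conclusions, List.mem_singleton] at he
    subst he
    simp only [Finset.mem_insert, Finset.mem_singleton] at hα
    rcases hα with rfl | rfl
    · exact ⟨hβ, Or.inl rfl, fun h => h.elim⟩
    · exact ⟨hβ, Or.inr rfl, fun h => h.elim⟩
  | or γ δ => exact absurd ⟨γ, δ, rfl⟩ hor
  | fix η y ψ =>
    simp only [conclusions, List.mem_singleton] at he
    subst he
    simp only [Finset.mem_singleton] at hα
    subst hα
    exact ⟨hβ, rfl, fun h => h.elim⟩
  | var y =>
    simp only [conclusions] at he
    split at he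
    · rename_i η ψ hb
      simp only [List.mem_singleton] at he
      subst he
      simp only [Finset.mem_singleton] at hα
      subst hα
      exact ⟨hβ, ⟨η, _, fix_mem_of_binder hb, rfl⟩, fun h => h.elim⟩
    · simp at he
  | _ => simp [conclusions] at he

theorem exists_or_step (hD : (φ.evalArena K).Region (evalI φ ∅) (φ.evalO K ∅ i) D c) {s : W}
    {α γ : Formula P A X} (hβ : (s, or α γ) ∈ D) : ∃ e ∈ φ.conclusions (or α γ), ∀ δ ∈ e.1,
      φ.EvalStep K D c (φ.rulePriority (or α γ)) (s, or α γ) (s, δ) := by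
  rcases (hD.own _ hβ trivial).1 with h | h
  · refine ⟨_, by simp only [conclusions]; exact List.mem_cons_self, fun δ hδ => ?_⟩
    simp only [Finset.mem_singleton] at hδ
    subst hδ
    exact ⟨hβ, Or.inl rfl, fun _ => h.symm⟩
  · refine ⟨({γ}, some γ), by simp [conclusions], fun δ hδ => ?_⟩
    simp only [Finset.mem_singleton] at hδ
    subst hδ
    exact ⟨hβ, Or.inr rfl, fun _ => h.symm⟩

/-- The move `m` at `v` tracks the threads from the state `s` to the state `t`. -/
def Traces (φ : Formula P A X) (K : Kripke P A W) (D : Set (W × Formula P A X))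
    (c : W × Formula P A X → ℕ × W × Formula P A X) (v : PNode P A X) (s : W)
    (m : ℕ × PNode P A X) (t : W) : Prop :=
  ∃ track hit fresh,
    m.1 = permPriority (φ.subs.toFinset.card * φ.numLevels) v.2
      (dropRepeats [] (v.2.map track)) hit ∧
    m.2.2 = nextPerm (dropRepeats [] (v.2.map track)) fresh ∧
    ∀ α j z, α ∈ v.1 → track (α, j) = some z → z.2 = j ∧
      (hit (α, j) = true → φ.EvalStep K D c (φ.levelPriority (2 * j + 1)) (s, α) (t, z.1)) ∧
      Relation.ReflTransGen (fun a b => ∃ p ≤ φ.levelPriority (2 * j + 1),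
        φ.EvalStep K D c p a b) (s, α) (t, z.1)

/-- At a label of true formulas, Eloise can answer each strategy of Abelard such that all
formulas remain true. -/
theorem exists_true_move (hD : (φ.evalArena K).Region (evalI φ ∅) (φ.evalO K ∅ i) D c) {s : W}
    {v : PNode P A X} (hv : ∀ α ∈ v.1, (s, α) ∈ D)
    {τ : ℕ × PNode P A X} (hτ : φ.permEloise v = false → τ ∈ φ.permMoves v) :
    ∃ m ∈ φ.permMoves v, (φ.permEloise v = false → m = τ) ∧ ∃ t, (∀ α ∈ m.2.1, (t, α) ∈ D) ∧
      φ.Traces K D c v s m t := by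
  -- At a clash some formula of the label is a position of Eloise without moves, which a region
  -- excludes.
  have hclash : clash v.1 = false := by
    by_contra h
    simp only [clash, Bool.not_eq_false, decide_eq_true_eq] at h
    obtain ⟨α, hα, h⟩ := h
    cases α with
    | bot => exact (hD.own _ (hv _ hα) trivial).1
    | prop p =>
      simp only [decide_eq_true_eq] at h
      by_cases hp : s ∈ K.val p
      · exact (hD.own _ (hv _ h) hp).1
      · exact (hD.own _ (hv _ hα) hp).1
    | _ => simp at h
  cases hpr : φ.principal v.1 with
  | some β =>
    obtain ⟨hβ, hred, hβs⟩ := principal_mem hpr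
    obtain ⟨m, hm, hmτ, e, he, rfl, hstep⟩ : ∃ m ∈ φ.permMoves v,
        (φ.permEloise v = false → m = τ) ∧ ∃ e ∈ φ.conclusions β,
        m = φ.permMove v.2 (v.1.erase β ∪ e.1) (φ.trackLocal β e.2) (φ.hitLocal β)
          (φ.freshLocal β e.2) ∧
        ∀ α ∈ e.1, φ.EvalStep K D c (φ.rulePriority β) (s, β) (s, α) := by
      by_cases hor : ∃ α γ, β = or α γ
      · have hown := (permEloise_local hclash hpr).2 hor
        obtain ⟨α, γ, rfl⟩ := hor
        obtain ⟨e, he, h⟩ := exists_or_step hD (hv _ hβ)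
        exact ⟨_, (mem_permMoves_local hclash hpr).2 ⟨e, he, rfl⟩, by simp [hown], e, he, rfl, h⟩
      · have hown : φ.permEloise v = false := by
          rw [← Bool.not_eq_true, permEloise_local hclash hpr]; exact hor
        obtain ⟨e, he, h⟩ := (mem_permMoves_local hclash hpr).1 (hτ hown)
        exact ⟨τ, hτ hown, fun _ => rfl, e, he, h, fun α hα => conclusions_step (hv _ hβ) hor he hα⟩
    refine ⟨_, hm, hmτ, s, fun α hα => ?_, _, _, _, rfl, rfl, fun α j z hα hz => ?_⟩
    · rcases Finset.mem_union.1 hα with hα | hα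
      · exact hv _ (Finset.mem_of_mem_erase hα)
      · exact (hstep α hα).mem hD
    · simp only [trackLocal] at hz
      split_ifs at hz with h1 h2
      · subst h1
        obtain ⟨δ, hδ, rfl⟩ := Option.map_eq_some_iff.1 hz
        have hs := hstep δ ((conclusions_mem hβs he).2 δ hδ)
        -- The tracking function has dropped the cases of level below `2 * j + 1`.
        have hp : φ.rulePriority α ≤ φ.levelPriority (2 * j + 1) := by
          simp only [rulePriority]
          cases hk : φ.unfoldLevel α with
          | none => simp
          | some k =>
            simp only [hk, Option.mem_def, Option.some.injEq, exists_eq_left'] at h2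
            simp only [Option.elim_some, levelPriority]
            omega
        refine ⟨rfl, fun hh => ?_, .single ⟨_, hp, hs⟩⟩
        simp only [hitLocal, true_and, decide_eq_true_eq] at hh
        simpa [rulePriority, hh] using hs
      · obtain rfl := Option.some.inj hz
        refine ⟨rfl, fun hh => ?_, .refl⟩
        simp [hitLocal, h1] at hh
  | none =>
    have hown := permEloise_modal hclash hpr
    obtain ⟨d, hd, hτd⟩ := (mem_permMoves_modal hclash hpr).1 (hτ hown)
    obtain ⟨α, hα, hdα⟩ := Finset.mem_biUnion.1 hd
    obtain ⟨t, ht, hnext⟩ := exists_modal_step hD (hv _ hα) hdα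
    refine ⟨τ, hτ hown, fun _ => rfl, t, ?_⟩
    subst hτd
    refine ⟨fun γ hγ => ?_, _, fun _ => false, [], rfl, rfl, fun γ j z hγ hz => ?_⟩
    · rcases Finset.mem_insert.1 hγ with rfl | hγ
      · exact ht
      · obtain ⟨δ, hδ, hγ⟩ := Finset.mem_biUnion.1 hγ
        exact (hnext δ (hv _ hδ) γ (by simpa using hγ)).1
    · obtain ⟨δ, hδ, rfl⟩ := Option.map_eq_some_iff.1 hz
      refine ⟨rfl, fun hh => by simp at hh, ?_⟩
      exact Relation.ReflTransGen.mono (r := φ.EvalStep K D c 0)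
        (fun a b h => ⟨0, Nat.zero_le _, h⟩) _ _ (hnext γ (hv _ hγ) δ hδ).2

/-- If `φ` is satisfiable, then the algorithm for the permutation game returns true. -/
theorem solve_of_satisfiable (hcl : φ.Closed) (hn : φ.bound.Nodup)
    (hsat : Satisfiable.{u, v, w, x} φ) : φ.permGame.solve φ.startNode = true := by
  by_contra hsolve
  obtain ⟨W, K, i, s0, hs0⟩ := hsat
  have hwin := win_of_mem_sem K hcl hn φ (self_mem_subs φ) ∅ (by rw [Closed] at hcl; simp [hcl])
    (by simp) i s0 hs0
  obtain ⟨D, c, hD, hsD⟩ := hwin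
  have hstart : φ.startNode ∈ φ.permGame.nodes := by
    show φ.startNode ∈ φ.permNodes
    rw [mem_permNodes, mem_pperm]
    simp [startNode, self_mem_subs]
  obtain ⟨D', τ, hD'0, hD'n, hτ, hD'c, hlose⟩ :=
    φ.permGame.abelard_of_not_solve hstart (by simpa using hsolve)
  -- Nodes of Abelard's region are paired with states at which the whole label is true;
  -- `exists_true_move` continues from every such pair.
  let State := {z : PNode P A X × W // z.1 ∈ D' ∧ ∀ α ∈ z.1.1, (z.2, α) ∈ D}
  have hnext : ∀ z : State, ∃ (p : ℕ) (z' : State), (p, z'.1.1) ∈ φ.permMoves z.1.1 ∧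
      (φ.permEloise z.1.1 = false → (p, z'.1.1) = τ z.1.1) ∧
      φ.Traces K D c z.1.1 z.1.2 (p, z'.1.1) z'.1.2 := by
    rintro ⟨⟨v, s⟩, hv, hvs⟩
    obtain ⟨m, hm, hmτ, t, ht, htr⟩ := exists_true_move hD hvs (hτ v hv)
    exact ⟨m.1, ⟨(m.2, t), hD'c v hv m hm hmτ, ht⟩, hm, hmτ, htr⟩
  choose p nx hm hmτ htr using hnext
  let Z : ℕ → State := fun n => nx^[n] ⟨(φ.startNode, s0), hD'0, by simpa [startNode] using hsD⟩
  have hZ : ∀ n, Z (n + 1) = nx (Z n) := fun n => Function.iterate_succ_apply' _ _ _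
  have hmoves : ∀ n, (p (Z n), (Z (n + 1)).1.1) ∈ φ.permMoves (Z n).1.1 := by
    intro n; rw [hZ]; exact hm _
  have hodd := hlose (fun n => (Z n).1.1) (fun n => p (Z n)) (fun n => (Z n).2.1)
    (fun n => ⟨hmoves n, by rw [hZ]; exact hmτ _⟩)
  have htrace : ∀ n, φ.Traces K D c (Z n).1.1 (Z n).1.2 (p (Z n), (Z (n + 1)).1.1)
      (Z (n + 1)).1.2 := by
    intro n; rw [hZ]; exact htr _
  choose track hit fresh h1 h2 h3 using htrace
  have hnode : ∀ n, (Z n).1.1 ∈ φ.permNodes := fun n => hD'n _ (Z n).2.1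
  set q := φ.subs.toFinset.card * φ.numLevels with hq
  have hlen : ∀ n, (Z n).1.1.2.length ≤ q := fun n => length_le_of_mem_permNodes (hnode n)
  obtain ⟨r, hr1, hr2⟩ := ParityGame.eventually_le_of_bounded (π := fun n => p (Z n)) (B := 2 * q)
    fun n => by
      have := h1 n
      simp only at this
      rw [this]
      exact permPriority_le _ _ _ _
  -- From `n0` on nothing exceeds `r`, which occurs at `n0`. Being odd, `r` points to a place `a` of
  -- the list; from then on its entry survives, and it is active whenever `r` recurs.
  obtain ⟨n0, hn0, hle0⟩ := (hr1.and_eventually (eventually_atTop.1 hr2 |>.elim fun N hN =>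
    (eventually_ge_atTop N).mono fun n hn m (hm : n ≤ m) => hN m (hn.trans hm))).exists
  simp only at h1 h2
  have hrodd := hodd r hr1 hr2
  obtain ⟨a, ha, hra⟩ := exists_of_odd_permPriority (h1 n0 ▸ hn0.symm ▸ hrodd)
  have hra : r = 2 * (q - a) - 1 := by rw [← hra, ← h1 n0, hn0]
  have hstep : ∀ n ≥ n0, ∀ y, (Z n).1.1.2[a]? = some y →
      (∃ z, track n y = some z ∧ (Z (n + 1)).1.1.2[a]? = some z) ∧
        (p (Z n) = r → hit n y = true) := by
    intro n hn y hy
    have hle := hle0 n hn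
    rw [h1 n, hra] at hle
    have := track_of_permPriority_le (fresh := fresh n) (hlen n) hy hle
    rw [← h2 n, ← h1 n, ← hra] at this
    exact this
  have hex : ∀ k, ∃ y, (Z (n0 + k)).1.1.2[a]? = some y := by
    intro k
    induction k with
    | zero => exact ⟨_, List.getElem?_eq_getElem ha⟩
    | succ k ih =>
      obtain ⟨y, hy⟩ := ih
      obtain ⟨⟨z, -, hz⟩, -⟩ := hstep (n0 + k) (by omega) y hy
      exact ⟨z, hz⟩
  choose y hy using hex
  have hmem : ∀ k, (y k).1 ∈ (Z (n0 + k)).1.1.1 ∧ (y k).2 < φ.numLevels := by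
    intro k
    have := (mem_permNodes.1 (hnode (n0 + k))).2
    have := (mem_pperm.1 this).2 _ (List.mem_of_getElem? (hy k))
    simpa [levelled] using this
  have htrk : ∀ k, track (n0 + k) ((y k).1, (y k).2) = some (y (k + 1)) ∧
      (p (Z (n0 + k)) = r → hit (n0 + k) ((y k).1, (y k).2) = true) := by
    intro k
    obtain ⟨⟨z, hz, hz'⟩, hh⟩ := hstep (n0 + k) (by omega) _ (hy k)
    have := hy (k + 1)
    rw [← add_assoc, hz'] at this
    exact ⟨hz.trans this, hh⟩
  have hlev : ∀ k, (y k).2 = (y 0).2 := by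
    intro k
    induction k with
    | zero => rfl
    | succ k ih => rw [← ih]; exact (h3 _ _ _ _ (hmem k).1 (htrk k).1).1
  refine false_of_thread hD (hmem 0).2 (f := fun k => ((Z (n0 + k)).1.2, (y k).1))
    (hit := fun k => p (Z (n0 + k)) = r) (fun k => ?_) (fun k hk => ?_) ?_
  · have := (h3 _ _ _ _ (hmem k).1 (htrk k).1).2.2
    rwa [hlev k] at this
  · have := (h3 _ _ _ _ (hmem k).1 (htrk k).1).2.1 ((htrk k).2 hk)
    rwa [hlev k] at this
  · have := (Arena.frequently_add (P := fun n => p (Z n) = r) n0).2 hr1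
    simpa only [add_comm] using this

end Formula

namespace Formula

open Filter Relation

variable {P : Type u} {A : Type v} {X : Type w} [DecidableEq P] [DecidableEq A] [DecidableEq X]

/-! ### Termination of the local rules -/

theorem ufv_subset_fv (α : Formula P A X) : α.ufv ⊆ α.fv := by
  induction α with
  | and α β ih1 ih2 | or α β ih1 ih2 => exact Finset.union_subset_union ih1 ih2
  | fix η x α ih => exact Finset.erase_subset_erase _ ih
  | _ => simp [ufv, fv]

/-- The size of the body of a bound variable. -/
def bodySize (φ : Formula P A X) (y : X) : ℕ := (φ.binder y).elim 0 fun b => b.2.size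

/-- Bounds the number of local rule applications to a formula. -/
def localRank (φ α : Formula P A X) : ℕ :=
  α.size + (φ.size + 1) * α.ufv.sup fun y => φ.size + 1 - φ.bodySize y

/-- Decomposition shrinks the size and adds no unguarded variables. Unfolding `y` yields a body
whose unguarded variables differ from `y` by guardedness, so they are bound further outside and have
larger bodies. The supremum then drops by at least one, and the factor `φ.size + 1` outweighs the
size of the body. -/
theorem localRank_lt {φ β : Formula P A X} (hcl : φ.Closed) (hn : φ.bound.Nodup)
    (hg : φ.Guarded) (hβ : β ∈ φ.subs) {e : Finset (Formula P A X) × Option (Formula P A X)}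
    (he : e ∈ φ.conclusions β) {α : Formula P A X} (hα : α ∈ e.1) :
    φ.localRank α < φ.localRank β := by
  have hlt : ∀ α β : Formula P A X, α.size < β.size → α.ufv ⊆ β.ufv →
      φ.localRank α < φ.localRank β := fun α β h1 h2 =>
    Nat.add_lt_add_of_lt_of_le h1 (Nat.mul_le_mul_left _ (Finset.sup_mono h2))
  cases β with
  | and γ δ =>
    simp only [conclusions, List.mem_singleton] at he
    subst he
    simp only [Finset.mem_insert, Finset.mem_singleton] at hα
    rcases hα with rfl | rfl
    · exact hlt _ _ (by simp only [size]; omega) Finset.subset_union_left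
    · exact hlt _ _ (by simp only [size]; omega) Finset.subset_union_right
  | or γ δ =>
    simp only [conclusions, List.mem_cons, List.not_mem_nil, or_false] at he
    rcases he with rfl | rfl <;> simp only [Finset.mem_singleton] at hα <;> subst hα
    · exact hlt _ _ (by simp only [size]; omega) Finset.subset_union_left
    · exact hlt _ _ (by simp only [size]; omega) Finset.subset_union_right
  | fix η y ψ =>
    simp only [conclusions, List.mem_singleton] at he
    subst he
    simp only [Finset.mem_singleton] at hα
    subst hα
    refine hlt _ _ (by simp only [size]; omega) ?_
    rw [ufv, Finset.erase_eq_of_notMem (hg _ _ _ hβ)]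
  | var y =>
    simp only [conclusions] at he
    split at he
    · rename_i η ψ hb
      simp only [List.mem_singleton] at he
      subst he
      simp only [Finset.mem_singleton] at hα
      subst hα
      have hfix := fix_mem_of_binder hb
      have hsize := size_le_of_mem_subs (body_mem_subs hfix)
      have hsup : (α.ufv.sup fun z => φ.size + 1 - φ.bodySize z) ≤ φ.size - α.size := by
        refine Finset.sup_le fun z hz => ?_
        have hzy : z ≠ y := by rintro rfl; exact hg _ _ _ hfix hz
        obtain ⟨ξ, χ, h1, h2⟩ := scope_closed hcl hfix (z := z)
          (by simp [fv, hzy, ufv_subset_fv _ hz])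
        have := size_le_of_mem_subs h2
        simp only [size] at this
        simp only [bodySize, binder_eq_some hn h1, Option.elim_some]
        omega
      have h1 : φ.bodySize y = α.size := by simp [bodySize, hb]
      have h2 := Nat.mul_le_mul_left (φ.size + 1) hsup
      have h3 : (φ.size + 1) * (φ.size + 1 - α.size) =
          (φ.size + 1) * (φ.size - α.size) + (φ.size + 1) := by
        rw [← Nat.mul_succ]; congr 1; omega
      simp only [localRank, ufv, Finset.sup_singleton, h1, h3, size]
      omega
    · simp at he
  | _ => simp [conclusions] at he

theorem conclusions_card {φ β : Formula P A X}
    {e : Finset (Formula P A X) × Option (Formula P A X)} (he : e ∈ φ.conclusions β) :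
    e.1.card ≤ 2 := by
  cases β with
  | and γ δ =>
    simp only [conclusions, List.mem_singleton] at he
    subst he
    exact Finset.card_le_two
  | or γ δ =>
    simp only [conclusions, List.mem_cons, List.not_mem_nil, or_false] at he
    rcases he with rfl | rfl <;> simp
  | fix η y ψ =>
    simp only [conclusions, List.mem_singleton] at he
    subst he; simp
  | var y =>
    simp only [conclusions] at he
    split at he
    · simp only [List.mem_singleton] at he
      subst he; simp
    · simp at he
  | _ => simp [conclusions] at he

/-- Decreases with each local rule application. -/
def weight (φ : Formula P A X) (U : Finset (Formula P A X)) : ℕ := ∑ α ∈ U, 3 ^ φ.localRank α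

/-- At most two formulas of lower rank replace one of rank `r`, and `2 * 3 ^ (r - 1) < 3 ^ r`. -/
theorem weight_lt {φ β : Formula P A X} (hcl : φ.Closed) (hn : φ.bound.Nodup)
    (hg : φ.Guarded) (hβ : β ∈ φ.subs) {U : Finset (Formula P A X)} (hU : β ∈ U)
    {e : Finset (Formula P A X) × Option (Formula P A X)} (he : e ∈ φ.conclusions β) :
    φ.weight (U.erase β ∪ e.1) < φ.weight U := by
  have h1 : φ.weight (U.erase β ∪ e.1) ≤ φ.weight (U.erase β) + φ.weight e.1 := by
    rw [weight, weight, weight, ← Finset.sum_union_inter]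
    exact Nat.le_add_right _ _
  have h2 : φ.weight (U.erase β) + 3 ^ φ.localRank β = φ.weight U :=
    Finset.sum_erase_add _ _ hU
  have h3 : φ.weight e.1 < 3 ^ φ.localRank β := by
    rcases e.1.eq_empty_or_nonempty with h | ⟨α, hα⟩
    · simp [weight, h]
    · have hpos := localRank_lt hcl hn hg hβ he hα
      have hle : φ.weight e.1 ≤ e.1.card • 3 ^ (φ.localRank β - 1) :=
        Finset.sum_le_card_nsmul _ _ _ fun γ hγ => Nat.pow_le_pow_right (by omega) (by
          have := localRank_lt hcl hn hg hβ he hγ; omega)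
      have hcard := conclusions_card he
      obtain ⟨r, hr⟩ := Nat.exists_eq_succ_of_ne_zero (n := φ.localRank β) (by omega)
      rw [hr] at hle ⊢
      simp only [Nat.succ_eq_add_one, Nat.add_sub_cancel, smul_eq_mul, pow_succ] at hle ⊢
      have := Nat.mul_le_mul_right (3 ^ r) hcard
      have := Nat.pow_pos (n := r) (show 0 < 3 by omega)
      omega
  omega

/-! ### Weak aconjunctivity along threads -/

/-- The condition with flag `false` is an invariant of all formulas in labels; this is the case of
unfolding a variable. -/
theorem weaklyAconjunctiveIn_body {φ ψ : Formula P A X} {η : FixKind} {y : X}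
    (α : Formula P A X) : ∀ g, φ.weaklyAconjunctiveIn g α → fix η y ψ ∈ α.subs →
    φ.weaklyAconjunctiveIn false ψ := by
  induction α with
  | bot | top | prop | nprop | var => simp [subs]
  | and γ δ ih1 ih2 =>
    intro g h hf
    simp only [subs, List.mem_cons, List.mem_append, reduceCtorEq, false_or] at hf
    rcases hf with hf | hf
    · exact ih1 _ h.2.1 hf
    · exact ih2 _ h.2.2 hf
  | or γ δ ih1 ih2 =>
    intro g h hf
    simp only [subs, List.mem_cons, List.mem_append, reduceCtorEq, false_or] at hf
    rcases hf with hf | hf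
    · exact ih1 _ h.1 hf
    · exact ih2 _ h.2 hf
  | dia a γ ih | box a γ ih =>
    intro g h hf
    simp only [subs, List.mem_cons, reduceCtorEq, false_or] at hf
    exact ih _ h hf
  | fix ξ z γ ih =>
    intro g h hf
    simp only [subs, List.mem_cons, fix.injEq] at hf
    rcases hf with ⟨rfl, rfl, rfl⟩ | hf
    · exact h
    · exact ih _ h hf

theorem weaklyAconjunctiveIn_conjunct {φ : Formula P A X} (γ : Formula P A X) :
    φ.weaklyAconjunctiveIn true γ → ∀ δ ∈ γ.conjuncts, φ.weaklyAconjunctiveIn true δ := by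
  induction γ with
  | and α β ih1 ih2 =>
    intro h δ hδ
    rcases List.mem_append.1 hδ with hδ | hδ
    · exact ih1 h.2.1 δ hδ
    · exact ih2 h.2.2 δ hδ
  | _ => intro h δ hδ; simp only [conjuncts, List.mem_singleton] at hδ; exact hδ ▸ h

/-- The flag passes to all conjuncts of the group and is reset below their modal operators. -/
theorem weaklyAconjunctiveIn_group {φ γ δ χ : Formula P A X} {a : A} {ds : List (Formula P A X)}
    (h : φ.weaklyAconjunctiveIn false (and γ δ)) (hg : modalGroup (and γ δ) = some (a, ds, χ)) :
    φ.weaklyAconjunctiveIn false χ ∧ ∀ ξ ∈ ds, φ.weaklyAconjunctiveIn false ξ := by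
  have h' : φ.weaklyAconjunctiveIn true (and γ δ) := by
    simp only [weaklyAconjunctiveIn, hg, Option.isSome_some, Bool.or_true] at h ⊢
    exact h
  obtain ⟨h1, h2, -⟩ := modalGroup_eq_some hg
  exact ⟨weaklyAconjunctiveIn_conjunct _ h' _ h1,
    fun ξ hξ => weaklyAconjunctiveIn_conjunct _ h' _ (h2 ξ hξ).1⟩

theorem weaklyAconjunctiveIn_conclusions {φ β : Formula P A X} (hφ : φ.WeaklyAconjunctive)
    (h : φ.weaklyAconjunctiveIn false β) (hr : β.reducible = true)
    {e : Finset (Formula P A X) × Option (Formula P A X)} (he : e ∈ φ.conclusions β)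
    {α : Formula P A X} (hα : α ∈ e.1) : φ.weaklyAconjunctiveIn false α := by
  cases β with
  | and γ δ =>
    simp only [reducible, Option.isNone_iff_eq_none] at hr
    simp only [weaklyAconjunctiveIn, hr, Option.isSome_none, Bool.or_false] at h
    simp only [conclusions, List.mem_singleton] at he
    subst he
    simp only [Finset.mem_insert, Finset.mem_singleton] at hα
    rcases hα with rfl | rfl
    · exact h.2.1
    · exact h.2.2
  | or γ δ =>
    simp only [conclusions, List.mem_cons, List.not_mem_nil, or_false] at he
    rcases he with rfl | rfl <;> simp only [Finset.mem_singleton] at hα <;> subst hα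
    · exact h.1
    · exact h.2
  | fix η y ψ =>
    simp only [conclusions, List.mem_singleton] at he
    subst he
    simp only [Finset.mem_singleton] at hα
    subst hα
    exact h
  | var y =>
    simp only [conclusions] at he
    split at he
    · rename_i η ψ hb
      simp only [List.mem_singleton] at he
      subst he
      simp only [Finset.mem_singleton] at hα
      subst hα
      exact weaklyAconjunctiveIn_body φ _ hφ (fix_mem_of_binder hb)
    · simp at he
  | _ => simp [conclusions] at he

theorem weaklyAconjunctiveIn_modalNext {φ α β ξ : Formula P A X} {a : A}
    (h : φ.weaklyAconjunctiveIn false α) (hβ : modalNext a ξ α = some β) :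
    φ.weaklyAconjunctiveIn false β := by
  cases α with
  | dia b ψ =>
    simp only [modalNext] at hβ
    split_ifs at hβ with hc
    obtain rfl := Option.some.inj hβ
    exact hc.2 ▸ h
  | box b χ =>
    simp only [modalNext] at hβ
    split_ifs at hβ with hc
    obtain rfl := Option.some.inj hβ
    exact h
  | and γ δ =>
    simp only [modalNext] at hβ
    split at hβ
    · rename_i b ds χ hg
      split_ifs at hβ with h1 h2
      · obtain rfl := Option.some.inj hβ
        exact (weaklyAconjunctiveIn_group h hg).2 _ h2
      · obtain rfl := Option.some.inj hβ
        exact (weaklyAconjunctiveIn_group h hg).1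
    · simp at hβ
  | _ => simp [modalNext] at hβ

/-- A diamond of a formula is among the formulas that arise from it by the modal rule. -/
theorem modalNext_diamonds {α : Formula P A X} {d : A × Formula P A X} (h : d ∈ diamonds α) :
    modalNext d.1 d.2 α = some d.2 := by
  cases α with
  | dia b ψ =>
    simp only [diamonds, Finset.mem_singleton] at h
    subst h; simp [modalNext]
  | and γ δ =>
    simp only [diamonds] at h
    split at h
    · rename_i b ds χ hg
      simp only [Finset.mem_image, List.mem_toFinset] at h
      obtain ⟨ξ, hξ, rfl⟩ := h
      simp [modalNext, hg, hξ]
    · simp at h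
  | _ => simp [diamonds] at h

/-! ### Threads of a winning strategy -/

/-- The move at `v` by the rule with principal formula `β` and conclusion `e`. -/
def localMove (φ : Formula P A X) (v : PNode P A X) (β : Formula P A X)
    (e : Finset (Formula P A X) × Option (Formula P A X)) : ℕ × PNode P A X :=
  φ.permMove v.2 (v.1.erase β ∪ e.1) (φ.trackLocal β e.2) (φ.hitLocal β) (φ.freshLocal β e.2)

/-- The move at `v` by the modal rule for the diamond `d`. -/
def modalMove (φ : Formula P A X) (v : PNode P A X) (d : A × Formula P A X) : ℕ × PNode P A X :=
  φ.permMove v.2 (insert d.2 (v.1.biUnion fun α => (modalNext d.1 d.2 α).toFinset))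
    (fun y => (modalNext d.1 d.2 y.1).map fun α => (α, y.2)) (fun _ => false) []

/-- A set of nodes from which Eloise wins by the strategy `σ`, with all labels weakly
aconjunctive. -/
structure WinSet (φ : Formula P A X) (σ : PNode P A X → ℕ × PNode P A X)
    (R : Set (PNode P A X)) : Prop where
  nodes : ∀ v ∈ R, v ∈ φ.permNodes
  wac : ∀ v ∈ R, ∀ α ∈ v.1, φ.weaklyAconjunctiveIn false α
  step : ∀ v ∈ R, ∀ m, φ.permGame.Conforms σ v m → m.2 ∈ R
  move : ∀ v ∈ R, φ.permEloise v = true → ∃ m, φ.permGame.Conforms σ v m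
  play : ∀ (ρ : ℕ → PNode P A X) (π : ℕ → ℕ), ρ 0 ∈ R →
    (∀ n, φ.permGame.Conforms σ (ρ n) (π n, ρ (n + 1))) →
    ∃ p, Even p ∧ (∃ᶠ n in atTop, π n = p) ∧ ∀ᶠ n in atTop, π n ≤ p

/-- The winning set consists of the nodes reachable under the strategy, so the truth proof can start
its plays at any of them. -/
theorem exists_winSet {φ : Formula P A X} (hφ : φ.WeaklyAconjunctive)
    (h : φ.permGame.EloiseWins φ.startNode) : ∃ σ R, φ.WinSet σ R ∧ φ.startNode ∈ R := by
  obtain ⟨σ, hstuck, hplay⟩ := h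
  refine ⟨σ, {v | ReflTransGen (fun a b => ∃ p, φ.permGame.Conforms σ a (p, b)) φ.startNode v},
    ⟨?_, ?_, ?_, ?_, ?_⟩, .refl⟩
  · intro v hv
    induction hv with
    | refl =>
      rw [mem_permNodes, mem_pperm]
      simp [startNode, self_mem_subs]
    | tail _ hs ih => obtain ⟨p, hp⟩ := hs; exact φ.permMoves_closed _ ih _ hp.1
  · intro v hv
    induction hv with
    | refl =>
      intro α hα
      simp only [startNode, Finset.mem_singleton] at hα
      exact hα ▸ hφ
    | @tail b c _ hs ih =>
      obtain ⟨p, hp, -⟩ := hs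
      intro α hα
      by_cases hcl : clash b.1 = true
      · simp [permGame, permMoves, hcl] at hp
      rw [Bool.not_eq_true] at hcl
      cases hpr : φ.principal b.1 with
      | some β =>
        obtain ⟨e, he, hm⟩ := (mem_permMoves_local hcl hpr).1 hp
        obtain ⟨hβ, hred, -⟩ := principal_mem hpr
        obtain rfl : c = (φ.localMove b β e).2 := congrArg Prod.snd hm
        rcases Finset.mem_union.1 hα with hα | hα
        · exact ih α (Finset.mem_of_mem_erase hα)
        · exact weaklyAconjunctiveIn_conclusions hφ (ih β hβ) hred he hα
      | none =>
        obtain ⟨d, hd, hm⟩ := (mem_permMoves_modal hcl hpr).1 hp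
        obtain rfl : c = (φ.modalMove b d).2 := congrArg Prod.snd hm
        obtain ⟨β, hβ, hdβ⟩ := Finset.mem_biUnion.1 hd
        rcases Finset.mem_insert.1 hα with rfl | hα
        · exact weaklyAconjunctiveIn_modalNext (ih β hβ) (modalNext_diamonds hdβ)
        · obtain ⟨γ, hγ, hα⟩ := Finset.mem_biUnion.1 hα
          exact weaklyAconjunctiveIn_modalNext (ih γ hγ) (by simpa using hα)
  · exact fun v hv m hm => ReflTransGen.tail hv ⟨m.1, hm⟩
  · intro v hv ho
    by_contra hno
    push Not at hno
    have := hstuck v hv hno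
    simp [permGame, ho] at this
  · intro ρ π h0 hπ
    generalize hv : ρ 0 = v at h0
    change ReflTransGen _ _ v at h0
    -- A play from a reachable node is extended backwards to the initial node; a finite prefix does
    -- not affect recurring priorities.
    induction h0 generalizing ρ π with
    | refl => exact hplay ρ π hv hπ
    | @tail b c _ hs ih =>
      obtain ⟨p, hp⟩ := hs
      obtain ⟨r, hr, hr1, hr2⟩ := ih (fun n => Nat.casesOn n b ρ) (fun n => Nat.casesOn n p π)
        (fun n => by
          cases n with
          | zero => simpa [hv] using hp
          | succ n => exact hπ n) rfl
      refine ⟨r, hr, ?_, ?_⟩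
      · exact (Arena.frequently_add
          (P := fun n => (Nat.casesOn n p π : ℕ) = r) 1).2 hr1
      · exact (Arena.eventually_add
          (P := fun n => (Nat.casesOn n p π : ℕ) ≤ r) 1).2 hr2

section

variable {φ : Formula P A X} {σ : PNode P A X → ℕ × PNode P A X} {R : Set (PNode P A X)}

theorem WinSet.not_clash (h : φ.WinSet σ R) {v : PNode P A X} (hv : v ∈ R) :
    clash v.1 = false := by
  by_contra hc
  rw [Bool.not_eq_false] at hc
  obtain ⟨m, hm, -⟩ := h.move v hv (by simp [permEloise, hc])
  simp [permGame, permMoves, hc] at hm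

theorem WinSet.mem_subs (h : φ.WinSet σ R) {v : PNode P A X} (hv : v ∈ R) {α : Formula P A X}
    (hα : α ∈ v.1) : α ∈ φ.subs := (mem_permNodes.1 (h.nodes v hv)).1 α hα

theorem WinSet.conforms_local (h : φ.WinSet σ R) {v : PNode P A X} (hv : v ∈ R)
    {β : Formula P A X} (hβ : φ.principal v.1 = some β) {m : ℕ × PNode P A X}
    (hm : φ.permGame.Conforms σ v m) : ∃ e ∈ φ.conclusions β, m = φ.localMove v β e :=
  (mem_permMoves_local (h.not_clash hv) hβ).1 hm.1

/-- Saturated nodes of a winning set belong to Abelard, so all their diamonds are available against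
any strategy of Eloise. -/
theorem WinSet.conforms_modal (h : φ.WinSet σ R) {v : PNode P A X} (hv : v ∈ R)
    (hβ : φ.principal v.1 = none) {d : A × Formula P A X} (hd : d ∈ v.1.biUnion diamonds) :
    φ.permGame.Conforms σ v (φ.modalMove v d) := by
  refine ⟨(mem_permMoves_modal (h.not_clash hv) hβ).2 ⟨d, hd, rfl⟩, fun ho => ?_⟩
  have := permEloise_modal (h.not_clash hv) hβ
  simp [permGame, this] at ho

theorem WinSet.exists_local (h : φ.WinSet σ R) (hcl : φ.Closed) (hn : φ.bound.Nodup)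
    {v : PNode P A X} (hv : v ∈ R) {β : Formula P A X} (hβ : φ.principal v.1 = some β) :
    ∃ m, φ.permGame.Conforms σ v m := by
  by_cases ho : φ.permEloise v = true
  · exact h.move v hv ho
  · obtain ⟨-, hred, hβs⟩ := principal_mem hβ
    have : ∃ e, e ∈ φ.conclusions β := by
      cases β with
      | and γ δ => exact ⟨_, List.mem_singleton.2 rfl⟩
      | or γ δ => exact absurd ((permEloise_local (h.not_clash hv) hβ).2 ⟨γ, δ, rfl⟩) ho
      | fix η y ψ => exact ⟨_, List.mem_singleton.2 rfl⟩
      | var y =>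
        obtain ⟨η, ψ, h1, -⟩ := scope_closed hcl hβs (z := y) (by simp [fv])
        exact ⟨_, by simp only [conclusions, binder_eq_some hn h1]; exact List.mem_singleton.2 rfl⟩
      | _ => simp [reducible] at hred
    obtain ⟨e, he⟩ := this
    exact ⟨_, (mem_permMoves_local (h.not_clash hv) hβ).2 ⟨e, he, rfl⟩, fun ho' => absurd ho' ho⟩

/-- A conforming move from an unsaturated node. -/
def LocalStep (φ : Formula P A X) (σ : PNode P A X → ℕ × PNode P A X) (v v' : PNode P A X) :
    Prop := (∃ β, φ.principal v.1 = some β) ∧ ∃ p, φ.permGame.Conforms σ v (p, v')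

/-- The saturated node `s` is reached from `v` by conforming local moves. -/
def Saturates (φ : Formula P A X) (σ : PNode P A X → ℕ × PNode P A X) (v s : PNode P A X) :
    Prop := ReflTransGen (φ.LocalStep σ) v s ∧ φ.principal s.1 = none

theorem WinSet.mem_of_saturates (h : φ.WinSet σ R) {v s : PNode P A X} (hv : v ∈ R)
    (hs : φ.Saturates σ v s) : s ∈ R := by
  obtain ⟨hs, -⟩ := hs
  induction hs with
  | refl => exact hv
  | tail _ hs ih => obtain ⟨-, p, hp⟩ := hs; exact h.step _ ih _ hp

/-- Guardedness enters here: local rules lower `weight`, so unfolding cannot go on without a modal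
step. -/
theorem WinSet.exists_saturates (h : φ.WinSet σ R) (hcl : φ.Closed) (hn : φ.bound.Nodup)
    (hg : φ.Guarded) {v : PNode P A X} (hv : v ∈ R) : ∃ s, φ.Saturates σ v s := by
  induction hw : φ.weight v.1 using Nat.strong_induction_on generalizing v with
  | _ n ih =>
    cases hpr : φ.principal v.1 with
    | none => exact ⟨v, .refl, hpr⟩
    | some β =>
      obtain ⟨m, hm⟩ := h.exists_local hcl hn hv hpr
      obtain ⟨e, he, hme⟩ := h.conforms_local hv hpr hm
      obtain ⟨hβ, -, hβs⟩ := principal_mem hpr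
      have hlt : φ.weight m.2.1 < n := by
        rw [← hw, hme]
        exact weight_lt hcl hn hg hβs hβ he
      obtain ⟨s, hs1, hs2⟩ := ih _ hlt (h.step v hv m hm) rfl
      exact ⟨s, .head ⟨⟨β, hpr⟩, m.1, hm⟩ hs1, hs2⟩

/-- The formula `α` in the label of `v` is replaced by `β` by the move `m`. -/
def Trace (φ : Formula P A X) (v : PNode P A X) (α : Formula P A X) (m : ℕ × PNode P A X)
    (β : Formula P A X) : Prop :=
  (∃ γ e, φ.principal v.1 = some γ ∧ e ∈ φ.conclusions γ ∧ m = φ.localMove v γ e ∧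
    (α ≠ γ ∧ β = α ∨ α = γ ∧ β ∈ e.1)) ∨
  ∃ d, φ.principal v.1 = none ∧ d ∈ v.1.biUnion diamonds ∧ m = φ.modalMove v d ∧
    modalNext d.1 d.2 α = some β

theorem Trace.mem {v : PNode P A X} {α β : Formula P A X} {m : ℕ × PNode P A X}
    (h : φ.Trace v α m β) (hα : α ∈ v.1) : β ∈ m.2.1 := by
  rcases h with ⟨γ, e, -, -, rfl, ⟨h1, rfl⟩ | ⟨-, h2⟩⟩ | ⟨d, -, -, rfl, h⟩
  · exact Finset.mem_union_left _ (Finset.mem_erase.2 ⟨h1, hα⟩)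
  · exact Finset.mem_union_right _ h2
  · exact Finset.mem_insert_of_mem (Finset.mem_biUnion.2 ⟨α, hα, by simp [h]⟩)

/-- A step of a thread along conforming moves that does not unfold the variables in `F`. -/
def ThreadStep (φ : Formula P A X) (σ : PNode P A X → ℕ × PNode P A X) (R : Set (PNode P A X))
    (F : Set X) (a b : PNode P A X × Formula P A X) : Prop :=
  a.1 ∈ R ∧ a.2 ∈ a.1.1 ∧ (∃ p, φ.permGame.Conforms σ a.1 (p, b.1) ∧
    φ.Trace a.1 a.2 (p, b.1) b.2) ∧
    ∀ y ∈ F, ¬ (a.2 = var y ∧ φ.principal a.1.1 = some (var y))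

theorem WinSet.thread_mem (h : φ.WinSet σ R) {F : Set X} {a b : PNode P A X × Formula P A X}
    (hab : ReflTransGen (φ.ThreadStep σ R F) a b) (ha : a.1 ∈ R) (ha' : a.2 ∈ a.1.1) :
    b.1 ∈ R ∧ b.2 ∈ b.1.1 := by
  induction hab with
  | refl => exact ⟨ha, ha'⟩
  | tail _ hs _ =>
    obtain ⟨h1, h2, ⟨p, hp, ht⟩, -⟩ := hs
    exact ⟨h.step _ h1 _ hp, ht.mem h2⟩

theorem ThreadStep.mono {F F' : Set X} (hF : F ⊆ F') {a b : PNode P A X × Formula P A X}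
    (h : ReflTransGen (φ.ThreadStep σ R F') a b) : ReflTransGen (φ.ThreadStep σ R F) a b :=
  ReflTransGen.mono (r := φ.ThreadStep σ R F') (p := φ.ThreadStep σ R F)
    (fun _ _ h => ⟨h.1, h.2.1, h.2.2.1, fun y hy => h.2.2.2 y (hF hy)⟩) _ _ h

theorem WinSet.persist (h : φ.WinSet σ R) (F : Set X) {v s : PNode P A X}
    (hs : φ.Saturates σ v s) (hv : v ∈ R) {α : Formula P A X} (hα : α ∈ v.1)
    (hr : α.reducible = false) : ReflTransGen (φ.ThreadStep σ R F) (v, α) (s, α) := by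
  obtain ⟨hs, -⟩ := hs
  induction hs using ReflTransGen.head_induction_on with
  | refl => exact .refl
  | @head b c hbc _ ih =>
    obtain ⟨⟨β, hβ⟩, p, hp⟩ := hbc
    obtain ⟨e, he, hm⟩ := h.conforms_local hv hβ hp
    obtain ⟨-, hred, -⟩ := principal_mem hβ
    have hne : α ≠ β := by rintro rfl; simp [hr] at hred
    have ht : φ.Trace b α (p, c) α := Or.inl ⟨β, e, hβ, he, hm, Or.inl ⟨hne, rfl⟩⟩
    refine .head ⟨hv, hα, ⟨p, hp, ht⟩, ?_⟩ (ih (h.step _ hv _ hp) (ht.mem hα))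
    rintro y - ⟨hy, -⟩
    simp only at hy
    simp [hy, reducible] at hr

/-- A saturated label contains no reducible formula, so `α` becomes principal on the way; until then
it is carried along. -/
theorem WinSet.expand (h : φ.WinSet σ R) (F : Set X) {v s : PNode P A X}
    (hs : φ.Saturates σ v s) (hv : v ∈ R) {α : Formula P A X} (hα : α ∈ v.1)
    (hr : α.reducible = true) : ∃ v₁ v₂ p e, ReflTransGen (φ.ThreadStep σ R F) (v, α) (v₁, α) ∧
      v₁ ∈ R ∧ α ∈ v₁.1 ∧ φ.principal v₁.1 = some α ∧ e ∈ φ.conclusions α ∧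
      φ.permGame.Conforms σ v₁ (p, v₂) ∧ (p, v₂) = φ.localMove v₁ α e ∧ φ.Saturates σ v₂ s := by
  obtain ⟨hs, hsat⟩ := hs
  induction hs using ReflTransGen.head_induction_on with
  | refl =>
    have := List.find?_eq_none.1 hsat α (h.mem_subs hv hα)
    simp [hα, hr] at this
  | @head b c hbc hcs ih =>
    obtain ⟨⟨β, hβ⟩, p, hp⟩ := hbc
    obtain ⟨e, he, hm⟩ := h.conforms_local hv hβ hp
    by_cases hne : α = β
    · subst hne
      exact ⟨b, c, p, e, .refl, hv, hα, hβ, he, hp, hm, hcs, hsat⟩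
    · have ht : φ.Trace b α (p, c) α := Or.inl ⟨β, e, hβ, he, hm, Or.inl ⟨hne, rfl⟩⟩
      obtain ⟨v₁, v₂, p', e', h1, h2⟩ := ih (h.step _ hv _ hp) (ht.mem hα)
      refine ⟨v₁, v₂, p', e', .head ⟨hv, hα, ⟨p, hp, ht⟩, ?_⟩ h1, h2⟩
      rintro y - ⟨hy, hy'⟩
      simp only [hβ, Option.some.injEq] at hy hy'
      exact hne (hy.trans hy'.symm)

/-! ### Bad threads are tracked -/

/-- The step of a thread at `a` unfolds the variable `x`. -/
def UnfoldStep (φ : Formula P A X) (σ : PNode P A X → ℕ × PNode P A X) (R : Set (PNode P A X))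
    (x : X) (a b : PNode P A X × Formula P A X) : Prop :=
  a.2 = var x ∧ φ.principal a.1.1 = some (var x) ∧ φ.ThreadStep σ R ∅ a b

theorem fStep_of_conclusions {β α : Formula P A X} (hβ : β ∈ φ.subs)
    {e : Finset (Formula P A X) × Option (Formula P A X)} (he : e ∈ φ.conclusions β)
    (hα : α ∈ e.1) : φ.FStep β α ∧ ∀ k, φ.unfoldLevel β = some k →
      ∃ η y, fix η y α ∈ φ.subs ∧ k = φ.level y ∧ (β = var y ∨ β = fix η y α) := by
  cases β with
  | and γ δ =>
    simp only [conclusions, List.mem_singleton] at he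
    subst he
    simp only [Finset.mem_insert, Finset.mem_singleton] at hα
    refine ⟨?_, by simp [unfoldLevel]⟩
    rcases hα with rfl | rfl <;> exact Or.inl (by simp [subs, self_mem_subs])
  | or γ δ =>
    simp only [conclusions, List.mem_cons, List.not_mem_nil, or_false] at he
    refine ⟨?_, by simp [unfoldLevel]⟩
    rcases he with rfl | rfl <;> simp only [Finset.mem_singleton] at hα <;> subst hα <;>
      exact Or.inl (by simp [subs, self_mem_subs])
  | fix η y ψ =>
    simp only [conclusions, List.mem_singleton] at he
    subst he
    simp only [Finset.mem_singleton] at hα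
    subst hα
    exact ⟨Or.inl (by simp [subs, self_mem_subs]), fun k hk => ⟨η, y, hβ,
      by simpa [unfoldLevel] using hk.symm, Or.inr rfl⟩⟩
  | var y =>
    simp only [conclusions] at he
    split at he
    · rename_i η ψ hb
      simp only [List.mem_singleton] at he
      subst he
      simp only [Finset.mem_singleton] at hα
      subst hα
      have h1 := fix_mem_of_binder hb
      exact ⟨Or.inr ⟨η, y, rfl, h1⟩, fun k hk => ⟨η, y, h1,
        by simpa [unfoldLevel] using hk.symm, Or.inl rfl⟩⟩
    · simp at he
  | _ => simp [conclusions] at he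

end

end Formula

theorem mem_nextPerm_of_fresh {T : Type x} [DecidableEq T] {t : List (Option T)} {fresh : List T}
    {y : T} (hy : y ∈ fresh) : y ∈ nextPerm t fresh := by
  by_cases h : y ∈ t.reduceOption <;> simp [nextPerm, h, hy]

theorem eventually_const_of_antitone {a : ℕ → ℕ} (h : Antitone a) : ∃ N, ∀ n ≥ N, a n = a N := by
  obtain ⟨_, ⟨N, rfl⟩, hmin⟩ := wellFounded_lt.has_min (Set.range a) ⟨_, 0, rfl⟩
  exact ⟨N, fun n hn => le_antisymm (h hn) (not_lt.1 (hmin _ ⟨n, rfl⟩))⟩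

namespace Formula

open Filter Relation

variable {P : Type u} {A : Type v} {X : Type w} [DecidableEq P] [DecidableEq A] [DecidableEq X]

variable {φ : Formula P A X} {σ : PNode P A X → ℕ × PNode P A X} {R : Set (PNode P A X)}

theorem conclusions_snd {β α : Formula P A X}
    {e : Finset (Formula P A X) × Option (Formula P A X)} (he : e ∈ φ.conclusions β)
    (hα : α ∈ e.1) (hand : ¬ ∃ γ δ, β = and γ δ) : e.2 = some α := by
  cases β with
  | and γ δ => exact absurd ⟨γ, δ, rfl⟩ hand
  | or γ δ =>
    simp only [conclusions, List.mem_cons, List.not_mem_nil, or_false] at he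
    rcases he with rfl | rfl <;> simp only [Finset.mem_singleton] at hα <;> subst hα <;> rfl
  | fix η y ψ =>
    simp only [conclusions, List.mem_singleton] at he
    subst he
    simp only [Finset.mem_singleton] at hα
    subst hα
    rfl
  | var y =>
    simp only [conclusions] at he
    split at he
    · simp only [List.mem_singleton] at he
      subst he
      simp only [Finset.mem_singleton] at hα
      subst hα
      rfl
    · simp at he
  | _ => simp [conclusions] at he

theorem Trace.fStep {v : PNode P A X} {α β : Formula P A X} {m : ℕ × PNode P A X}
    (h : φ.Trace v α m β) (hα : α ∈ φ.subs) : φ.FStep α β := by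
  rcases h with ⟨γ, e, -, he, -, ⟨-, rfl⟩ | ⟨rfl, h2⟩⟩ | ⟨d, -, -, -, h⟩
  · exact Or.inl (self_mem_subs _)
  · exact (fStep_of_conclusions hα he h2).1
  · exact Or.inl (modalNext_mem_subs h)

/-- On a loop through a `μ`-variable, the levelled formula of its level is tracked. -/
theorem WinSet.track (h : φ.WinSet σ R) (hcl : φ.Closed) (hn : φ.bound.Nodup) {x : X}
    {ψ : Formula P A X} (hx : fix .mu x ψ ∈ φ.subs) {j : ℕ} (hj : φ.level x = 2 * j + 1)
    {v : PNode P A X} {α β : Formula P A X} {m : ℕ × PNode P A X} (hv : v ∈ R) (hα : α ∈ v.1)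
    (ht : φ.Trace v α m β) (hαψ : α ∈ ψ.subs) (hβψ : β ∈ ψ.subs)
    (hpath : ReflTransGen (fun α β => φ.FStep α β ∧ α ∈ ψ.subs) β (var x)) :
    ∃ track hit fresh,
      m.1 = permPriority (φ.subs.toFinset.card * φ.numLevels) v.2
        (dropRepeats [] (v.2.map track)) hit ∧
      m.2.2 = nextPerm (dropRepeats [] (v.2.map track)) fresh ∧
      track (α, j) = some (β, j) ∧
      (α = var x ∧ φ.principal v.1 = some (var x) → hit (α, j) = true ∧ (β, j) ∈ fresh) := by
  rcases ht with ⟨γ, e, hpr, he, rfl, ht⟩ | ⟨d, hpr, -, rfl, ht⟩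
  · refine ⟨φ.trackLocal γ e.2, φ.hitLocal γ, φ.freshLocal γ e.2, rfl, rfl, ?_, ?_⟩
    · rcases ht with ⟨h1, rfl⟩ | ⟨rfl, h2⟩
      · simp [trackLocal, h1]
      · have hαs := h.mem_subs hv hα
        -- The entry is not dropped, since no fixpoint of lower level is unfolded on the loop.
        have hlev : ¬ ∃ k ∈ φ.unfoldLevel α, k < 2 * j + 1 := by
          rintro ⟨k, hk, hlt⟩
          obtain ⟨η, y, h3, rfl, h4⟩ := (fStep_of_conclusions hαs he h2).2 k hk
          have := level_le_of_loop hcl hn hx h3 hβψ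
            (h4.imp (fun h5 => by rwa [h5] at hαψ) fun h5 => by rwa [h5] at hαψ)
            (ReflTransGen.mono (r := fun α β => φ.FStep α β ∧ α ∈ ψ.subs) (p := φ.FStep)
              (fun _ _ h => h.1) _ _ hpath)
          omega
        -- The conjunct on the loop is active and the conjunction is no modal group, so the other
        -- conjunct is inactive and the tracked conclusion is `β`. This is the one use of weak
        -- aconjunctivity on threads.
        have hsnd : e.2 = some β := by
          by_cases hand : ∃ γ δ, α = and γ δ
          · obtain ⟨γ, δ, rfl⟩ := hand
            have hβ := active_of_loop hcl hn hx hpath (subs_trans (body_mem_subs hx) hβψ)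
            have hwac := h.wac v hv _ hα
            obtain ⟨-, hred, -⟩ := principal_mem hpr
            simp only [reducible, Option.isNone_iff_eq_none] at hred
            simp only [weaklyAconjunctiveIn, hred, Option.isSome_none, Bool.or_false,
              Bool.false_eq_true, false_or] at hwac
            simp only [conclusions, List.mem_singleton] at he
            subst he
            simp only [Finset.mem_insert, Finset.mem_singleton] at h2
            rcases h2 with rfl | rfl
            · simp [hβ]
            · have : ¬ φ.active γ = true := fun hγ => hwac.1 ⟨hγ, hβ⟩
              simp [hβ, this]
          · exact conclusions_snd he h2 hand
        simp only [trackLocal, if_true, hlev, if_false, hsnd, Option.map_some]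
    · rintro ⟨rfl, hpr'⟩
      obtain rfl : γ = var x := Option.some.inj (hpr.symm.trans hpr')
      rcases ht with ⟨h1, -⟩ | ⟨-, h2⟩
      · exact absurd rfl h1
      · have hsnd := conclusions_snd he h2 (by simp)
        refine ⟨by simp [hitLocal, unfoldLevel, hj], ?_⟩
        have h3 : (2 * j + 1) % 2 = 1 := by omega
        have h4 : (2 * j + 1) / 2 = j := by omega
        simp [freshLocal, unfoldLevel, hsnd, hj, h3, h4]
  · refine ⟨fun y => (modalNext d.1 d.2 y.1).map fun α => (α, y.2), fun _ => false, [],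
      rfl, rfl, by simp [ht], ?_⟩
    rintro ⟨-, hpr'⟩
    simp [hpr] at hpr'

/-- No thread in a winning set unfolds a `μ`-variable infinitely often and otherwise only
variables bound in its body. -/
theorem WinSet.false_of_thread (h : φ.WinSet σ R) (hcl : φ.Closed) (hn : φ.bound.Nodup) {x : X}
    {ψ : Formula P A X} (hx : fix .mu x ψ ∈ φ.subs) {F : Set X} (hF : ∀ y ∈ ψ.fv, y ∈ F)
    {g : ℕ → PNode P A X × Formula P A X} (hg0 : (g 0).2 = ψ)
    (hg : ∀ n, φ.ThreadStep σ R F (g n) (g (n + 1)) ∨ φ.UnfoldStep σ R x (g n) (g (n + 1)))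
    (hf : ∃ᶠ n in atTop, φ.UnfoldStep σ R x (g n) (g (n + 1))) : False := by
  have hg' : ∀ n, φ.ThreadStep σ R ∅ (g n) (g (n + 1)) := fun n =>
    (hg n).elim (fun h => ⟨h.1, h.2.1, h.2.2.1, fun y hy => absurd hy (Set.notMem_empty y)⟩)
      fun h => h.2.2
  choose π hπ htr using fun n => (hg' n).2.2.1
  have hR : ∀ n, (g n).1 ∈ R := fun n => (hg' n).1
  have hmem : ∀ n, (g n).2 ∈ (g n).1.1 := fun n => (hg' n).2.1
  have hψφ := body_mem_subs hx
  -- The thread could leave `ψ` only by unfolding a free variable of `ψ`; apart from `x` itself,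
  -- this is forbidden as these variables are in `F`.
  have hψ : ∀ n, (g n).2 ∈ ψ.subs := by
    intro n
    induction n with
    | zero => rw [hg0]; exact self_mem_subs _
    | succ n ih =>
      rcases (htr n).fStep (subs_trans hψφ ih) with h1 | ⟨η, y, h1, h2⟩
      · exact subs_trans ih h1
      · by_cases hyx : y = x
        · subst hyx
          obtain ⟨-, h3⟩ := fix_unique hn hx h2
          rw [← h3]; exact self_mem_subs _
        · rw [h1] at ih
          rcases scope ih (z := y) (by simp [fv]) with h3 | ⟨ξ, χ, h3, -⟩
          · rcases hg n with h4 | h4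
            · rcases htr n with ⟨γ, e, hpr, -, -, ⟨-, h5⟩ | ⟨h5, -⟩⟩ | ⟨d, -, -, -, h5⟩
              · rwa [h5, h1]
              · exact absurd ⟨h1, by rw [hpr, ← h5, h1]⟩ (h4.2.2.2 y (hF y h3))
              · simp [h1, modalNext] at h5
            · have h5 := h4.1
              rw [h1] at h5
              exact absurd (var.inj h5) hyx
          · obtain ⟨-, h4⟩ := fix_unique hn h2 (subs_trans hψφ h3)
            rw [h4]; exact body_mem_subs h3
  have hfs : ∀ n, φ.FStep (g n).2 (g (n + 1)).2 := fun n =>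
    (htr n).fStep (subs_trans hψφ (hψ n))
  have hpath : ∀ n, ReflTransGen (fun α β => φ.FStep α β ∧ α ∈ ψ.subs) (g n).2 (var x) := by
    intro n
    obtain ⟨k, hk, hkn⟩ := (hf.and_eventually (eventually_ge_atTop n)).exists
    obtain ⟨j, rfl⟩ := Nat.exists_eq_add_of_le hkn
    rw [← hk.1]
    clear hk hkn
    induction j with
    | zero => exact .refl
    | succ j ih => exact ih.tail ⟨hfs _, hψ _⟩
  obtain ⟨j, hj⟩ : ∃ j, φ.level x = 2 * j + 1 := by
    have := (level_mod hn hx).2 rfl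
    exact ⟨φ.level x / 2, by omega⟩
  choose track hit fresh h1 h2 h3 h4 using fun n =>
    h.track hcl hn hx hj (hR n) (hmem n) (htr n) (hψ n) (hψ (n + 1)) (hpath (n + 1))
  simp only at h1 h2
  set q := φ.subs.toFinset.card * φ.numLevels with hq
  have hlen : ∀ n, (g n).1.2.length ≤ q := fun n =>
    length_le_of_mem_permNodes (h.nodes _ (hR n))
  obtain ⟨n0, hn0⟩ := hf.exists
  -- The first unfolding of `x` supplies the entry as a fresh one, unless it is already present;
  -- from then on it is tracked.
  have htrk : ∀ n > n0, ((g n).2, j) ∈ (g n).1.2 := by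
    intro n hn
    induction n, hn using Nat.le_induction with
    | base =>
      rw [h2 n0]
      exact mem_nextPerm_of_fresh (h4 n0 ⟨hn0.1, hn0.2.1⟩).2
    | succ n hn ih => exact (idxOf_track (hlen n) ih (h3 n) (h2 n).symm (h1 n).symm).1
  obtain ⟨idx, hidx⟩ : ∃ idx : ℕ → ℕ, ∀ n > n0, idx (n + 1) ≤ idx n ∧ (idx (n + 1) = idx n →
      (hit n ((g n).2, j) = true → 2 * (q - idx n) - 1 ≤ π n) ∧
      (Even (π n) → π n < 2 * (q - idx n) - 1)) :=
    ⟨fun n => @List.idxOf _ instBEqOfDecidableEq ((g n).2, j) (g n).1.2, fun n hn =>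
      (idxOf_track (hlen n) (htrk n hn) (h3 n) (h2 n).symm (h1 n).symm).2⟩
  -- An entry never moves backwards, so its place is eventually some constant `a`.
  obtain ⟨N, hN⟩ := eventually_const_of_antitone (a := fun k => idx (n0 + 1 + k))
    (antitone_nat_of_succ_le fun k => (hidx (n0 + 1 + k) (by omega)).1)
  replace hN : ∀ k ≥ N, idx (n0 + 1 + k) = idx (n0 + 1 + N) := hN
  generalize idx (n0 + 1 + N) = a at hN
  have hprio : ∀ n ≥ n0 + 1 + N, (hit n ((g n).2, j) = true → 2 * (q - a) - 1 ≤ π n) ∧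
      (Even (π n) → π n < 2 * (q - a) - 1) := by
    intro n hn
    obtain ⟨k, rfl⟩ := Nat.exists_eq_add_of_le hn
    have h5 := hN (N + k) (by omega)
    have h6 := hN (N + k + 1) (by omega)
    rw [show n0 + 1 + (N + k) = n0 + 1 + N + k by omega] at h5
    rw [show n0 + 1 + (N + k + 1) = n0 + 1 + N + k + 1 by omega] at h6
    have h7 := (hidx (n0 + 1 + N + k) (by omega)).2 (h6.trans h5.symm)
    rw [h5] at h7
    exact h7
  -- Now each unfolding of `x` has priority at least `2 * (q - a) - 1` and all even priorities lie
  -- below it, so no even `p` is the highest recurring one.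
  obtain ⟨p, hp, hp1, hp2⟩ := h.play (fun n => (g n).1) π (hR 0) hπ
  obtain ⟨n, ⟨hn, hle⟩, hnN⟩ :=
    ((hf.and_eventually hp2).and_eventually (eventually_ge_atTop (n0 + 1 + N))).exists
  obtain ⟨n', hn', hnN'⟩ := (hp1.and_eventually (eventually_ge_atTop (n0 + 1 + N))).exists
  have h5 := (hprio n hnN).1 (h4 n ⟨hn.1, hn.2.1⟩).1
  have h6 := (hprio n' hnN').2 (hn' ▸ hp)
  omega

end Formula

namespace Formula

open Filter Relation

variable {P : Type u} {A : Type v} {X : Type w} [DecidableEq P] [DecidableEq A] [DecidableEq X]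

variable {φ : Formula P A X} {σ : PNode P A X → ℕ × PNode P A X} {R : Set (PNode P A X)}
  {W : Type x}

/-! ### The model of a winning strategy -/

theorem mem_sem_iff_conjuncts {K : Kripke P A W} {i : X → Set W} {s : W} (γ : Formula P A X) :
    s ∈ γ.sem K i ↔ ∀ δ ∈ γ.conjuncts, s ∈ δ.sem K i := by
  induction γ with
  | and α β ih1 ih2 =>
    simp only [sem, conjuncts, List.mem_append, or_imp, forall_and, Set.mem_inter_iff, ih1, ih2]
  | _ => simp [conjuncts]

theorem mem_sem_of_isDisjunct {K : Kripke P A W} {i : X → Set W} {s : W} {ξ : Formula P A X}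
    (χ : Formula P A X) : isDisjunct ξ χ = true → s ∈ ξ.sem K i → s ∈ χ.sem K i := by
  induction χ with
  | or α β ih1 ih2 =>
    intro h hs
    simp only [isDisjunct, Bool.or_eq_true, decide_eq_true_eq] at h
    rcases h with (h | h) | h
    · exact h ▸ hs
    · exact Or.inl (ih1 h hs)
    · exact Or.inr (ih2 h hs)
  | _ => intro h hs; simp only [isDisjunct, decide_eq_true_eq] at h; exact h ▸ hs

theorem fv_conjuncts_subset (γ : Formula P A X) : ∀ δ ∈ γ.conjuncts, δ.fv ⊆ γ.fv := by
  induction γ with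
  | and α β ih1 ih2 =>
    intro δ hδ
    rcases List.mem_append.1 hδ with hδ | hδ
    · exact (ih1 δ hδ).trans Finset.subset_union_left
    · exact (ih2 δ hδ).trans Finset.subset_union_right
  | _ => intro δ hδ; simp only [conjuncts, List.mem_singleton] at hδ; rw [hδ]

/-- The Kripke structure on the saturated nodes named by `st`. -/
def winKripke (φ : Formula P A X) (σ : PNode P A X → ℕ × PNode P A X) (st : W → PNode P A X) :
    Kripke P A W where
  rel a s t := ∃ d ∈ (st s).1.biUnion diamonds, d.1 = a ∧
    φ.Saturates σ (φ.modalMove (st s) d).2 (st t)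
  val p := {s | prop p ∈ (st s).1}

/-- The variables in `F` are true where threads from `ψ` at `v` reach them. -/
def ExitsTrue (φ : Formula P A X) (σ : PNode P A X → ℕ × PNode P A X) (R : Set (PNode P A X))
    (st : W → PNode P A X) (F : Set X) (i : X → Set W) (v : PNode P A X) (ψ : Formula P A X) :
    Prop :=
  ∀ y ∈ F, ∀ v', ReflTransGen (φ.ThreadStep σ R F) (v, ψ) (v', var y) →
    ∀ s, φ.Saturates σ v' (st s) → s ∈ i y

theorem WinSet.modal_thread (h : φ.WinSet σ R) (F : Set X) {v s : PNode P A X} (hv : v ∈ R)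
    (hs : φ.Saturates σ v s) {α β : Formula P A X} (hα : α ∈ v.1) (hr : α.reducible = false)
    {d : A × Formula P A X} (hd : d ∈ s.1.biUnion diamonds)
    (hβ : modalNext d.1 d.2 α = some β) :
    ReflTransGen (φ.ThreadStep σ R F) (v, α) ((φ.modalMove s d).2, β) := by
  have h1 := h.persist F hs hv hα hr
  obtain ⟨h2, h3⟩ := h.thread_mem h1 hv hα
  refine h1.tail ⟨h2, h3, ⟨_, h.conforms_modal h2 hs.2 hd, Or.inr ⟨d, hs.2, hd, rfl, hβ⟩⟩, ?_⟩
  rintro y - ⟨-, hy⟩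
  simp [hs.2] at hy

theorem WinSet.exists_rel (h : φ.WinSet σ R) (hcl : φ.Closed) (hn : φ.bound.Nodup)
    (hg : φ.Guarded) {st : W → PNode P A X} (hst : ∀ v ∈ φ.permNodes, ∃ s, st s = v)
    {v : PNode P A X} (hv : v ∈ R) {s : W} (hs : φ.Saturates σ v (st s)) {d : A × Formula P A X}
    (hd : d ∈ (st s).1.biUnion diamonds) :
    ∃ t, (winKripke φ σ st).rel d.1 s t ∧ φ.Saturates σ (φ.modalMove (st s) d).2 (st t) := by
  have hsR := h.mem_of_saturates hv hs
  have hR := h.step _ hsR _ (h.conforms_modal hsR hs.2 hd)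
  obtain ⟨u, hu⟩ := h.exists_saturates hcl hn hg hR
  obtain ⟨t, rfl⟩ := hst u (h.nodes _ (h.mem_of_saturates hR hu))
  exact ⟨t, ⟨d, hd, rfl, hu⟩, hu⟩

/-- All formulas in the label of a node are true at the saturated node that it leads to. -/
theorem WinSet.truth (h : φ.WinSet σ R) (hcl : φ.Closed) (hn : φ.bound.Nodup)
    (hg : φ.Guarded) {st : W → PNode P A X} (hst : ∀ v ∈ φ.permNodes, ∃ s, st s = v)
    (ψ : Formula P A X) : ψ ∈ φ.subs → ∀ F : Set X, (∀ y ∈ ψ.fv, y ∈ F) →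
      (∀ y ∈ F, y ∉ ψ.bound) → ∀ (i : X → Set W) (v : PNode P A X), v ∈ R → ψ ∈ v.1 →
      φ.ExitsTrue σ R st F i v ψ → ∀ s, φ.Saturates σ v (st s) →
      s ∈ ψ.sem (winKripke φ σ st) i := by
  -- Structural induction would not suffice: a modal group passes at once to formulas below its
  -- nested conjuncts.
  induction hsz : ψ.size using Nat.strong_induction_on generalizing ψ with
  | _ n IH =>
  intro hψ F hF hB i v hv hψv hex s hs
  have ih : ∀ β v', β ∈ ψ.subs → β.size < ψ.size → β.fv ⊆ ψ.fv →
      ReflTransGen (φ.ThreadStep σ R F) (v, ψ) (v', β) →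
      ∀ t, φ.Saturates σ v' (st t) → t ∈ β.sem (winKripke φ σ st) i := by
    intro β v' hβ hlt hfv hpath
    obtain ⟨h1, h2⟩ := h.thread_mem hpath hv hψv
    exact IH _ (hsz ▸ hlt) β rfl (subs_trans hψ hβ) F (fun y hy => hF y (hfv hy))
      (fun y hy hb => hB y hy ((bound_sublist hβ).subset hb)) i v' h1 h2
      fun y hy u hu => hex y hy u (hpath.trans hu)
  have hstep : ∀ v₁ v₂ p e β, (∀ y, ψ ≠ var y) →
      ReflTransGen (φ.ThreadStep σ R F) (v, ψ) (v₁, ψ) → v₁ ∈ R →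
      ψ ∈ v₁.1 → φ.principal v₁.1 = some ψ → e ∈ φ.conclusions ψ →
      φ.permGame.Conforms σ v₁ (p, v₂) → (p, v₂) = φ.localMove v₁ ψ e → β ∈ e.1 →
      ReflTransGen (φ.ThreadStep σ R F) (v, ψ) (v₂, β) := by
    intro v₁ v₂ p e β hvar h1 h2 h3 h4 h5 h6 h7 h8
    exact h1.tail ⟨h2, h3, ⟨p, h6, Or.inl ⟨ψ, e, h4, h5, h7, Or.inr ⟨rfl, h8⟩⟩⟩,
      fun y _ hy => hvar y hy.1⟩
  have hsR := h.mem_of_saturates hv hs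
  cases ψ with
  | bot =>
    have := h.not_clash hv
    rw [← Bool.not_eq_true] at this
    exact absurd (by simpa [clash] using ⟨bot, hψv, rfl⟩) this
  | top => trivial
  | prop p => exact (h.thread_mem (h.persist F hs hv hψv rfl) hv hψv).2
  | nprop p =>
    intro hp
    have h1 := (h.thread_mem (h.persist F hs hv hψv rfl) hv hψv).2
    have := h.not_clash hsR
    rw [← Bool.not_eq_true] at this
    refine this ?_
    simp only [clash, decide_eq_true_eq]
    exact ⟨prop p, hp, by simpa using h1⟩
  | var y => exact hex y (hF y (by simp [fv])) v .refl s hs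
  | and α β =>
    cases hgr : modalGroup (and α β) with
    | none =>
      obtain ⟨v₁, v₂, p, e, h1, h2, h3, h4, h5, h6, h7, h8⟩ :=
        h.expand F hs hv hψv (by simp [reducible, hgr])
      have hst' := fun β => hstep v₁ v₂ p e β (by simp) h1 h2 h3 h4 h5 h6 h7
      simp only [conclusions, List.mem_singleton] at h5
      subst h5
      exact ⟨ih α v₂ (by simp [subs, self_mem_subs]) (by simp only [size]; omega)
          Finset.subset_union_left (hst' α (by simp)) s h8,
        ih β v₂ (by simp [subs, self_mem_subs]) (by simp only [size]; omega)
          Finset.subset_union_right (hst' β (by simp)) s h8⟩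
    | some b =>
      obtain ⟨a, ds, χ⟩ := b
      have hr : (and α β).reducible = false := by simp [reducible, hgr]
      obtain ⟨hg1, hg2, hg3⟩ := modalGroup_eq_some hgr
      have hmt := fun d hd δ => h.modal_thread F (d := d) (β := δ) hv hs hψv hr hd
      have hγs := (h.thread_mem (h.persist F hs hv hψv hr) hv hψv).2
      have hχ := conjuncts_subset_subs _ _ hg1
      have hχsize := size_le_of_mem_subs hχ
      simp only [size] at hχsize
      have hξ : ∀ ξ ∈ ds, ∀ u, ReflTransGen (φ.ThreadStep σ R F) (v, and α β) (u, ξ) →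
          ∀ t, φ.Saturates σ u (st t) → t ∈ ξ.sem (winKripke φ σ st) i := by
        intro ξ hξ u
        have h1 := conjuncts_subset_subs _ _ (hg2 ξ hξ).1
        have h2 := size_le_of_mem_subs h1
        simp only [size] at h2
        exact ih ξ u (subs_trans h1 (by simp [subs, self_mem_subs])) (by simp only [size]; omega)
          (fv_conjuncts_subset _ (dia a ξ) (hg2 ξ hξ).1)
      rw [mem_sem_iff_conjuncts]
      intro δ hδ
      rcases hg3 δ hδ with ⟨ξ, hξds, rfl⟩ | rfl
      · have hd : (a, ξ) ∈ (st s).1.biUnion diamonds :=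
          Finset.mem_biUnion.2 ⟨_, hγs, by simp [diamonds, hgr, hξds]⟩
        obtain ⟨t, ht1, ht2⟩ := h.exists_rel hcl hn hg hst hv hs hd
        exact ⟨t, ht1, hξ ξ hξds _ (hmt _ hd ξ (by simp [modalNext, hgr, hξds])) t ht2⟩
      -- An edge stems from any diamond of the label. If its argument is one of the `ψᵢ`, the group
      -- continues as that disjunct; otherwise it continues as the whole disjunction.
      · rintro t ⟨d, hd, rfl, ht⟩
        by_cases hds : d.2 ∈ ds
        · exact mem_sem_of_isDisjunct _ (hg2 _ hds).2
            (hξ _ hds _ (hmt _ hd _ (by simp [modalNext, hgr, hds])) t ht)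
        · exact ih χ _ (subs_trans hχ (by simp [subs, self_mem_subs])) (by simp only [size]; omega)
            (fv_conjuncts_subset _ (box _ χ) hg1) (hmt _ hd _ (by simp [modalNext, hgr, hds])) t ht
  | or α β =>
    obtain ⟨v₁, v₂, p, e, h1, h2, h3, h4, h5, h6, h7, h8⟩ := h.expand F hs hv hψv rfl
    have hst' := fun β => hstep v₁ v₂ p e β (by simp) h1 h2 h3 h4 h5 h6 h7
    simp only [conclusions, List.mem_cons, List.not_mem_nil, or_false] at h5
    rcases h5 with rfl | rfl
    · exact Or.inl (ih α v₂ (by simp [subs, self_mem_subs]) (by simp only [size]; omega)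
          Finset.subset_union_left (hst' α (by simp)) s h8)
    · exact Or.inr (ih β v₂ (by simp [subs, self_mem_subs]) (by simp only [size]; omega)
          Finset.subset_union_right (hst' β (by simp)) s h8)
  | dia a ξ =>
    have hγs := (h.thread_mem (h.persist F hs hv hψv rfl) hv hψv).2
    have hd : (a, ξ) ∈ (st s).1.biUnion diamonds :=
      Finset.mem_biUnion.2 ⟨_, hγs, by simp [diamonds]⟩
    obtain ⟨t, ht1, ht2⟩ := h.exists_rel hcl hn hg hst hv hs hd
    exact ⟨t, ht1, ih ξ _ (by simp [subs, self_mem_subs]) (by simp only [size]; omega) subset_rfl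
      (h.modal_thread F hv hs hψv rfl hd (by simp [modalNext])) t ht2⟩
  | box a χ =>
    rintro t ⟨d, hd, rfl, ht⟩
    exact ih χ _ (by simp [subs, self_mem_subs]) (by simp only [size]; omega) subset_rfl
      (h.modal_thread F hv hs hψv rfl hd (by simp [modalNext])) t ht
  | fix η x ψ =>
    obtain ⟨v₁, v₂, p, e, h1, h2, h3, h4, h5, h6, h7, h8⟩ := h.expand F hs hv hψv rfl
    have hst' := fun β => hstep v₁ v₂ p e β (by simp) h1 h2 h3 h4 h5 h6 h7
    simp only [conclusions, List.mem_singleton] at h5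
    subst h5
    have hpath := hst' ψ (by simp)
    have hxF : x ∉ F := fun hx => hB x hx (by simp [bound])
    have hψφ := body_mem_subs hψ
    have hFF : F ⊆ insert x F := Set.subset_insert x F
    have hF' : ∀ y ∈ ψ.fv, y ∈ insert x F := fun y hy => by
      by_cases hyx : y = x
      · exact Or.inl hyx
      · exact Or.inr (hF y (by simp [fv, hy, hyx]))
    have hB' : ∀ y ∈ insert x F, y ∉ ψ.bound := fun y hy => by
      rcases hy with rfl | hy
      · exact not_mem_bound_body hn hψ
      · exact fun hb => hB y hy (by simp [bound, hb])
    have ih' := IH ψ.size (by rw [← hsz]; simp only [size]; omega) ψ rfl hψφ (insert x F) hF' hB'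
    -- The invariant that is restored each time the fixpoint is unfolded.
    let good : PNode P A X → Prop := fun u => u ∈ R ∧ ψ ∈ u.1 ∧ φ.ExitsTrue σ R st F i u ψ
    have hgood : good v₂ := by
      obtain ⟨h9, h10⟩ := h.thread_mem hpath hv hψv
      exact ⟨h9, h10, fun y hy u hu => hex y hy u (hpath.trans hu)⟩
    -- Once a thread has arrived at `x`, the variable is unfolded before saturation. As `x ∉ F`,
    -- this continues the thread with respect to `F`, so the exits of the new thread are exits of
    -- the old one.
    have hnext : ∀ u, good u → ∀ u', ReflTransGen (φ.ThreadStep σ R (insert x F)) (u, ψ)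
        (u', var x) → ∀ t, φ.Saturates σ u' (st t) → ∃ u₁ u₂,
        ReflTransGen (φ.ThreadStep σ R (insert x F)) (u, ψ) (u₁, var x) ∧
        φ.UnfoldStep σ R x (u₁, var x) (u₂, ψ) ∧ φ.Saturates σ u₂ (st t) ∧ good u₂ := by
      intro u hu u' hp t ht
      obtain ⟨k1, k2⟩ := h.thread_mem hp hu.1 hu.2.1
      obtain ⟨u₁, u₂, p, e, m1, m2, m3, m4, m5, m6, m7, m8⟩ :=
        h.expand (insert x F) ht k1 k2 rfl
      simp only [conclusions, binder_eq_some hn hψ, List.mem_singleton] at m5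
      have hstp : ∀ G : Set X, x ∉ G → φ.ThreadStep σ R G (u₁, var x) (u₂, ψ) := fun G hG =>
        ⟨m2, m3, ⟨p, m6, Or.inl ⟨var x, e, m4, by simp [conclusions, binder_eq_some hn hψ, m5],
          m7, Or.inr ⟨rfl, by simp [m5]⟩⟩⟩, fun y hy hy' => hG (var.inj hy'.1 ▸ hy)⟩
      have hpu := hp.trans m1
      have hpF := (ThreadStep.mono hFF hpu).tail (hstp F hxF)
      obtain ⟨k3, k4⟩ := h.thread_mem hpF hu.1 hu.2.1
      exact ⟨u₁, u₂, hpu, ⟨rfl, m4, hstp ∅ (Set.notMem_empty x)⟩, m8, k3, k4,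
        fun y hy z hz => hu.2.2 y hy z (hpF.trans hz)⟩
    cases η with
    | nu =>
      -- States reached from good nodes form a post-fixpoint: threads that come back to `x` produce
      -- good nodes again.
      refine ⟨{t | ∃ u, good u ∧ φ.Saturates σ u (st t)}, ?_, v₂, hgood, h8⟩
      rintro t ⟨u, hu, hut⟩
      refine ih' _ u hu.1 hu.2.1 (fun y hy u' hp t' ht' => ?_) t hut
      by_cases hyx : y = x
      · subst hyx
        obtain ⟨u₁, u₂, -, -, k1, k2⟩ := hnext u hu u' hp t' ht'
        rw [Function.update_self]
        exact ⟨u₂, k2, k1⟩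
      · rw [Function.update_of_ne hyx]
        exact hu.2.2 y (hy.resolve_left hyx) u' (ThreadStep.mono hFF hp) t' ht'
    | mu =>
      intro S hS
      by_contra hsS
      -- Good nodes from which a state outside the pre-fixpoint `S` is reached. The body is false
      -- there, so some exit fails; it can only be `x`, and its unfolding is again in `Z`.
      -- Repetition gives the thread that `false_of_thread` excludes.
      let Z : Set (PNode P A X × Formula P A X) :=
        {a | a.2 = ψ ∧ good a.1 ∧ ∃ t, t ∉ S ∧ φ.Saturates σ a.1 (st t)}
      have hZ : ∀ a ∈ Z, ∃ b c, ReflTransGen (φ.ThreadStep σ R (insert x F)) a b ∧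
          φ.UnfoldStep σ R x b c ∧ c ∈ Z := by
        rintro ⟨u, χ⟩ ⟨hχ, hu, t, htS, hut⟩
        simp only at hχ hu hut
        subst hχ
        have hnot : ¬ φ.ExitsTrue σ R st (insert x F) (Function.update i x S) u χ :=
          fun hexu => htS (hS (ih' _ u hu.1 hu.2.1 hexu t hut))
        simp only [ExitsTrue, not_forall] at hnot
        obtain ⟨y, hy, u', hp, t', ht', hnS⟩ := hnot
        by_cases hyx : y = x
        · subst hyx
          rw [Function.update_self] at hnS
          obtain ⟨u₁, u₂, k1, k2, k3, k4⟩ := hnext u hu u' hp t' ht'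
          exact ⟨_, _, k1, k2, rfl, k4, t', hnS, k3⟩
        · rw [Function.update_of_ne hyx] at hnS
          exact absurd
            (hu.2.2 y (hy.resolve_left hyx) u' (ThreadStep.mono hFF hp) t' ht') hnS
      obtain ⟨g, hg0, hg1, hg2⟩ := exists_path hZ (a := (v₂, ψ)) ⟨rfl, hgood, s, hsS, h8⟩
      exact h.false_of_thread hcl hn hψ hF' (by rw [hg0]) hg1 hg2

/-- The states number all nodes of the game, so the model is finite; indices in a lifted `Fin` let
it live in any universe. -/
theorem satisfiable_of_eloiseWins (hcl : φ.Closed) (hn : φ.bound.Nodup) (hg : φ.Guarded)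
    (hw : φ.WeaklyAconjunctive) (hwin : φ.permGame.EloiseWins φ.startNode) :
    Satisfiable.{u, v, w, x} φ := by
  obtain ⟨σ, R, h, hstart⟩ := exists_winSet hw hwin
  let st : ULift.{x} (Fin φ.permNodes.card) → PNode P A X :=
    fun s => (φ.permNodes.equivFin.symm s.down).1
  have hst : ∀ v ∈ φ.permNodes, ∃ s, st s = v := fun v hv =>
    ⟨⟨φ.permNodes.equivFin ⟨v, hv⟩⟩, by simp [st]⟩
  obtain ⟨u, hu⟩ := h.exists_saturates hcl hn hg hstart
  obtain ⟨s, rfl⟩ := hst u (h.nodes _ (h.mem_of_saturates hstart hu))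
  refine ⟨_, winKripke φ σ st, fun _ => ∅, s, ?_⟩
  exact h.truth hcl hn hg hst φ (self_mem_subs φ) ∅ (by rw [Closed] at hcl; simp [hcl]) (by simp)
    _ φ.startNode hstart (by simp [startNode])
    (fun y hy => absurd hy (Set.notMem_empty y)) s hu

end Formula

/-! ### The size of the permutation game -/

/-- The ratio `(s * L)! / s!` grows with `s`: passing to `s + 1` multiplies `(s * L)!` by at least
`s + 1`. -/
theorem factorial_mul_factorial_le {L : ℕ} (hL : 1 ≤ L) {j s : ℕ} (h : j ≤ s) :
    s.factorial * (j * L).factorial ≤ j.factorial * (s * L).factorial := by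
  induction s, h using Nat.le_induction with
  | base => exact le_rfl
  | succ s hs ih =>
    obtain ⟨L, rfl⟩ := Nat.exists_eq_add_of_le' hL
    have h1 : (s + 1) * (s * (L + 1)).factorial ≤ ((s + 1) * (L + 1)).factorial := by
      rw [show (s + 1) * (L + 1) = (s * (L + 1) + L) + 1 by ring, Nat.factorial_succ]
      refine Nat.mul_le_mul ?_ (Nat.factorial_le (by omega))
      have := Nat.le_mul_of_pos_right s (Nat.succ_pos L)
      simp only [Nat.succ_eq_add_one] at this
      omega
    calc (s + 1).factorial * (j * (L + 1)).factorial
        = (s + 1) * (s.factorial * (j * (L + 1)).factorial) := by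
          rw [Nat.factorial_succ]; ring
      _ ≤ (s + 1) * (j.factorial * (s * (L + 1)).factorial) := Nat.mul_le_mul_left _ ih
      _ = j.factorial * ((s + 1) * (s * (L + 1)).factorial) := by ring
      _ ≤ _ := Nat.mul_le_mul_left _ h1

/-- The `j`-th term is at most `(s * L)! / (s - j)!`, and the sum of inverse factorials is at most
`e < 3`. -/
theorem sum_choose_mul_factorial_le {L : ℕ} (hL : 1 ≤ L) (s : ℕ) :
    ∑ j ∈ Finset.range (s + 1), s.choose j * (j * L).factorial ≤ 3 * (s * L).factorial := by
  have hterm : ∀ j ∈ Finset.range (s + 1), ((s.choose j * (j * L).factorial : ℕ) : ℝ) ≤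
      (s * L).factorial * (1 / (s - j).factorial : ℝ) := by
    intro j hj
    have hj : j ≤ s := Nat.lt_succ_iff.1 (Finset.mem_range.1 hj)
    rw [mul_one_div, le_div_iff₀ (by positivity)]
    have h1 := Nat.choose_mul_factorial_mul_factorial hj
    have h2 := factorial_mul_factorial_le hL hj
    rw [← h1] at h2
    have h3 : s.choose j * (j * L).factorial * (s - j).factorial ≤ (s * L).factorial := by
      refine Nat.le_of_mul_le_mul_left ?_ (Nat.factorial_pos j)
      calc _ = s.choose j * j.factorial * (s - j).factorial * (j * L).factorial := by ring
        _ ≤ _ := h2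
    exact_mod_cast h3
  have hsum : ((∑ j ∈ Finset.range (s + 1), s.choose j * (j * L).factorial : ℕ) : ℝ) ≤
      3 * (s * L).factorial := by
    rw [Nat.cast_sum]
    refine (Finset.sum_le_sum hterm).trans ?_
    rw [← Finset.mul_sum, mul_comm]
    refine mul_le_mul_of_nonneg_right ?_ (by positivity)
    have h1 : ∑ j ∈ Finset.range (s + 1), (1 / (s - j).factorial : ℝ) =
        ∑ j ∈ Finset.range (s + 1), (1 : ℝ) ^ j / j.factorial := by
      rw [← Finset.sum_range_reflect]
      refine Finset.sum_congr rfl fun j hj => ?_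
      have hj : j ≤ s := Nat.lt_succ_iff.1 (Finset.mem_range.1 hj)
      rw [one_pow, show s - (s + 1 - 1 - j) = j by omega]
    rw [h1]
    exact (Real.sum_le_exp_of_nonneg zero_le_one _).trans Real.exp_one_lt_three.le
  exact_mod_cast hsum

theorem card_lists {T : Type x} (s : Multiset T) :
    Multiset.card s.lists = (Multiset.card s).factorial := by
  induction s using Quotient.inductionOn with
  | h l => simp [List.length_permutations]

theorem card_pperm_le {T : Type x} [DecidableEq T] (U : Finset T) :
    (pperm U).card ≤ 3 * U.card.factorial := by
  calc (pperm U).card ≤ ∑ S ∈ U.powerset, S.card.factorial := by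
        refine Finset.card_biUnion_le.trans (Finset.sum_le_sum fun S _ => ?_)
        exact (Multiset.toFinset_card_le _).trans (card_lists S.val).le
    _ = ∑ j ∈ Finset.range (U.card + 1), U.card.choose j * (j * 1).factorial := by
        rw [Finset.sum_powerset_apply_card]
        simp
    _ ≤ 3 * U.card.factorial := by simpa using sum_choose_mul_factorial_le le_rfl U.card

theorem two_pow_le_two_mul_factorial (n : ℕ) : 2 ^ n ≤ 2 * n.factorial := by
  induction n with
  | zero => simp
  | succ n ih =>
    rcases n with _ | n
    · simp
    · rw [pow_succ, Nat.factorial_succ]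
      have := Nat.mul_le_mul_right (n + 1).factorial (show 2 ≤ n + 1 + 1 by omega)
      omega

namespace Formula

variable {P : Type u} {A : Type v} {X : Type w}

theorem length_subs (φ : Formula P A X) : φ.subs.length = φ.size := by
  induction φ <;> simp_all [subs, size]

variable [DecidableEq P] [DecidableEq A] [DecidableEq X]

theorem card_subs_le (φ : Formula P A X) : φ.subs.toFinset.card ≤ φ.size :=
  (List.toFinset_card_le _).trans φ.length_subs.le

/-- The constant is `3 * 3`: one factor for the partial permutations at a fixed label, another for
the sum over all labels. -/
theorem card_permNodes_le (φ : Formula P A X) :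
    φ.permNodes.card ≤ 9 * (φ.size * max 1 φ.ad).factorial := by
  have hs := φ.card_subs_le
  generalize hS : φ.subs.toFinset = S at hs
  have h1 : φ.permNodes.card ≤
      3 * ∑ j ∈ Finset.range (S.card + 1), S.card.choose j * (j * φ.numLevels).factorial := by
    calc φ.permNodes.card ≤ ∑ U ∈ S.powerset, 3 * (U.card * φ.numLevels).factorial := by
          rw [permNodes, hS]
          refine Finset.card_biUnion_le.trans (Finset.sum_le_sum fun U _ => ?_)
          refine Finset.card_image_le.trans ((card_pperm_le _).trans ?_)
          rw [levelled, Finset.card_product, Finset.card_range]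
      _ = _ := by
          rw [← Finset.mul_sum,
            Finset.sum_powerset_apply_card (fun j => (j * φ.numLevels).factorial)]
          simp
  rcases Nat.eq_zero_or_pos φ.numLevels with h0 | hpos
  -- Without odd levels all lists are empty, and only the `2 ^ S.card` labels count.
  · have h2 : ∑ j ∈ Finset.range (S.card + 1), S.card.choose j * (j * φ.numLevels).factorial =
        2 ^ S.card := by simp [h0, Nat.sum_range_choose]
    have h3 := two_pow_le_two_mul_factorial S.card
    have h4 := Nat.factorial_le (hs.trans (Nat.le_mul_of_pos_right _ (by omega)) :
      S.card ≤ φ.size * max 1 φ.ad)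
    omega
  · have h2 := sum_choose_mul_factorial_le hpos S.card
    have h3 : φ.numLevels ≤ max 1 φ.ad := by rw [numLevels]; omega
    have h4 := Nat.factorial_le (Nat.mul_le_mul hs h3)
    omega

theorem permMove_priority_lt (φ : Formula P A X) {v : PNode P A X} {m : ℕ × PNode P A X}
    (hm : m ∈ φ.permMoves v) : m.1 < 9 * (φ.size * max 1 φ.ad) := by
  have h1 : φ.numLevels ≤ max 1 φ.ad := by rw [numLevels]; omega
  have h2 := Nat.mul_le_mul φ.card_subs_le h1
  have h3 : 0 < φ.size * max 1 φ.ad := Nat.mul_pos φ.size_pos (by omega)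
  have h4 : m.1 ≤ 2 * (φ.subs.toFinset.card * φ.numLevels) := by
    unfold permMoves at hm
    split_ifs at hm
    · simp at hm
    split at hm
    · simp only [List.mem_toFinset, List.mem_map] at hm
      obtain ⟨c, -, rfl⟩ := hm
      exact permPriority_le _ v.2 _ _
    · simp only [Finset.mem_image] at hm
      obtain ⟨d, -, rfl⟩ := hm
      exact permPriority_le _ v.2 _ fun _ => false
  omega

-- Assembling the equivalences.

theorem startNode_mem (φ : Formula P A X) : φ.startNode ∈ φ.permGame.nodes := by
  show φ.startNode ∈ φ.permNodes
  rw [mem_permNodes, mem_pperm]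
  simp [startNode, self_mem_subs]

theorem solve_iff_eloiseWins (φ : Formula P A X) :
    φ.permGame.solve φ.startNode = true ↔ φ.permGame.EloiseWins φ.startNode :=
  ⟨φ.permGame.eloiseWins_of_solve φ.startNode_mem, φ.permGame.solve_of_eloiseWins φ.startNode_mem⟩

/-- A model only defeats Abelard's positional strategies; determinacy, in the form of the answer of
the algorithm, turns this into a memoryless strategy for Eloise. -/
theorem eloiseWins_iff_satisfiable {φ : Formula P A X} (hcl : φ.Closed) (hg : φ.Guarded)
    (hclean : φ.Clean) (hw : φ.WeaklyAconjunctive) :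
    φ.permGame.EloiseWins φ.startNode ↔ Satisfiable.{u, v, w, x} φ :=
  ⟨satisfiable_of_eloiseWins hcl hclean.1 hg hw,
    fun h => φ.solve_iff_eloiseWins.1 (solve_of_satisfiable hcl hclean.1 h)⟩

end Formula

end MuCalc

theorem mainTheorem8 :
    ∃ C : ℕ, ∀ (P : Type*) (A : Type*) (X : Type*)
      [DecidableEq P] [DecidableEq A] [DecidableEq X] (φ : MuCalc.Formula P A X),
      φ.Closed → φ.Guarded → φ.Clean → φ.Irredundant → φ.WeaklyAconjunctive →
        φ.permGame.nodes.card ≤ C * (φ.size * max 1 φ.ad).factorial ∧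
        (∀ v ∈ φ.permGame.nodes, ∀ m ∈ φ.permGame.moves v, m.1 < C * (φ.size * max 1 φ.ad)) ∧
        φ.startNode ∈ φ.permGame.nodes ∧
        (φ.permGame.EloiseWins φ.startNode ↔ φ.Satisfiable) ∧
        (φ.permGame.solve φ.startNode = true ↔ φ.permGame.EloiseWins φ.startNode) ∧
        (φ.decideSat = true ↔ φ.Satisfiable) := by
  -- The number of nodes dictates `9`; priorities are at most twice the maximal length of the lists.
  refine ⟨9, fun P A X _ _ _ φ hcl hg hclean _ hw => ?_⟩
  exact ⟨φ.card_permNodes_le, fun v _ m hm => φ.permMove_priority_lt hm, φ.startNode_mem,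
    MuCalc.Formula.eloiseWins_iff_satisfiable hcl hg hclean hw, φ.solve_iff_eloiseWins,
    φ.solve_iff_eloiseWins.trans (MuCalc.Formula.eloiseWins_iff_satisfiable hcl hg hclean hw)⟩
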